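/- Let $d\in\{2,3\}$ and let $D\subset\mathbb R^d$ be a bounded open set with $C^1$ boundary. Let $W=H^2(D;\mathbb R^d)\cap H^1_0(D;\mathbb R^d)$ with the $H^2(D;\mathbb{R}^d)$ norm $\|\cdot\|_2$; fields in $W$ are extended by $0$ outside $D$. Let $f:[0,\infty)\to\mathbb R$ be smooth and concave, with $f(r)>0$ for $r>0$, $\lim_{r\to0^+}f(r)/r=f'(0)$, $\lim_{r\to\infty}f(r)=f_\infty<\infty$, and such that the derivatives of orders $1,\dots,4$ of $F_1(r)=f(r^2)$ are bounded on $\mathbb R$. Let $J:[0,\infty)\to\mathbb R$ be measurable with $0\le J\le M$ on $[0,1)$ and $J=0$ on $[1,\infty)$, and let $C_{\omega_1},C_{\omega_2}$ be real constants. For $0<\epsilon<1$, a boundary function is a continuous $\omega:\mathbb R^d\to[0,1]$ with $\omega=0$ on $\partial D$ and $\omega(x)=1$ for all $x\in D$ with $\mathrm{dist}(x,\partial D)\ge\epsilon$, such that for every $|\xi|<1$ the function $\bar\omega_\xi(x)=\omega(x)\omega(x+\epsilon\xi)$ is $C^2$ on $D$ with $|\nabla\bar\omega_\xi|\le C_{\omega_1}$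 and $|\nabla^2\bar\omega_\xi|\le C_{\omega_2}$ on $D$. For $y\neq x$ put $$S(y,x;u)=\frac{u(y)-u(x)}{|y-x|}\cdot\frac{y-x}{|y-x|},\qquad W^\epsilon(S,y-x)=\omega(x)\omega(y)\frac{J(|y-x|/\epsilon)}{\epsilon|y-x|}f(|y-x|S^2),$$ and, with $H_\epsilon(x)$ the open ball of radius $\epsilon$ about $x$ and $\omega_d$ the volume of the unit ball of $\mathbb R^d$, $$Q(v;u)(x)=\frac{2}{\epsilon^d\omega_d}\int_{H_\epsilon(x)}\partial_S^2W^\epsilon(S(y,x;u),y-x)\,S(y,x;v)\,\frac{y-x}{|y-x|}\,dy,\qquad x\in D.$$ Then there is a constant $L_6>0$, depending only on $d$, $D$, $f$, $J$, $M$, $C_{\omega_1}$ and $C_{\omega_2}$, such that for every $\epsilon\in(0,1)$, every boundary function $\omega$ as above and every $u\in W$ the following hold. For every $v\in W$ the integral defining $Q(v;u)(x)$ converges absolutely for all $x\in D$, and $Q(v;u)\in W$. For all $v,w\in W$, $$\|Q(v;u)-Q(w;u)\|_2\le\frac{L_6(1+\|u\|_2+\|u\|_2^2)}{\epsilon^3}\|v-w\|_2,$$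 and for all $v\in W$, $$\|Q(v;u)\|_2\le\frac{L_6(1+\|u\|_2+\|u\|_2^2)}{\epsilon^3}\|v\|_2 .$$ -/

import Mathlib

open MeasureTheory Filter Topology Set
open scoped ContDiff

namespace Peridynamics

/-- The Euclidean space `ℝ^d`. -/
abbrev E (d : ℕ) : Type := EuclideanSpace ℝ (Fin d)

/-- The `i`-th standard basis vector of `ℝ^d`. -/
noncomputable def basisVec {d : ℕ} (i : Fin d) : E d := EuclideanSpace.single i (1 : ℝ)

/-- The boundary of `D` is of class `C^1`: near each boundary point `p`, after a choice of a unit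
vector `n`, the set `D` is the part of a ball lying above the graph of a `C^1` function `γ` of the
component `x - ⟪n, x⟫ n` orthogonal to `n`. -/
def HasC1Boundary {d : ℕ} (D : Set (E d)) : Prop :=
  ∀ p ∈ frontier D, ∃ (n : E d) (r : ℝ) (γ : E d → ℝ), ‖n‖ = 1 ∧ 0 < r ∧ ContDiff ℝ 1 γ ∧
    D ∩ Metric.ball p r =
      {x | x ∈ Metric.ball p r ∧ γ (x - (inner ℝ n x : ℝ) • n) < inner ℝ n x}

/-! ### Sobolev spaces on `D` through weak derivatives -/

/-- `g` is the weak partial derivative `∂_i u` of `u` in the open set `D`. -/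
def HasWeakPartial {d : ℕ} (D : Set (E d)) (i : Fin d) (u g : E d → E d) : Prop :=
  LocallyIntegrableOn u D ∧ LocallyIntegrableOn g D ∧
    ∀ φ : E d → ℝ, ContDiff ℝ ∞ φ → HasCompactSupport φ → tsupport φ ⊆ D →
      ∫ x in D, (fderiv ℝ φ x (basisVec i)) • u x = - ∫ x in D, φ x • g x

open Classical in
/-- The weak partial derivative (unique up to null sets of `D`), with junk value `0` if there is
none. -/
noncomputable def weakPartial {d : ℕ} (D : Set (E d)) (i : Fin d) (u : E d → E d) : E d → E d :=
  if h : ∃ g, HasWeakPartial D i u g then h.choose else 0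

/-- `u ∈ L²(D; ℝ^d)`. -/
def MemL2 {d : ℕ} (D : Set (E d)) (u : E d → E d) : Prop :=
  MemLp u 2 (volume.restrict D)

/-- The norm of `L²(D; ℝ^d)`. -/
noncomputable def l2Norm {d : ℕ} (D : Set (E d)) (u : E d → E d) : ℝ :=
  (eLpNorm u 2 (volume.restrict D)).toReal

/-- `u ∈ H¹(D; ℝ^d)`. -/
def MemH1 {d : ℕ} (D : Set (E d)) (u : E d → E d) : Prop :=
  MemL2 D u ∧ ∀ i, ∃ g, HasWeakPartial D i u g ∧ MemL2 D g

/-- `u ∈ H²(D; ℝ^d)`: `u` and all its first weak partial derivatives are in `H¹(D; ℝ^d)`. -/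
def MemH2 {d : ℕ} (D : Set (E d)) (u : E d → E d) : Prop :=
  MemL2 D u ∧ ∀ i, ∃ g, HasWeakPartial D i u g ∧ MemH1 D g

/-- The norm of `H¹(D; ℝ^d)`. -/
noncomputable def h1Norm {d : ℕ} (D : Set (E d)) (u : E d → E d) : ℝ :=
  Real.sqrt (l2Norm D u ^ 2 + ∑ i, l2Norm D (weakPartial D i u) ^ 2)

/-- The norm of `H²(D; ℝ^d)`. -/
noncomputable def h2Norm {d : ℕ} (D : Set (E d)) (u : E d → E d) : ℝ :=
  Real.sqrt (l2Norm D u ^ 2 + ∑ i, l2Norm D (weakPartial D i u) ^ 2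
    + ∑ i, ∑ j, l2Norm D (weakPartial D j (weakPartial D i u)) ^ 2)

/-- `u ∈ H¹₀(D; ℝ^d)`: `u` is an `H¹`-limit of smooth fields with compact support in `D`. -/
def MemH10 {d : ℕ} (D : Set (E d)) (u : E d → E d) : Prop :=
  MemH1 D u ∧ ∀ δ : ℝ, 0 < δ → ∃ φ : E d → E d, ContDiff ℝ ∞ φ ∧ HasCompactSupport φ ∧
    tsupport φ ⊆ D ∧ h1Norm D (u - φ) < δ

/-- `W = H²(D; ℝ^d) ∩ H¹₀(D; ℝ^d)`. Only the values of a field on `D` matter. -/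
def MemW {d : ℕ} (D : Set (E d)) (u : E d → E d) : Prop :=
  MemH2 D u ∧ MemH10 D u

/-! ### The peridynamic model -/

/-- The class of potential functions `f`: smooth, positive and concave on `[0, ∞)`, with
`f(r)/r → f'(0)` as `r → 0+` and `f(r) → f_∞ < ∞` as `r → ∞`, such that `F₁(r) = f(r²)` has bounded
derivatives of orders one to four. -/
structure IsPotentialFunction (f : ℝ → ℝ) : Prop where
  smooth : ContDiffOn ℝ ∞ f (Ici 0)
  pos : ∀ r, 0 < r → 0 < f r
  concave : ConcaveOn ℝ (Ici 0) f
  slope_zero : Tendsto (fun r => f r / r) (𝓝[>] 0) (𝓝 (derivWithin f (Ici 0) 0))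
  limit_top : ∃ fInf : ℝ, Tendsto f atTop (𝓝 fInf)
  bounded_deriv : ∀ k : ℕ, 1 ≤ k → k ≤ 4 →
    ∃ C : ℝ, ∀ r : ℝ, |iteratedDeriv k (fun t : ℝ => f (t ^ 2)) r| ≤ C

/-- The influence function: `0 ≤ J ≤ M` on `[0, 1)` and `J = 0` on `[1, ∞)`. -/
structure IsInfluenceFunction (J : ℝ → ℝ) (M : ℝ) : Prop where
  meas : Measurable J
  nonneg : ∀ r, 0 ≤ r → r < 1 → 0 ≤ J r
  le : ∀ r, 0 ≤ r → r < 1 → J r ≤ M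
  zero : ∀ r, 1 ≤ r → J r = 0

/-- `x ↦ om(x) om(x + ε ξ)`. -/
def omegaBar {d : ℕ} (om : E d → ℝ) (ε : ℝ) (ξ x : E d) : ℝ := om x * om (x + ε • ξ)

/-- The boundary function `om`: it takes values in `[0, 1]`, equals `1` at the points of `D` of
distance at least `ε` from `∂D`, vanishes on `∂D`, and for all `ξ` in the unit ball
`x ↦ om(x) om(x + ε ξ)` has on `D` first and second derivatives bounded by `C₁` and `C₂`. -/
structure IsBoundaryFunction {d : ℕ} (D : Set (E d)) (ε C₁ C₂ : ℝ) (om : E d → ℝ) : Prop where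
  cont : Continuous om
  nonneg : ∀ x, 0 ≤ om x
  le_one : ∀ x, om x ≤ 1
  eq_one : ∀ x ∈ D, ε ≤ Metric.infDist x (frontier D) → om x = 1
  eq_zero : ∀ x ∈ frontier D, om x = 0
  smooth : ∀ ξ ∈ Metric.ball (0 : E d) 1, ContDiffOn ℝ 2 (omegaBar om ε ξ) D
  bound_fst : ∀ ξ ∈ Metric.ball (0 : E d) 1, ∀ x ∈ D, ‖fderiv ℝ (omegaBar om ε ξ) x‖ ≤ C₁
  bound_snd : ∀ ξ ∈ Metric.ball (0 : E d) 1, ∀ x ∈ D,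
    ‖iteratedFDeriv ℝ 2 (omegaBar om ε ξ) x‖ ≤ C₂

/-- The unit vector `e_{y-x} = (y - x)/|y - x|`. -/
noncomputable def dir {d : ℕ} (x y : E d) : E d := ‖y - x‖⁻¹ • (y - x)

/-- The linearized strain `S(y, x; u) = (u(y) - u(x))/|y - x| ⬝ (y - x)/|y - x|`. -/
noncomputable def strain {d : ℕ} (u : E d → E d) (y x : E d) : ℝ :=
  inner ℝ (‖y - x‖⁻¹ • (u y - u x)) (dir x y)

/-- The two-point potential
`W^ε(S, y - x) = om(x) om(y) J(|y - x|/ε) / (ε |y - x|) f(|y - x| S²)`. -/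
noncomputable def bondPotential {d : ℕ} (f J : ℝ → ℝ) (om : E d → ℝ) (ε : ℝ) (x y : E d)
    (S : ℝ) : ℝ :=
  om x * om y * (J (‖y - x‖ / ε) / (ε * ‖y - x‖)) * f (‖y - x‖ * S ^ 2)

/-- The integrand `∂²_S W^ε(S(y, x; u), y - x) S(y, x; v) e_{y-x}`. -/
noncomputable def bondForceDeriv {d : ℕ} (f J : ℝ → ℝ) (om : E d → ℝ) (ε : ℝ)
    (v u : E d → E d) (x y : E d) : E d :=
  (iteratedDeriv 2 (bondPotential f J om ε x y) (strain u y x) * strain v y x) • dir x y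

/-- The linearized peridynamic operator `Q(v; u)`, where the fields `u` and `v` on `D` are extended
by zero outside `D`. -/
noncomputable def Q {d : ℕ} (D : Set (E d)) (f J : ℝ → ℝ) (om : E d → ℝ) (ε : ℝ)
    (v u : E d → E d) (x : E d) : E d :=
  (2 / (ε ^ d * (volume (Metric.ball (0 : E d) 1)).toReal)) •
    ∫ y in Metric.ball x ε, bondForceDeriv f J om ε (D.indicator v) (D.indicator u) x y

end Peridynamics

/-! Substituting y = x + εξ turns the operator into a superposition of bonds: Q(v;u)(x) is 2/ω_d
times the integral over |ξ| < 1 of (J(|ξ|)/ε) ω̄_ξ(x) F(√r S_ξu(x)) S_ξv(x) e_ξ, where r = ε|ξ|, F =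
F₁'' and S_ξ is the strain along εξ (`bondForceDeriv_eq_bondField`, `Q_ae_eq`). It suffices to bound
the H² norm in x of a single bond by a multiple of r^(-7/4). That weight is integrable on the unit
ball since d ≥ 2, Minkowski's inequality (`LpLe.integral`) sums the bonds, and the total power of ε
is ε^(-1-7/4) = ε^(-11/4) ≤ ε^(-3).

For one bond put a = √r S_ξu and b = S_ξv. The second derivatives of F(a)b contain F''(a) ∂_i a ∂_j
a b and F'(a) ∂_i a ∂_j b. They lie in L² once gradients are in L⁴, second derivatives are in L² and
b is bounded. With 1/4-Hölder fields, ∇a costs r^(-1/2), ∇b costs r^(-1) and b itself r^(-3/4). The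
worst product is the first one, r^(-1/2-1/2-3/4) = r^(-7/4) (`HasSecondWeak.bond`, `kern_weakPD`).

The embeddings needed for H² ∩ H¹₀ are derived from the zero boundary values, without any extension
operator. Stampacchia's method gives the sup bound: testing with a truncation and using Sobolev into
L⁶, the measures of the superlevel sets decay with exponent 2 > 1 (`level_decay`,
`stampacchia_iteration`). Then the identity ∫(∂_i a)⁴ = -3∫ a (∂_i a)² ∂_ii a bounds the gradient in
L⁴ (`lintegral_pow_four_le`). The extension by zero therefore lies in W^{1,4} of the whole space,
and Morrey's inequality (`exists_morrey`) gives Hölder exponent 1 - d/4 ≥ 1/4.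

The obstacle is that the extension by zero is H¹ but in general not H²: its gradient may jump across
∂D, and the shift by εξ moves this jump into D. The jump is met only where x + εξ ∈ ∂D. There ω̄_ξ
vanishes, and since ω̄_ξ ≥ 0 its gradient vanishes as well. By `WeakPD.cutoff` a C¹ factor that
vanishes on the exceptional set lets a product be extended by zero across it. Applying this to ω̄_ξ
and to its partial derivatives gives two weak derivatives in D (`WeakPD.cutoff_two`).

Finally |Q| ≤ Cω with ω continuous and zero on ∂D, so truncating the small values of Q leaves
functions supported in compact subsets of D, and Q lies in H¹₀ (`isH10_of_abs_le`). As Q is linear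
in v, the Lipschitz estimate is the norm estimate for v - w. -/

namespace Peridynamics

/-! ### Mollification and its compatibility with weak derivatives -/

variable {d : ℕ} {F : Type*} [NormedAddCommGroup F] [NormedSpace ℝ F]

/-- Weak partial derivatives of functions with values in a normed space. -/
def WeakPD (U : Set (E d)) (i : Fin d) (u g : E d → F) : Prop :=
  LocallyIntegrableOn u U ∧ LocallyIntegrableOn g U ∧
    ∀ φ : E d → ℝ, ContDiff ℝ ∞ φ → HasCompactSupport φ → tsupport φ ⊆ U →
      ∫ x in U, (fderiv ℝ φ x (basisVec i)) • u x = - ∫ x in U, φ x • g x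

/-- A sequence of bump functions shrinking to the origin. -/
noncomputable def moll (d n : ℕ) : ContDiffBump (0 : E d) where
  rIn := 1 / (2 * (n + 1))
  rOut := 1 / (n + 1)
  rIn_pos := by positivity
  rIn_lt_rOut := by
    apply one_div_lt_one_div_of_lt <;> [positivity; skip]
    have : (0 : ℝ) < n + 1 := by positivity
    linarith

/-- The mollifying kernel. -/
noncomputable def mker (d n : ℕ) : E d → ℝ := (moll d n).normed volume

/-- Mollification. -/
noncomputable def mol (n : ℕ) (f : E d → F) : E d → F :=
  convolution (mker d n) f (ContinuousLinearMap.lsmul ℝ ℝ) volume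

lemma mol_apply (n : ℕ) (f : E d → F) (x : E d) :
    mol n f x = ∫ t, mker d n t • f (x - t) := rfl

lemma mker_nonneg (n : ℕ) (x : E d) : 0 ≤ mker d n x := (moll d n).nonneg_normed x

lemma mker_contDiff (n : ℕ) : ContDiff ℝ ∞ (mker d n) := (moll d n).contDiff_normed

lemma mker_hasCompactSupport (n : ℕ) : HasCompactSupport (mker d n) :=
  (moll d n).hasCompactSupport_normed

lemma integral_mker (n : ℕ) : ∫ x, mker d n x = 1 := (moll d n).integral_normed

lemma tsupport_mker (n : ℕ) : tsupport (mker d n) = Metric.closedBall 0 (1 / ((n : ℝ) + 1)) :=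
  (moll d n).tsupport_normed_eq

lemma tendsto_moll_rOut : Tendsto (fun n => (moll d n).rOut) atTop (𝓝 0) :=
  tendsto_one_div_add_atTop_nhds_zero_nat

lemma integrable_mker (n : ℕ) : Integrable (mker d n) :=
  (mker_contDiff n).continuous.integrable_of_hasCompactSupport (mker_hasCompactSupport n)

lemma lintegral_mker (n : ℕ) : ∫⁻ x, ‖mker d n x‖ₑ = 1 := by
  have h := ofReal_integral_eq_lintegral_ofReal (integrable_mker (d := d) n)
    (Eventually.of_forall (mker_nonneg n))
  rw [integral_mker, ENNReal.ofReal_one] at h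
  rw [h]
  exact lintegral_congr fun x => by rw [Real.enorm_of_nonneg (mker_nonneg n x)]

lemma mol_contDiff (n : ℕ) {f : E d → F} (hf : LocallyIntegrable f) : ContDiff ℝ ∞ (mol n f) :=
  (mker_hasCompactSupport n).contDiff_convolution_left _ (mker_contDiff n) hf

lemma integrable_mker_smul (n : ℕ) {f : E d → F} (hf : LocallyIntegrable f) (x : E d) :
    Integrable fun t => mker d n t • f (x - t) :=
  (mker_hasCompactSupport n).convolutionExists_left (ContinuousLinearMap.lsmul ℝ ℝ)
    (mker_contDiff n).continuous hf x

lemma mol_sub (n : ℕ) {f g : E d → F} (hf : LocallyIntegrable f) (hg : LocallyIntegrable g)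
    (x : E d) : mol n (f - g) x = mol n f x - mol n g x := by
  simp only [mol_apply, Pi.sub_apply, smul_sub]
  exact integral_sub (integrable_mker_smul n hf x) (integrable_mker_smul n hg x)

/-- Jensen's inequality for the probability measure with density `mker d n`, in the form that L^p
norms of a probability space increase with p. -/
lemma enorm_mol_rpow_le (n : ℕ) {f : E d → F} (hf : AEStronglyMeasurable f) {p : ℝ} (hp : 1 ≤ p)
    (x : E d) : ‖mol n f x‖ₑ ^ p ≤ ∫⁻ t, ‖mker d n t‖ₑ * ‖f (x - t)‖ₑ ^ p := by
  have hfx : AEMeasurable (fun t => ‖f (x - t)‖ₑ) :=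
    (hf.comp_quasiMeasurePreserving
      (quasiMeasurePreserving_sub_left (volume : Measure (E d)) x)).enorm
  have hk : Measurable fun t => ‖mker d n t‖ₑ := (mker_contDiff n).continuous.measurable.enorm
  have hprob : IsProbabilityMeasure
      ((volume : Measure (E d)).withDensity fun t => ‖mker d n t‖ₑ) :=
    ⟨by rw [withDensity_apply _ MeasurableSet.univ, setLIntegral_univ, lintegral_mker]⟩
  have h1 : ‖mol n f x‖ₑ ≤ ∫⁻ t, ‖mker d n t‖ₑ * ‖f (x - t)‖ₑ := by
    rw [mol_apply]
    refine (enorm_integral_le_lintegral_enorm _).trans (lintegral_mono fun t => ?_)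
    rw [enorm_smul]
  have hac := withDensity_absolutelyContinuous (volume : Measure (E d)) (fun t => ‖mker d n t‖ₑ)
  have h2 := eLpNorm'_le_eLpNorm'_of_exponent_le (p := 1) (q := p)
    (μ := (volume : Measure (E d)).withDensity fun t => ‖mker d n t‖ₑ)
    zero_lt_one hp (hfx.mono_ac hac).aestronglyMeasurable
  simp only [eLpNorm', enorm_eq_self, ENNReal.rpow_one, one_div, inv_one] at h2
  rw [lintegral_withDensity_eq_lintegral_mul₀ hk.aemeasurable hfx,
    lintegral_withDensity_eq_lintegral_mul₀ hk.aemeasurable (hfx.pow_const p)] at h2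
  calc ‖mol n f x‖ₑ ^ p ≤ (∫⁻ t, ‖mker d n t‖ₑ * ‖f (x - t)‖ₑ) ^ p := by gcongr
    _ ≤ ((∫⁻ t, ‖mker d n t‖ₑ * ‖f (x - t)‖ₑ ^ p) ^ p⁻¹) ^ p := by
        gcongr
        exact h2
    _ = _ := by rw [← ENNReal.rpow_mul, inv_mul_cancel₀ (by positivity), ENNReal.rpow_one]

/-- Integrating the pointwise Jensen bound in x, Tonelli and translation invariance leave the mass
of the kernel, which is 1. -/
lemma eLpNorm_mol_le (n : ℕ) {f : E d → F} (hf : AEStronglyMeasurable f) {p : ℝ} (hp : 1 ≤ p) :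
    eLpNorm (mol n f) (ENNReal.ofReal p) volume ≤ eLpNorm f (ENNReal.ofReal p) volume := by
  have hp0 : 0 < p := by positivity
  rw [eLpNorm_eq_lintegral_rpow_enorm_toReal (by simpa using hp0) (by simp),
    eLpNorm_eq_lintegral_rpow_enorm_toReal (by simpa using hp0) (by simp),
    ENNReal.toReal_ofReal hp0.le]
  gcongr ?_ ^ (1 / p)
  have hm : AEMeasurable (fun z : E d × E d => ‖f (z.1 - z.2)‖ₑ ^ p)
      ((volume : Measure (E d)).prod volume) :=
    (hf.comp_quasiMeasurePreserving
      (quasiMeasurePreserving_sub (volume : Measure (E d)) volume)).enorm.pow_const p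
  have hk : Measurable fun t => ‖mker d n t‖ₑ := (mker_contDiff n).continuous.measurable.enorm
  calc ∫⁻ x, ‖mol n f x‖ₑ ^ p ≤ ∫⁻ x, ∫⁻ t, ‖mker d n t‖ₑ * ‖f (x - t)‖ₑ ^ p :=
        lintegral_mono fun x => enorm_mol_rpow_le n hf hp x
    _ = ∫⁻ t, ∫⁻ x, ‖mker d n t‖ₑ * ‖f (x - t)‖ₑ ^ p :=
        lintegral_lintegral_swap ((hk.comp measurable_snd).aemeasurable.mul hm)
    _ = ∫⁻ t, ‖mker d n t‖ₑ * ∫⁻ x, ‖f x‖ₑ ^ p := by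
        refine lintegral_congr fun t => ?_
        rw [lintegral_const_mul' _ _ (by simp)]
        congr 1
        exact lintegral_sub_right_eq_self (fun x => ‖f x‖ₑ ^ p) t
    _ = ∫⁻ x, ‖f x‖ₑ ^ p := by
        rw [lintegral_mul_const _ hk, lintegral_mker, one_mul]

lemma eLpNorm_mol_two_le (n : ℕ) {f : E d → F} (hf : AEStronglyMeasurable f) :
    eLpNorm (mol n f) 2 volume ≤ eLpNorm f 2 volume := by
  simpa using eLpNorm_mol_le n hf one_le_two

lemma tendsto_mol_ae [CompleteSpace F] {f : E d → F} (hf : LocallyIntegrable f) :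
    ∀ᵐ x, Tendsto (fun n => mol n f x) atTop (𝓝 (f x)) := by
  refine ContDiffBump.ae_convolution_tendsto_right_of_locallyIntegrable (φ := moll d) (K := 2)
    tendsto_moll_rOut (Eventually.of_forall fun n => ?_) hf
  simp only [moll]
  rw [one_div, one_div, mul_inv, ← mul_assoc, mul_inv_cancel₀ two_ne_zero, one_mul]

lemma norm_mol_le (n : ℕ) {f : E d → F} {B : ℝ} (hf : ∀ᵐ x, ‖f x‖ ≤ B) (x : E d) :
    ‖mol n f x‖ ≤ B := by
  rw [mol_apply]
  have h := (quasiMeasurePreserving_sub_left (volume : Measure (E d)) x).ae hf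
  refine (norm_integral_le_of_norm_le (g := fun t => mker d n t * B)
    ((integrable_mker n).mul_const B) ?_).trans_eq ?_
  · filter_upwards [h] with t ht
    rw [norm_smul, Real.norm_of_nonneg (mker_nonneg n t)]
    exact mul_le_mul_of_nonneg_left ht (mker_nonneg n t)
  · rw [integral_mul_const, integral_mker, one_mul]

lemma support_mol_subset (n : ℕ) (f : E d → F) {K : Set (E d)} (hf : Function.support f ⊆ K) :
    Function.support (mol n f) ⊆ Metric.cthickening (1 / ((n : ℝ) + 1)) K := by
  intro x hx
  obtain ⟨a, ha, b, hb, rfl⟩ := support_convolution_subset _ hx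
  have ha' : a ∈ Metric.closedBall (0 : E d) (1 / ((n : ℝ) + 1)) := by
    rw [← tsupport_mker]; exact subset_tsupport _ ha
  refine Metric.mem_cthickening_of_dist_le _ b _ _ (hf hb) ?_
  simpa [dist_eq_norm] using ha'

lemma dist_mol_le [CompleteSpace F] (n : ℕ) {f : E d → F} (hf : AEStronglyMeasurable f) {x : E d}
    {ε : ℝ} (h : ∀ y ∈ Metric.ball x (1 / ((n : ℝ) + 1)), dist (f y) (f x) ≤ ε) :
    dist (mol n f x) (f x) ≤ ε :=
  ContDiffBump.dist_normed_convolution_le (φ := moll d n) hf h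

lemma exists_dist_mol_le [CompleteSpace F] {f : E d → F} (hf : Continuous f)
    (hc : HasCompactSupport f) {ε : ℝ} (hε : 0 < ε) :
    ∃ N : ℕ, ∀ n ≥ N, ∀ x, dist (mol n f x) (f x) ≤ ε := by
  obtain ⟨δ, hδ, h⟩ := Metric.uniformContinuous_iff.1 (hc.uniformContinuous_of_continuous hf) ε hε
  obtain ⟨N, hN⟩ := exists_nat_one_div_lt hδ
  refine ⟨N, fun n hn x => dist_mol_le n hf.aestronglyMeasurable fun y hy => (h ?_).le⟩
  refine lt_trans (Metric.mem_ball.1 hy) (lt_of_le_of_lt ?_ hN)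
  apply one_div_le_one_div_of_le (by positivity)
  have : (N : ℝ) ≤ n := by exact_mod_cast hn
  linarith

/-- The convergence is uniform, and all differences are supported in one compact neighbourhood K of
the support, so the L² norm is at most the sup norm times |K|^(1/2). -/
lemma tendsto_eLpNorm_mol_sub_of_continuous [CompleteSpace F] {f : E d → F} (hf : Continuous f)
    (hc : HasCompactSupport f) :
    Tendsto (fun n => eLpNorm (mol n f - f) 2 volume) atTop (𝓝 0) := by
  set K := Metric.cthickening 1 (tsupport f) with hK
  have hKc : IsCompact K := hc.isCompact.cthickening
  have hKv : volume K ≠ ⊤ := hKc.measure_lt_top.ne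
  rw [ENNReal.tendsto_atTop_zero]
  intro ε hε
  by_cases hεt : ε = ⊤
  · exact ⟨0, fun _ _ => hεt ▸ le_top⟩
  obtain ⟨η, hη, hηε⟩ : ∃ η : ℝ, 0 < η ∧ ENNReal.ofReal η * volume K ^ (1 / 2 : ℝ) ≤ ε := by
    have h1 : volume K ^ (1 / 2 : ℝ) ≠ ⊤ := ENNReal.rpow_ne_top_of_nonneg (by norm_num) hKv
    have h2 : Tendsto (fun η : ℝ => ENNReal.ofReal η * volume K ^ (1 / 2 : ℝ)) (𝓝[>] 0) (𝓝 0) := by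
      have : Tendsto (fun η : ℝ => ENNReal.ofReal η * volume K ^ (1 / 2 : ℝ)) (𝓝 0)
          (𝓝 (ENNReal.ofReal 0 * volume K ^ (1 / 2 : ℝ))) :=
        ENNReal.Tendsto.mul_const (ENNReal.tendsto_ofReal tendsto_id) (Or.inr h1)
      rw [ENNReal.ofReal_zero, zero_mul] at this
      exact this.mono_left nhdsWithin_le_nhds
    obtain ⟨η, h3, h4⟩ := ((h2.eventually_lt_const hε).and self_mem_nhdsWithin).exists
    exact ⟨η, h4, h3.le⟩
  obtain ⟨N, hN⟩ := exists_dist_mol_le hf hc hη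
  refine ⟨N, fun n hn => le_trans ?_ hηε⟩
  have hsub : Function.support (mol n f - f) ⊆ K := by
    intro x hx
    by_contra hxK
    have h1 : mol n f x = 0 := by
      by_contra h
      refine hxK (Metric.cthickening_mono ?_ _ (support_mol_subset n f (subset_tsupport f) h))
      rw [div_le_one (by positivity)]
      have : (0 : ℝ) ≤ n := by positivity
      linarith
    have h2 : f x = 0 := by
      by_contra h
      exact hxK (Metric.self_subset_cthickening _ (subset_tsupport f h))
    exact hx (by simp [h1, h2])
  rw [← eLpNorm_restrict_eq_of_support_subset hsub]
  refine (eLpNorm_le_of_ae_bound (C := η) (Eventually.of_forall fun x => ?_)).trans_eq ?_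
  · rw [Pi.sub_apply, ← dist_eq_norm]; exact hN n hn x
  · simp [mul_comm]

/-- Density of continuous compactly supported functions, combined with the fact that mollification
does not increase the L² norm. -/
lemma tendsto_eLpNorm_mol_sub [CompleteSpace F] {f : E d → F} (hf : MemLp f 2 volume) :
    Tendsto (fun n => eLpNorm (mol n f - f) 2 volume) atTop (𝓝 0) := by
  rw [ENNReal.tendsto_atTop_zero]
  intro ε hε
  have hε3 : ε / 3 ≠ 0 := by simp [hε.ne']
  obtain ⟨g, hgc, hfg, hgcont, hg⟩ := hf.exists_hasCompactSupport_eLpNorm_sub_le (by simp) hε3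
  obtain ⟨N, hN⟩ := ENNReal.tendsto_atTop_zero.1
    (tendsto_eLpNorm_mol_sub_of_continuous hgcont hgc) (ε / 3) (pos_iff_ne_zero.2 hε3)
  refine ⟨N, fun n hn => ?_⟩
  have hfl := hf.locallyIntegrable one_le_two
  have hgl := hg.locallyIntegrable one_le_two
  have e : mol n f - f = mol n (f - g) + ((mol n g - g) + (g - f)) := by
    ext x
    simp only [Pi.add_apply, Pi.sub_apply, mol_sub n hfl hgl]
    abel
  have m1 : AEStronglyMeasurable (mol n (f - g)) :=
    (mol_contDiff n (hfl.sub hgl)).continuous.aestronglyMeasurable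
  have m2 : AEStronglyMeasurable (mol n g - g) :=
    ((mol_contDiff n hgl).continuous.sub hgcont).aestronglyMeasurable
  have m3 : AEStronglyMeasurable (g - f) := hg.1.sub hf.1
  rw [e]
  calc _ ≤ eLpNorm (mol n (f - g)) 2 volume + (eLpNorm (mol n g - g) 2 volume
        + eLpNorm (g - f) 2 volume) :=
        (eLpNorm_add_le m1 (m2.add m3) one_le_two).trans
          (by gcongr; exact eLpNorm_add_le m2 m3 one_le_two)
    _ ≤ ε / 3 + (ε / 3 + ε / 3) := by
        gcongr
        · exact (eLpNorm_mol_two_le n (hf.1.sub hg.1)).trans hfg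
        · exact hN n hn
        · rw [eLpNorm_sub_comm]; exact hfg
    _ = ε := by rw [← add_assoc, ENNReal.add_thirds]

/-- Mollification commutes with weak derivatives away from the boundary. -/
lemma fderiv_mol [CompleteSpace F] {U : Set (E d)} {i : Fin d} {f g h k : E d → F}
    (hfg : WeakPD U i f g) (hh : LocallyIntegrable h) (hU : MeasurableSet U)
    (hhf : ∀ x ∈ U, h x = f x) (hkg : ∀ x ∈ U, k x = g x) (n : ℕ) {x : E d}
    (hx : Metric.closedBall x (1 / ((n : ℝ) + 1)) ⊆ U) :
    fderiv ℝ (mol n h) x (basisVec i) = mol n k x := by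
  have hd := (mker_hasCompactSupport n).hasFDerivAt_convolution_left
    (ContinuousLinearMap.lsmul ℝ ℝ : ℝ →L[ℝ] F →L[ℝ] F)
    ((mker_contDiff n).of_le (by exact_mod_cast le_top)) hh x
  have hex := ((mker_hasCompactSupport (d := d) n).fderiv (𝕜 := ℝ)).convolutionExists_left
    (ContinuousLinearMap.precompL (E d) (ContinuousLinearMap.lsmul ℝ ℝ : ℝ →L[ℝ] F →L[ℝ] F))
    ((mker_contDiff n).continuous_fderiv (by simp)) hh x
  have h1 : fderiv ℝ (mol n h) x (basisVec i)
      = ∫ t, (fderiv ℝ (mker d n) t (basisVec i)) • h (x - t) := by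
    rw [mol, hd.fderiv, convolution_def, ContinuousLinearMap.integral_apply hex]
    rfl
  -- The reflected kernel is a test function supported in the closed ball about x, hence in U. The
  -- sign produced by the reflection cancels the sign in the definition of the weak derivative.
  set ψ : E d → ℝ := fun s => mker d n (x - s) with hψ
  have hψ1 : ContDiff ℝ ∞ ψ := (mker_contDiff n).comp (contDiff_const.sub contDiff_id)
  have hψd : ∀ s, fderiv ℝ ψ s (basisVec i) = - fderiv ℝ (mker d n) (x - s) (basisVec i) := by
    intro s
    have h3 : HasFDerivAt (fun s => x - s) (-ContinuousLinearMap.id ℝ (E d)) s :=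
      (hasFDerivAt_id s).const_sub x
    have h4 := ((mker_contDiff n).differentiable (by simp) (x - s)).hasFDerivAt.comp s h3
    rw [show ψ = mker d n ∘ fun s => x - s from rfl, h4.fderiv]
    simp
  have hψs : tsupport ψ ⊆ Metric.closedBall x (1 / ((n : ℝ) + 1)) := by
    refine closure_minimal (fun s hs => ?_) Metric.isClosed_closedBall
    have : x - s ∈ tsupport (mker d n) := subset_tsupport _ hs
    rw [tsupport_mker] at this
    simpa [dist_eq_norm, norm_sub_rev] using this
  have hψc : HasCompactSupport ψ :=
    HasCompactSupport.of_support_subset_isCompact (isCompact_closedBall x _)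
      ((subset_tsupport ψ).trans hψs)
  have hψU := hψs.trans hx
  have key := hfg.2.2 ψ hψ1 hψc hψU
  rw [h1, mol_apply, ← integral_sub_left_eq_self _ volume x,
    ← integral_sub_left_eq_self (fun t => mker d n t • k (x - t)) volume x]
  simp only [sub_sub_cancel]
  have e1 : ∫ s, (fderiv ℝ (mker d n) (x - s) (basisVec i)) • h s
      = - ∫ s in U, (fderiv ℝ ψ s (basisVec i)) • f s := by
    rw [← integral_neg, ← setIntegral_eq_integral_of_forall_compl_eq_zero (s := U)]
    · refine setIntegral_congr_fun hU fun s hs => ?_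
      simp [hψd, hhf s hs]
    · intro s hs
      have h5 : fderiv ℝ ψ s = 0 :=
        Function.notMem_support.1 fun h => hs (hψU (support_fderiv_subset ℝ h))
      have := hψd s
      rw [h5] at this
      simp only [zero_apply, zero_eq_neg] at this
      rw [this, zero_smul]
  have e2 : ∫ s, mker d n (x - s) • k s = ∫ s in U, ψ s • g s := by
    rw [← setIntegral_eq_integral_of_forall_compl_eq_zero (s := U)]
    · exact setIntegral_congr_fun hU fun s hs => by simp [hψ, hkg s hs]
    · intro s hs
      have h5 : ψ s = 0 := image_eq_zero_of_notMem_tsupport fun h => hs (hψU h)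
      rw [show mker d n (x - s) = ψ s from rfl, h5, zero_smul]
  rw [e1, e2, key, neg_neg]

end Peridynamics

namespace Peridynamics

/-! ### Elementary calculus of weak derivatives -/

section Basic

variable {d : ℕ} {F G : Type*} [NormedAddCommGroup F] [NormedSpace ℝ F]
  [NormedAddCommGroup G] [NormedSpace ℝ G]

lemma integrable_smul_of_compact {U K : Set (E d)} (hK : IsCompact K) (hKU : K ⊆ U)
    {u : E d → F} (hu : LocallyIntegrableOn u U) {ψ : E d → ℝ} (hψ : Continuous ψ)
    (hs : ∀ x ∉ K, ψ x = 0) : Integrable fun x => ψ x • u x := by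
  have h : IntegrableOn (fun x => ψ x • u x) K :=
    (hu.integrableOn_compact_subset hKU hK).continuousOn_smul hψ.continuousOn hK
  refine (integrableOn_iff_integrable_of_support_subset fun x hx => ?_).1 h
  by_contra hxK
  exact hx (by simp [hs x hxK])

lemma integrable_smul_test {U : Set (E d)} {u : E d → F} (hu : LocallyIntegrableOn u U)
    {ψ : E d → ℝ} (hψ : Continuous ψ) (hc : HasCompactSupport ψ) (hs : tsupport ψ ⊆ U) :
    Integrable fun x => ψ x • u x :=
  integrable_smul_of_compact hc hs hu hψ fun _ hx => image_eq_zero_of_notMem_tsupport hx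

lemma continuous_pd {φ : E d → F} (hφ : ContDiff ℝ 1 φ) (v : E d) :
    Continuous fun x => fderiv ℝ φ x v :=
  (hφ.continuous_fderiv one_ne_zero).clm_apply continuous_const

lemma tsupport_pd_subset (φ : E d → F) (v : E d) :
    tsupport (fun x => fderiv ℝ φ x v) ⊆ tsupport φ :=
  tsupport_fderiv_apply_subset ℝ v

lemma hasCompactSupport_pd {φ : E d → F} (hφ : HasCompactSupport φ) (v : E d) :
    HasCompactSupport fun x => fderiv ℝ φ x v :=
  hφ.of_isClosed_subset (isClosed_tsupport _) (tsupport_pd_subset φ v)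

/-- Integrals of functions supported in `U`. -/
lemma setIntegral_smul_test {U : Set (E d)} (u : E d → F) {ψ : E d → ℝ} (hs : tsupport ψ ⊆ U) :
    ∫ x in U, ψ x • u x = ∫ x, ψ x • u x :=
  setIntegral_eq_integral_of_forall_compl_eq_zero fun x hx => by
    rw [image_eq_zero_of_notMem_tsupport fun h => hx (hs h), zero_smul]

lemma tendsto_integral_smul_of_compact {U K : Set (E d)} (hK : IsCompact K) (hKU : K ⊆ U)
    {u : E d → F} (hu : LocallyIntegrableOn u U) {ψ : ℕ → E d → ℝ} {ψ' : E d → ℝ} {B : ℝ}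
    (hψ : ∀ n, Continuous (ψ n)) (hs : ∀ n, ∀ x ∉ K, ψ n x = 0) (hB : ∀ n x, |ψ n x| ≤ B)
    (hlim : ∀ x, Tendsto (fun n => ψ n x) atTop (𝓝 (ψ' x))) :
    Tendsto (fun n => ∫ x in U, ψ n x • u x) atTop (𝓝 (∫ x in U, ψ' x • u x)) := by
  have hKi : Integrable (K.indicator fun x => B * ‖u x‖) :=
    IntegrableOn.integrable_indicator
      (((hu.integrableOn_compact_subset hKU hK).norm).const_mul B) hK.measurableSet
  refine tendsto_integral_of_dominated_convergence (K.indicator fun x => B * ‖u x‖)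
    (fun n => ?_) hKi.integrableOn (fun n => Eventually.of_forall fun x => ?_)
    (Eventually.of_forall fun x => (hlim x).smul_const _)
  · exact (integrable_smul_of_compact hK hKU hu (hψ n) (hs n)).aestronglyMeasurable.restrict
  · by_cases hx : x ∈ K
    · rw [indicator_of_mem hx, norm_smul, Real.norm_eq_abs]
      gcongr
      exact hB n x
    · simp [hs n x hx, hx]

lemma WeakPD.of_contDiff (U : Set (E d)) (i : Fin d) {g : E d → F} (hg : ContDiff ℝ 1 g) :
    WeakPD U i g fun x => fderiv ℝ g x (basisVec i) := by
  have h1 : LocallyIntegrable g := hg.continuous.locallyIntegrable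
  have h2 : LocallyIntegrable fun x => fderiv ℝ g x (basisVec i) :=
    (continuous_pd hg _).locallyIntegrable
  refine ⟨h1.locallyIntegrableOn U, h2.locallyIntegrableOn U, fun φ hφ hc hs => ?_⟩
  have hφ1 : ContDiff ℝ 1 φ := hφ.of_le (by exact_mod_cast le_top)
  rw [setIntegral_smul_test _ hs, setIntegral_smul_test _ ((tsupport_pd_subset φ _).trans hs),
    eq_comm, neg_eq_iff_eq_neg]
  refine integral_smul_fderiv_eq_neg_fderiv_smul_of_integrable ?_ ?_ ?_
    (fun x _ => hφ.differentiable (by simp) x) (fun x _ => hg.differentiable one_ne_zero x)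
  · exact integrable_smul_test (h1.locallyIntegrableOn univ) (continuous_pd hφ1 _)
      (hasCompactSupport_pd hc _) (subset_univ _)
  · exact integrable_smul_test (h2.locallyIntegrableOn univ) hφ.continuous hc (subset_univ _)
  · exact integrable_smul_test (h1.locallyIntegrableOn univ) hφ.continuous hc (subset_univ _)

lemma WeakPD.mono {U V : Set (E d)} {i : Fin d} {u g : E d → F} (h : WeakPD U i u g)
    (hVU : V ⊆ U) : WeakPD V i u g := by
  refine ⟨h.1.mono_set hVU, h.2.1.mono_set hVU, fun φ hφ hc hs => ?_⟩
  rw [setIntegral_smul_test _ hs, setIntegral_smul_test _ ((tsupport_pd_subset φ _).trans hs),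
    ← setIntegral_smul_test (U := U) _ (hs.trans hVU),
    ← setIntegral_smul_test (U := U) _ (((tsupport_pd_subset φ _).trans hs).trans hVU)]
  exact h.2.2 φ hφ hc (hs.trans hVU)

lemma exists_bound_of_hasCompactSupport {φ : E d → ℝ} (hφ : Continuous φ)
    (hc : HasCompactSupport φ) : ∃ B, 0 ≤ B ∧ ∀ x, |φ x| ≤ B := by
  obtain ⟨B, hB⟩ := hc.exists_bound_of_continuous hφ
  exact ⟨B, (norm_nonneg _).trans (hB 0), hB⟩

lemma tendsto_mol_of_continuous [CompleteSpace F] {f : E d → F} (hf : Continuous f) (x : E d) :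
    Tendsto (fun n => mol n f x) atTop (𝓝 (f x)) :=
  ContDiffBump.convolution_tendsto_right_of_continuous (φ := moll d) tendsto_moll_rOut hf x

lemma one_div_succ_le_of_le {N n : ℕ} (h : N ≤ n) : 1 / ((n : ℝ) + 1) ≤ 1 / ((N : ℝ) + 1) := by
  have : (N : ℝ) ≤ n := by exact_mod_cast h
  exact one_div_le_one_div_of_le (by positivity) (by linarith)

lemma fderiv_mol_of_contDiff [CompleteSpace F] {f : E d → F} (hf : ContDiff ℝ 1 f) (i : Fin d)
    (n : ℕ) (x : E d) : fderiv ℝ (mol n f) x (basisVec i)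
      = mol n (fun x => fderiv ℝ f x (basisVec i)) x :=
  fderiv_mol (WeakPD.of_contDiff univ i hf) hf.continuous.locallyIntegrable MeasurableSet.univ
    (fun _ _ => rfl) (fun _ _ => rfl) n (subset_univ _)

/-- A weak derivative may be tested against `C^1` functions. -/
lemma WeakPD.test_contDiff_one {U : Set (E d)} (hU : IsOpen U) {i : Fin d} {u g : E d → F}
    (h : WeakPD U i u g) {φ : E d → ℝ} (hφ : ContDiff ℝ 1 φ) (hc : HasCompactSupport φ)
    (hs : tsupport φ ⊆ U) :
    ∫ x in U, (fderiv ℝ φ x (basisVec i)) • u x = - ∫ x in U, φ x • g x := by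
  obtain ⟨δ, hδ, hδU⟩ := hc.isCompact.exists_cthickening_subset_open hU hs
  -- The index is shifted by N so that all mollified test functions are supported in the fixed
  -- compact K inside U.
  obtain ⟨N, hN⟩ := exists_nat_one_div_lt hδ
  set K := Metric.cthickening δ (tsupport φ)
  have hK : IsCompact K := hc.isCompact.cthickening
  have hsK : ∀ (f : E d → ℝ), Function.support f ⊆ tsupport φ → ∀ n,
      Function.support (mol (n + N) f) ⊆ K := fun f hf n =>
    (support_mol_subset (n + N) f hf).trans (Metric.cthickening_mono
      ((one_div_succ_le_of_le (Nat.le_add_left N n)).trans hN.le) _)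
  set φ' : E d → ℝ := fun x => fderiv ℝ φ x (basisVec i) with hφ'
  have hφ'c : Continuous φ' := continuous_pd hφ _
  have hφ's : Function.support φ' ⊆ tsupport φ :=
    (subset_tsupport _).trans (tsupport_pd_subset φ _)
  obtain ⟨B, hB0, hB⟩ := exists_bound_of_hasCompactSupport hφ.continuous hc
  obtain ⟨B', hB0', hB'⟩ := exists_bound_of_hasCompactSupport hφ'c (hasCompactSupport_pd hc _)
  have key : ∀ n, ∫ x in U, mol (n + N) φ' x • u x = - ∫ x in U, mol (n + N) φ x • g x := by
    intro n
    have hts : tsupport (mol (n + N) φ) ⊆ K :=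
      closure_minimal (hsK φ (subset_tsupport φ) n) Metric.isClosed_cthickening
    have := h.2.2 (mol (n + N) φ) (mol_contDiff _ hφ.continuous.locallyIntegrable)
      (hK.of_isClosed_subset (isClosed_tsupport _) hts) (hts.trans hδU)
    simpa only [fderiv_mol_of_contDiff hφ] using this
  have hzero : ∀ (f : E d → ℝ), Function.support f ⊆ tsupport φ → ∀ n, ∀ x ∉ K,
      mol (n + N) f x = 0 := fun f hf n x hx => Function.notMem_support.1 fun h => hx (hsK f hf n h)
  have l1 := tendsto_integral_smul_of_compact hK hδU h.1 (ψ := fun n => mol (n + N) φ')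
    (B := B')
    (fun n => (mol_contDiff _ hφ'c.locallyIntegrable).continuous) (hzero φ' hφ's)
    (fun n x => norm_mol_le (n + N) (f := φ') (Eventually.of_forall hB') x)
    (fun x => (tendsto_mol_of_continuous hφ'c x).comp (tendsto_add_atTop_nat N))
  have l2 := tendsto_integral_smul_of_compact hK hδU h.2.1 (ψ := fun n => mol (n + N) φ)
    (B := B)
    (fun n => (mol_contDiff _ hφ.continuous.locallyIntegrable).continuous)
    (hzero φ (subset_tsupport φ))
    (fun n x => norm_mol_le (n + N) (f := φ) (Eventually.of_forall hB) x)
    (fun x => (tendsto_mol_of_continuous hφ.continuous x).comp (tendsto_add_atTop_nat N))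
  exact tendsto_nhds_unique l1 (by simpa only [key] using l2.neg)

/-- The fundamental lemma of the calculus of variations, applied to the difference of the two
candidates. -/
lemma WeakPD.unique [CompleteSpace F] {U : Set (E d)} (hU : IsOpen U) {i : Fin d}
    {u g g' : E d → F} (h : WeakPD U i u g) (h' : WeakPD U i u g') :
    g =ᵐ[volume.restrict U] g' := by
  have := hU.ae_eq_zero_of_integral_contDiff_smul_eq_zero (h.2.1.sub h'.2.1) fun φ hφ hc hs => by
    have e1 := integrable_smul_test h.2.1 hφ.continuous hc hs
    have e2 := integrable_smul_test h'.2.1 hφ.continuous hc hs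
    simp only [Pi.sub_apply, smul_sub]
    rw [integral_sub e1 e2, ← setIntegral_smul_test (U := U) g hs,
      ← setIntegral_smul_test (U := U) g' hs, sub_eq_zero, ← neg_inj, ← h.2.2 φ hφ hc hs,
      ← h'.2.2 φ hφ hc hs]
  rw [EventuallyEq, ae_restrict_iff' hU.measurableSet]
  filter_upwards [this] with x hx hxU
  exact sub_eq_zero.1 (hx hxU)

omit [NormedSpace ℝ F] in
lemma locallyIntegrableOn_congr_ae {U : Set (E d)} {u u' : E d → F}
    (hu : LocallyIntegrableOn u U) (h : u =ᵐ[volume.restrict U] u') :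
    LocallyIntegrableOn u' U := by
  intro x hx
  obtain ⟨s, hs, hi⟩ := hu x hx
  refine ⟨s ∩ U, inter_mem hs self_mem_nhdsWithin, ?_⟩
  exact (hi.mono_set inter_subset_left).congr_fun_ae (ae_restrict_of_ae_restrict_of_subset
    inter_subset_right h)

lemma WeakPD.congr_ae {U : Set (E d)} {i : Fin d} {u g u' g' : E d → F}
    (h : WeakPD U i u g) (hu : u =ᵐ[volume.restrict U] u') (hg : g =ᵐ[volume.restrict U] g') :
    WeakPD U i u' g' := by
  refine ⟨locallyIntegrableOn_congr_ae h.1 hu, locallyIntegrableOn_congr_ae h.2.1 hg, fun φ hφ hc hs => ?_⟩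
  have e1 : ∫ x in U, (fderiv ℝ φ x (basisVec i)) • u' x
      = ∫ x in U, (fderiv ℝ φ x (basisVec i)) • u x :=
    integral_congr_ae (by filter_upwards [hu] with x hx; rw [hx])
  have e2 : ∫ x in U, φ x • g' x = ∫ x in U, φ x • g x :=
    integral_congr_ae (by filter_upwards [hg] with x hx; rw [hx])
  rw [e1, e2, h.2.2 φ hφ hc hs]

lemma WeakPD.add {U : Set (E d)} {i : Fin d} {u g u' g' : E d → F}
    (h : WeakPD U i u g) (h' : WeakPD U i u' g') :
    WeakPD U i (fun x => u x + u' x) fun x => g x + g' x := by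
  refine ⟨h.1.add h'.1, h.2.1.add h'.2.1, fun φ hφ hc hs => ?_⟩
  have hφ1 : ContDiff ℝ 1 φ := hφ.of_le (by exact_mod_cast le_top)
  have hs' := (tsupport_pd_subset φ (basisVec i)).trans hs
  have hc' := hasCompactSupport_pd hc (basisVec i)
  simp only [smul_add]
  rw [integral_add, integral_add, h.2.2 φ hφ hc hs, h'.2.2 φ hφ hc hs, neg_add]
  · exact (integrable_smul_test h.2.1 hφ.continuous hc hs).restrict
  · exact (integrable_smul_test h'.2.1 hφ.continuous hc hs).restrict
  · exact (integrable_smul_test h.1 (continuous_pd hφ1 _) hc' hs').restrict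
  · exact (integrable_smul_test h'.1 (continuous_pd hφ1 _) hc' hs').restrict

lemma WeakPD.clm_comp [CompleteSpace F] [CompleteSpace G] {U : Set (E d)} {i : Fin d}
    {u g : E d → F} (h : WeakPD U i u g) (L : F →L[ℝ] G) :
    WeakPD U i (fun x => L (u x)) fun x => L (g x) := by
  have hL : ∀ v : E d → F, LocallyIntegrableOn v U → LocallyIntegrableOn (fun x => L (v x)) U := by
    intro v hv x hx
    obtain ⟨s, hs, hi⟩ := hv x hx
    exact ⟨s, hs, L.integrable_comp hi⟩
  refine ⟨hL u h.1, hL g h.2.1, fun φ hφ hc hs => ?_⟩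
  have hφ1 : ContDiff ℝ 1 φ := hφ.of_le (by exact_mod_cast le_top)
  have hs' := (tsupport_pd_subset φ (basisVec i)).trans hs
  have hc' := hasCompactSupport_pd hc (basisVec i)
  have e1 := (integrable_smul_test h.2.1 hφ.continuous hc hs).restrict (s := U)
  have e2 := (integrable_smul_test h.1 (continuous_pd hφ1 _) hc' hs').restrict (s := U)
  have := congrArg L (h.2.2 φ hφ hc hs)
  rw [map_neg, ← L.integral_comp_comm e1, ← L.integral_comp_comm e2] at this
  simpa only [map_smul] using this

lemma WeakPD.const_smul {U : Set (E d)} {i : Fin d} {u g : E d → F} (h : WeakPD U i u g) (c : ℝ) :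
    WeakPD U i (fun x => c • u x) fun x => c • g x := by
  refine ⟨h.1.smul c, h.2.1.smul c, fun φ hφ hc hs => ?_⟩
  simp only [smul_comm _ c, integral_smul, h.2.2 φ hφ hc hs, smul_neg]

lemma WeakPD.sub {U : Set (E d)} {i : Fin d} {u g u' g' : E d → F}
    (h : WeakPD U i u g) (h' : WeakPD U i u' g') :
    WeakPD U i (fun x => u x - u' x) fun x => g x - g' x := by
  simpa [sub_eq_add_neg] using h.add (h'.const_smul (-1))

lemma WeakPD.translate {U : Set (E d)} {i : Fin d} {u g : E d → F} (h : WeakPD U i u g)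
    (z : E d) :
    WeakPD ((fun x => x + z) ⁻¹' U) i (fun x => u (x + z)) fun x => g (x + z) := by
  have hm := measurePreserving_add_right (volume : Measure (E d)) z
  have he : MeasurableEmbedding fun x : E d => x + z := measurableEmbedding_addRight z
  have hl : ∀ v : E d → F, LocallyIntegrableOn v U →
      LocallyIntegrableOn (fun x => v (x + z)) ((fun x => x + z) ⁻¹' U) := by
    intro v hv x hx
    obtain ⟨s, hs, hi⟩ := hv (x + z) hx
    refine ⟨(fun x => x + z) ⁻¹' s, ?_, (hm.integrableOn_comp_preimage he).2 hi⟩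
    exact (tendsto_nhdsWithin_iff.2 ⟨((continuous_add_const z).tendsto x).mono_left
      nhdsWithin_le_nhds, eventually_nhdsWithin_of_forall fun _ hy => hy⟩) hs
  refine ⟨hl u h.1, hl g h.2.1, fun φ hφ hc hs => ?_⟩
  set ψ : E d → ℝ := fun y => φ (y - z) with hψ
  have hψ1 : ContDiff ℝ ∞ ψ := hφ.comp (contDiff_id.sub contDiff_const)
  have hψs : tsupport ψ ⊆ (fun y => y - z) ⁻¹' tsupport φ :=
    closure_minimal (fun y hy => subset_tsupport φ hy)
      ((isClosed_tsupport φ).preimage (continuous_sub_right z))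
  have hψc : HasCompactSupport ψ := hc.comp_homeomorph (Homeomorph.subRight z)
  have hψU : tsupport ψ ⊆ U := fun y hy => by
    have : y - z + z ∈ U := hs (hψs hy)
    simpa using this
  have hd : ∀ x, fderiv ℝ φ x = fderiv ℝ ψ (x + z) := by
    intro x
    rw [hψ, fderiv_comp_sub]
    simp
  have e1 : ∫ x in (fun x => x + z) ⁻¹' U, (fderiv ℝ φ x (basisVec i)) • u (x + z)
      = ∫ y in U, (fderiv ℝ ψ y (basisVec i)) • u y := by
    rw [← hm.setIntegral_preimage_emb he (fun y => (fderiv ℝ ψ y (basisVec i)) • u y)]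
    simp only [hd]
  have e2 : ∫ x in (fun x => x + z) ⁻¹' U, φ x • g (x + z) = ∫ y in U, ψ y • g y := by
    rw [← hm.setIntegral_preimage_emb he (fun y => ψ y • g y)]
    simp [hψ]
  rw [e1, e2, h.2.2 ψ hψ1 hψc hψU]

/-- A test function supported away from ∂D stays smooth when multiplied by the indicator of D, and
then its support lies in D. Nothing is asserted across ∂D, so no boundary values of u are needed;
this is what makes the lemma applicable to first derivatives of fields in W. -/
lemma WeakPD.extend_zero {D : Set (E d)} (hD : IsOpen D) {i : Fin d} {u g : E d → F}
    (h : WeakPD D i u g) (hu : IntegrableOn u D) (hg : IntegrableOn g D) :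
    WeakPD (frontier D)ᶜ i (D.indicator u) (D.indicator g) := by
  refine ⟨(hu.integrable_indicator hD.measurableSet).locallyIntegrable.locallyIntegrableOn _,
    (hg.integrable_indicator hD.measurableSet).locallyIntegrable.locallyIntegrableOn _,
    fun φ hφ hc hs => ?_⟩
  set ψ : E d → ℝ := D.indicator φ with hψ
  -- Near every point, ψ coincides with φ or with zero; this yields both its smoothness and the
  -- inclusion of its support in D.
  have hcases : ∀ x, (ψ =ᶠ[𝓝 x] φ ∧ x ∈ D) ∨ (ψ =ᶠ[𝓝 x] 0 ∧ x ∉ D) := by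
    intro x
    by_cases hx : x ∈ D
    · left
      refine ⟨?_, hx⟩
      filter_upwards [hD.mem_nhds hx] with y hy
      rw [hψ, indicator_of_mem hy]
    · right
      refine ⟨?_, hx⟩
      by_cases hxc : x ∈ closure D
      · have hxf : x ∉ tsupport φ := fun hxt => hs hxt ⟨hxc, by rwa [hD.interior_eq]⟩
        filter_upwards [notMem_tsupport_iff_eventuallyEq.1 hxf] with y hy
        simp [hψ, hy]
      · filter_upwards [isClosed_closure.isOpen_compl.mem_nhds hxc] with y hy
        rw [hψ, indicator_of_notMem fun hyD => hy (subset_closure hyD)]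
        rfl
  have hψ1 : ContDiff ℝ ∞ ψ := contDiff_iff_contDiffAt.2 fun x => by
    rcases hcases x with ⟨h1, -⟩ | ⟨h1, -⟩
    · exact hφ.contDiffAt.congr_of_eventuallyEq h1
    · exact contDiffAt_const.congr_of_eventuallyEq h1
  have hψs : tsupport ψ ⊆ tsupport φ ∩ D := by
    intro x hx
    have hsupp : Function.support ψ ⊆ Function.support φ := fun y hy hy' => hy (by
      by_cases hyD : y ∈ D <;> simp [hψ, hyD, hy'])
    refine ⟨closure_mono hsupp hx, ?_⟩
    · rcases hcases x with ⟨-, h1⟩ | ⟨h1, -⟩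
      · exact h1
      · exact absurd hx (notMem_tsupport_iff_eventuallyEq.2 h1)
  have key := h.2.2 ψ hψ1 (hc.of_isClosed_subset (isClosed_tsupport _)
    (hψs.trans inter_subset_left)) (hψs.trans inter_subset_right)
  rw [setIntegral_smul_test _ hs, setIntegral_smul_test _ ((tsupport_pd_subset φ _).trans hs)]
  have e1 : ∀ x, (fderiv ℝ φ x (basisVec i)) • D.indicator u x
      = D.indicator (fun x => (fderiv ℝ ψ x (basisVec i)) • u x) x := by
    intro x
    by_cases hx : x ∈ D
    · rcases hcases x with ⟨h1, -⟩ | ⟨-, h1⟩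
      · rw [indicator_of_mem hx, indicator_of_mem hx, h1.fderiv_eq]
      · exact absurd hx h1
    · simp [hx]
  have e2 : ∀ x, φ x • D.indicator g x = D.indicator (fun x => ψ x • g x) x := by
    intro x
    by_cases hx : x ∈ D <;> simp [hx, hψ]
  simp only [e1, e2]
  rw [integral_indicator hD.measurableSet, integral_indicator hD.measurableSet, key]

end Basic

end Peridynamics

namespace Peridynamics

/-! ### Product rule, chain rule, and truncation of small values -/

section Calculus

variable {d : ℕ} {F : Type*} [NormedAddCommGroup F] [NormedSpace ℝ F]

lemma exists_closedBall_subset {U K : Set (E d)} (hU : IsOpen U) (hK : IsCompact K)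
    (hKU : K ⊆ U) : ∃ N : ℕ, ∀ n ≥ N, ∀ x ∈ K, Metric.closedBall x (1 / ((n : ℝ) + 1)) ⊆ U := by
  obtain ⟨δ, hδ, hδU⟩ := hK.exists_cthickening_subset_open hU hKU
  obtain ⟨N, hN⟩ := exists_nat_one_div_lt hδ
  refine ⟨N, fun n hn x hx y hy => hδU ?_⟩
  exact Metric.mem_cthickening_of_dist_le y x δ K hx
    ((Metric.mem_closedBall.1 hy).trans ((one_div_succ_le_of_le hn).trans hN.le))

omit [NormedSpace ℝ F] in
lemma locallyIntegrableOn_of_integrable {U : Set (E d)} {f : E d → F}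
    (hf : Integrable f (volume.restrict U)) : LocallyIntegrableOn f U :=
  IntegrableOn.locallyIntegrableOn hf

omit [NormedSpace ℝ F] in
lemma memLp_indicator {U : Set (E d)} (hU : MeasurableSet U) {f : E d → F} {p : ENNReal}
    (hf : MemLp f p (volume.restrict U)) : MemLp (U.indicator f) p volume :=
  (memLp_indicator_iff_restrict hU).2 hf

/-- Local mollification of a function on `U`, extended by zero. -/
lemma exists_fderiv_mol_indicator [CompleteSpace F] {U K : Set (E d)} (hU : IsOpen U)
    (hK : IsCompact K) (hKU : K ⊆ U) {i : Fin d} {f f' : E d → F} (h : WeakPD U i f f')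
    (hf : MemLp f 2 (volume.restrict U)) :
    ∃ N : ℕ, ∀ n ≥ N, ∀ x ∈ K, fderiv ℝ (mol n (U.indicator f)) x (basisVec i)
      = mol n (U.indicator f') x := by
  obtain ⟨N, hN⟩ := exists_closedBall_subset hU hK hKU
  refine ⟨N, fun n hn x hx => fderiv_mol h
    ((memLp_indicator hU.measurableSet hf).locallyIntegrable one_le_two) hU.measurableSet
    (fun y hy => indicator_of_mem hy f) (fun y hy => indicator_of_mem hy f') n (hN n hn x hx)⟩

lemma tendsto_eLpNorm_mol_indicator_sub [CompleteSpace F] {U : Set (E d)} (hU : MeasurableSet U)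
    {f : E d → F} (hf : MemLp f 2 (volume.restrict U)) :
    Tendsto (fun n => eLpNorm (mol n (U.indicator f) - f) 2 (volume.restrict U)) atTop (𝓝 0) := by
  refine tendsto_of_tendsto_of_tendsto_of_le_of_le tendsto_const_nhds
    (tendsto_eLpNorm_mol_sub (memLp_indicator hU hf)) (fun _ => zero_le) fun n => ?_
  refine le_trans (eLpNorm_congr_ae ?_).le (eLpNorm_restrict_le _ _ _ U)
  filter_upwards [ae_restrict_mem hU] with x hx
  simp [hx]

lemma tendsto_mol_indicator_ae [CompleteSpace F] {U : Set (E d)} (hU : MeasurableSet U)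
    {f : E d → F} (hf : MemLp f 2 (volume.restrict U)) :
    ∀ᵐ x ∂(volume.restrict U), Tendsto (fun n => mol n (U.indicator f) x) atTop (𝓝 (f x)) := by
  rw [ae_restrict_iff' hU]
  filter_upwards [tendsto_mol_ae ((memLp_indicator hU hf).locallyIntegrable one_le_two)]
    with x hx hxU
  rwa [indicator_of_mem hxU] at hx

lemma mol_indicator_memLp {U : Set (E d)} (hU : MeasurableSet U) {f : E d → F}
    (hf : MemLp f 2 (volume.restrict U)) (n : ℕ) :
    MemLp (mol n (U.indicator f)) 2 (volume.restrict U) := by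
  have h := memLp_indicator hU hf
  have h1 : MemLp (mol n (U.indicator f)) 2 volume :=
    ⟨(mol_contDiff n (h.locallyIntegrable one_le_two)).continuous.aestronglyMeasurable,
      (eLpNorm_mol_two_le n h.1).trans_lt h.2⟩
  exact h1.restrict U

lemma integrable_mul_of_memLp {α : Type*} [MeasurableSpace α] {μ : Measure α} {f g : α → ℝ}
    (hf : MemLp f 2 μ) (hg : MemLp g 2 μ) : Integrable (fun x => f x * g x) μ :=
  hf.integrable_mul hg

/-- The `L²` pairing is continuous. -/
lemma tendsto_integral_mul_of_eLpNorm {α : Type*} [MeasurableSpace α] {μ : Measure α}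
    {f h : α → ℝ} {fn : ℕ → α → ℝ}
    (hf : MemLp f 2 μ) (hfn : ∀ n, MemLp (fn n) 2 μ) (hh : MemLp h 2 μ)
    (hlim : Tendsto (fun n => eLpNorm (fn n - f) 2 μ) atTop (𝓝 0)) :
    Tendsto (fun n => ∫ x, h x * fn n x ∂μ) atTop (𝓝 (∫ x, h x * f x ∂μ)) := by
  refine tendsto_integral_of_L1' (fun x => h x * f x)
    (integrable_mul_of_memLp hh hf).aestronglyMeasurable
    (Eventually.of_forall fun n => integrable_mul_of_memLp hh (hfn n)) ?_
  have h1 : Tendsto (fun n => eLpNorm h 2 μ * eLpNorm (fn n - f) 2 μ) atTop (𝓝 0) := by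
    simpa using ENNReal.Tendsto.const_mul hlim (Or.inr hh.2.ne)
  refine tendsto_of_tendsto_of_tendsto_of_le_of_le tendsto_const_nhds h1 (fun _ => zero_le)
    fun n => ?_
  have := eLpNorm_smul_le_mul_eLpNorm (p := 2) (q := 2) (r := 1) ((hfn n).1.sub hf.1) hh.1
  refine le_trans (eLpNorm_congr_ae (Eventually.of_forall fun x => ?_)).le this
  simp [mul_sub]

lemma memLp_test {ψ : E d → ℝ} (hψ : Continuous ψ) (hc : HasCompactSupport ψ) (p : ENNReal)
    (U : Set (E d)) : MemLp ψ p (volume.restrict U) :=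
  (hψ.memLp_of_hasCompactSupport hc).restrict U

lemma memLp_mul_bounded {α : Type*} [MeasurableSpace α] {μ : Measure α} {f ψ : α → ℝ}
    {p : ENNReal} (hf : MemLp f p μ) (hψ : AEStronglyMeasurable ψ μ) {B : ℝ}
    (hB : ∀ᵐ x ∂μ, |ψ x| ≤ B) : MemLp (fun x => ψ x * f x) p μ := by
  refine MemLp.of_le_mul (c := B) hf (hψ.mul hf.1) ?_
  filter_upwards [hB] with x hx
  rw [norm_mul]
  gcongr
  exact hx

lemma memLp_test_mul {U : Set (E d)} {f ψ : E d → ℝ} (hf : MemLp f 2 (volume.restrict U))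
    (hψ : Continuous ψ) (hc : HasCompactSupport ψ) :
    MemLp (fun x => ψ x * f x) 2 (volume.restrict U) := by
  obtain ⟨B, -, hB⟩ := exists_bound_of_hasCompactSupport hψ hc
  exact memLp_mul_bounded hf hψ.aestronglyMeasurable (Eventually.of_forall hB)

/-- The product rule for weak derivatives. -/
lemma WeakPD.mul {U : Set (E d)} (hU : IsOpen U) {i : Fin d} {f f' g g' : E d → ℝ}
    (hf : WeakPD U i f f') (hg : WeakPD U i g g')
    (mf : MemLp f 2 (volume.restrict U)) (mf' : MemLp f' 2 (volume.restrict U))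
    (mg : MemLp g 2 (volume.restrict U)) (mg' : MemLp g' 2 (volume.restrict U)) :
    WeakPD U i (fun x => f x * g x) (fun x => f' x * g x + f x * g' x) := by
  refine ⟨locallyIntegrableOn_of_integrable (integrable_mul_of_memLp mf mg),
    locallyIntegrableOn_of_integrable ((integrable_mul_of_memLp mf' mg).add
      (integrable_mul_of_memLp mf mg')), fun φ hφ hc hs => ?_⟩
  have hφ1 : ContDiff ℝ 1 φ := hφ.of_le (by exact_mod_cast le_top)
  obtain ⟨N, hN⟩ := exists_fderiv_mol_indicator hU hc.isCompact hs hf mf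
  -- Only f is mollified. Then φ · fₙ is a legitimate test function for g, and each term of the
  -- resulting identity is an L² pairing that is continuous in fₙ or fₙ'.
  set fn : ℕ → E d → ℝ := fun n => mol (n + N) (U.indicator f) with hfn
  set fn' : ℕ → E d → ℝ := fun n => mol (n + N) (U.indicator f') with hfn'
  have hfnC : ∀ n, ContDiff ℝ ∞ (fn n) := fun n =>
    mol_contDiff _ ((memLp_indicator hU.measurableSet mf).locallyIntegrable one_le_two)
  set φ' : E d → ℝ := fun x => fderiv ℝ φ x (basisVec i) with hφ'
  have hφ'c : Continuous φ' := continuous_pd hφ1 _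
  have hc' : HasCompactSupport φ' := hasCompactSupport_pd hc _
  have m1 : MemLp (fun x => φ' x * g x) 2 (volume.restrict U) := memLp_test_mul mg hφ'c hc'
  have m2 : MemLp (fun x => φ x * g x) 2 (volume.restrict U) := memLp_test_mul mg hφ.continuous hc
  have m3 : MemLp (fun x => φ x * g' x) 2 (volume.restrict U) :=
    memLp_test_mul mg' hφ.continuous hc
  have n1 : ∀ n, MemLp (fn n) 2 (volume.restrict U) := fun n =>
    mol_indicator_memLp hU.measurableSet mf _
  have n2 : ∀ n, MemLp (fn' n) 2 (volume.restrict U) := fun n =>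
    mol_indicator_memLp hU.measurableSet mf' _
  have l1 := (tendsto_eLpNorm_mol_indicator_sub hU.measurableSet mf).comp
    (tendsto_add_atTop_nat N)
  have l2 := (tendsto_eLpNorm_mol_indicator_sub hU.measurableSet mf').comp
    (tendsto_add_atTop_nat N)
  have t1 := tendsto_integral_mul_of_eLpNorm mf n1 m1 l1
  have t2 := tendsto_integral_mul_of_eLpNorm mf' n2 m2 l2
  have t3 := tendsto_integral_mul_of_eLpNorm mf n1 m3 l1
  have key : ∀ n, ∫ x in U, φ' x * g x * fn n x
      = -(∫ x in U, φ x * g' x * fn n x) - ∫ x in U, φ x * g x * fn' n x := by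
    intro n
    have hts : tsupport (fun x => φ x * fn n x) ⊆ tsupport φ :=
      closure_mono (Function.support_mul_subset_left _ _)
    have h1 := hg.2.2 (fun x => φ x * fn n x) (hφ.mul (hfnC n))
      (hc.of_isClosed_subset (isClosed_tsupport _) hts) (hts.trans hs)
    have h2 : ∀ x, fderiv ℝ (fun x => φ x * fn n x) x (basisVec i) • g x
        = φ' x * g x * fn n x + φ x * g x * fn' n x := by
      intro x
      rw [fderiv_fun_mul (hφ.differentiable (by simp) x) ((hfnC n).differentiable (by simp) x)]
      simp only [add_apply, smul_apply, smul_eq_mul]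
      by_cases hx : x ∈ tsupport φ
      · rw [hN (n + N) (Nat.le_add_left N n) x hx]
        ring
      · rw [image_eq_zero_of_notMem_tsupport hx]
        ring
    simp only [h2, smul_eq_mul] at h1
    rw [integral_add (integrable_mul_of_memLp m1 (n1 n)) (integrable_mul_of_memLp m2 (n2 n))] at h1
    rw [eq_sub_iff_add_eq, h1]
    congr 1
    exact integral_congr_ae (Eventually.of_forall fun x => by ring)
  have t4 := t3.neg.sub t2
  have h3 := tendsto_nhds_unique (t1.congr key) t4
  simp only [smul_eq_mul, mul_add]
  have j1 : Integrable (fun x => φ x * (f' x * g x)) (volume.restrict U) :=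
    (integrable_mul_of_memLp m2 mf').congr (Eventually.of_forall fun x => by ring)
  have j2 : Integrable (fun x => φ x * (f x * g' x)) (volume.restrict U) :=
    (integrable_mul_of_memLp m3 mf).congr (Eventually.of_forall fun x => by ring)
  rw [integral_add j1 j2]
  have k1 : ∫ x in U, φ x * g x * f' x = ∫ x in U, φ x * (f' x * g x) :=
    integral_congr_ae (Eventually.of_forall fun x => by ring)
  have k2 : ∫ x in U, φ x * g' x * f x = ∫ x in U, φ x * (f x * g' x) :=
    integral_congr_ae (Eventually.of_forall fun x => by ring)
  have k3 : ∫ x in U, φ' x * g x * f x = ∫ x in U, φ' x * (f x * g x) :=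
    integral_congr_ae (Eventually.of_forall fun x => by ring)
  rw [k1, k2, k3] at h3
  rw [h3]
  ring

lemma abs_sub_le_of_deriv_bounded {T : ℝ → ℝ} (hT : ContDiff ℝ 1 T) {L : ℝ}
    (hL : ∀ s, |deriv T s| ≤ L) (a b : ℝ) : |T a - T b| ≤ L * |a - b| := by
  have h := convex_univ.norm_image_sub_le_of_norm_deriv_le (f := T) (C := L) (x := b) (y := a)
    (fun x _ => hT.differentiable one_ne_zero x) (fun x _ => hL x) (mem_univ _) (mem_univ _)
  simpa only [Real.norm_eq_abs] using h

lemma memLp_comp_of_deriv_bounded {U : Set (E d)} (hUv : volume U ≠ ⊤) {T : ℝ → ℝ}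
    (hT : ContDiff ℝ 1 T) {L : ℝ} (hL : ∀ s, |deriv T s| ≤ L) {f : E d → ℝ}
    (mf : MemLp f 2 (volume.restrict U)) : MemLp (fun x => T (f x)) 2 (volume.restrict U) := by
  have : IsFiniteMeasure (volume.restrict U) := ⟨by simpa using hUv.lt_top⟩
  have hlip := abs_sub_le_of_deriv_bounded hT hL
  have h0 : MemLp (fun x => L * ‖f x‖) 2 (volume.restrict U) := mf.norm.const_mul L
  have h00 : MemLp (fun _ : E d => |T 0|) 2 (volume.restrict U) := memLp_const _
  have h1 : MemLp (fun x => |T 0| + L * ‖f x‖) 2 (volume.restrict U) := h00.add h0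
  refine h1.mono (hT.continuous.comp_aestronglyMeasurable mf.1) (Eventually.of_forall fun x => ?_)
  have h2 := hlip (f x) 0
  rw [sub_zero] at h2
  have h3 : |T (f x)| ≤ |T 0| + L * |f x| := by
    have h4 := abs_add_le (T 0) (T (f x) - T 0)
    rw [add_sub_cancel] at h4
    linarith
  exact h3.trans (le_abs_self _)

/-- The chain rule for weak derivatives. -/
lemma WeakPD.comp {U : Set (E d)} (hU : IsOpen U) (hUv : volume U ≠ ⊤) {i : Fin d}
    {T : ℝ → ℝ} (hT : ContDiff ℝ 1 T) {L : ℝ} (hL : ∀ s, |deriv T s| ≤ L)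
    {f f' : E d → ℝ} (hf : WeakPD U i f f')
    (mf : MemLp f 2 (volume.restrict U)) (mf' : MemLp f' 2 (volume.restrict U)) :
    WeakPD U i (fun x => T (f x)) (fun x => deriv T (f x) * f' x) := by
  have hfin : IsFiniteMeasure (volume.restrict U) := ⟨by simpa using hUv.lt_top⟩
  have hlip := abs_sub_le_of_deriv_bounded hT hL
  have hT'c : Continuous (deriv T) := hT.continuous_deriv le_rfl
  have mT : ∀ {f : E d → ℝ}, MemLp f 2 (volume.restrict U) →
      MemLp (fun x => T (f x)) 2 (volume.restrict U) := fun hf =>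
    memLp_comp_of_deriv_bounded hUv hT hL hf
  have mT' : ∀ {f g : E d → ℝ}, MemLp f 2 (volume.restrict U) → MemLp g 2 (volume.restrict U) →
      MemLp (fun x => deriv T (f x) * g x) 2 (volume.restrict U) := fun hf hg =>
    memLp_mul_bounded hg (hT'c.comp_aestronglyMeasurable hf.1) (Eventually.of_forall fun x => hL _)
  refine ⟨locallyIntegrableOn_of_integrable ((mT mf).integrable one_le_two),
    locallyIntegrableOn_of_integrable ((mT' mf mf').integrable one_le_two), fun φ hφ hc hs => ?_⟩
  have hφ1 : ContDiff ℝ 1 φ := hφ.of_le (by exact_mod_cast le_top)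
  obtain ⟨N, hN⟩ := exists_fderiv_mol_indicator hU hc.isCompact hs hf mf
  set fn : ℕ → E d → ℝ := fun n => mol (n + N) (U.indicator f) with hfn
  set fn' : ℕ → E d → ℝ := fun n => mol (n + N) (U.indicator f') with hfn'
  have hfnC : ∀ n, ContDiff ℝ ∞ (fn n) := fun n =>
    mol_contDiff _ ((memLp_indicator hU.measurableSet mf).locallyIntegrable one_le_two)
  set φ' : E d → ℝ := fun x => fderiv ℝ φ x (basisVec i) with hφ'
  have hφ'c : Continuous φ' := continuous_pd hφ1 _
  have hc' : HasCompactSupport φ' := hasCompactSupport_pd hc _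
  have n1 : ∀ n, MemLp (fn n) 2 (volume.restrict U) := fun n =>
    mol_indicator_memLp hU.measurableSet mf _
  have n2 : ∀ n, MemLp (fn' n) 2 (volume.restrict U) := fun n =>
    mol_indicator_memLp hU.measurableSet mf' _
  have p0 : MemLp φ 2 (volume.restrict U) := memLp_test hφ.continuous hc 2 U
  have p1 : MemLp φ' 2 (volume.restrict U) := memLp_test hφ'c hc' 2 U
  have l1 := (tendsto_eLpNorm_mol_indicator_sub hU.measurableSet mf).comp
    (tendsto_add_atTop_nat N)
  have l2 := (tendsto_eLpNorm_mol_indicator_sub hU.measurableSet mf').comp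
    (tendsto_add_atTop_nat N)
  have hdom : ∀ (g : E d → ℝ) (hn : ℕ → E d → ℝ),
      Tendsto (fun n => eLpNorm (hn n - g) 2 (volume.restrict U)) atTop (𝓝 0) →
      ∀ (kn : ℕ → E d → ℝ), (∀ n x, |kn n x| ≤ L * |hn n x - g x|) →
      Tendsto (fun n => eLpNorm (kn n) 2 (volume.restrict U)) atTop (𝓝 0) := by
    intro g hn hlim kn hkn
    have h1 : Tendsto (fun n => ENNReal.ofReal L * eLpNorm (hn n - g) 2 (volume.restrict U))
        atTop (𝓝 0) := by
      simpa using ENNReal.Tendsto.const_mul hlim (Or.inr ENNReal.ofReal_ne_top)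
    refine tendsto_of_tendsto_of_tendsto_of_le_of_le tendsto_const_nhds h1 (fun _ => zero_le)
      fun n => eLpNorm_le_mul_eLpNorm_of_ae_le_mul (Eventually.of_forall fun x => ?_) 2
    simpa using hkn n x
  have n3 : ∀ n, MemLp (fun x => fn' n x - f' x) 2 (volume.restrict U) := fun n =>
    (n2 n).sub mf'
  have q1 : Tendsto (fun n => eLpNorm ((fun x => T (fn n x)) - fun x => T (f x)) 2
      (volume.restrict U)) atTop (𝓝 0) :=
    hdom f fn l1 _ fun n x => hlip _ _
  -- The term T'(fₙ) fₙ' is split as T'(fₙ)(fₙ' - f') + T'(fₙ) f'. The first part tends to zero in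
  -- L² because T' is bounded. The second needs dominated convergence, since T' is merely continuous
  -- and only a.e. convergence of fₙ helps.
  have q2 : Tendsto (fun n => eLpNorm ((fun x => deriv T (fn n x) * (fn' n x - f' x)) - 0) 2
      (volume.restrict U)) atTop (𝓝 0) := by
    simp only [sub_zero]
    refine hdom f' fn' l2 _ fun n x => ?_
    rw [abs_mul]
    gcongr
    exact hL _
  have t1 := tendsto_integral_mul_of_eLpNorm (mT mf) (fun n => mT (n1 n)) p1 q1
  have t2 := tendsto_integral_mul_of_eLpNorm MemLp.zero
    (fun n => mT' (n1 n) (n3 n)) p0 q2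
  have t3 : Tendsto (fun n => ∫ x in U, φ x * (deriv T (fn n x) * f' x)) atTop
      (𝓝 (∫ x in U, φ x * (deriv T (f x) * f' x))) := by
    refine tendsto_integral_of_dominated_convergence (fun x => L * ‖φ x * f' x‖)
      (fun n => (integrable_mul_of_memLp p0 (mT' (n1 n) mf')).aestronglyMeasurable)
      ((integrable_mul_of_memLp p0 mf').norm.const_mul L)
      (fun n => Eventually.of_forall fun x => ?_) ?_
    · rw [show φ x * (deriv T (fn n x) * f' x) = deriv T (fn n x) * (φ x * f' x) by ring,
        norm_mul]
      gcongr
      exact hL _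
    · filter_upwards [tendsto_mol_indicator_ae hU.measurableSet mf] with x hx
      have := hx.comp (tendsto_add_atTop_nat N)
      exact (((hT'c.tendsto _).comp this).mul_const _).const_mul _
  have key : ∀ n, ∫ x in U, φ' x * T (fn n x)
      = - ((∫ x in U, φ x * (deriv T (fn n x) * (fn' n x - f' x)))
        + ∫ x in U, φ x * (deriv T (fn n x) * f' x)) := by
    intro n
    have hC : ContDiff ℝ 1 (fun x => T (fn n x)) :=
      hT.comp ((hfnC n).of_le (by exact_mod_cast le_top))
    have h1 := (WeakPD.of_contDiff U i hC).2.2 φ hφ hc hs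
    simp only [smul_eq_mul] at h1
    rw [h1, ← integral_add (integrable_mul_of_memLp p0 (mT' (n1 n) (n3 n)))
      (integrable_mul_of_memLp p0 (mT' (n1 n) mf'))]
    congr 1
    refine integral_congr_ae (Eventually.of_forall fun x => ?_)
    by_cases hx : x ∈ tsupport φ
    · have h2 : fderiv ℝ (fun x => T (fn n x)) x (basisVec i)
          = deriv T (fn n x) * fn' n x := by
        have h3 := (hT.differentiable one_ne_zero (fn n x)).hasDerivAt.comp_hasFDerivAt x
          ((hfnC n).differentiable (by simp) x).hasFDerivAt
        rw [show (fun x => T (fn n x)) = T ∘ fn n from rfl, h3.fderiv, smul_apply,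
          hN (n + N) (Nat.le_add_left N n) x hx, smul_eq_mul]
      simp only [h2]
      ring
    · simp [image_eq_zero_of_notMem_tsupport hx]
  have := tendsto_nhds_unique (t1.congr key) (t2.add t3).neg
  simpa using this

/-- A smooth function vanishing near the origin, equal to the identity away from it. -/
noncomputable def eta (s : ℝ) : ℝ := s * Real.smoothTransition (s ^ 2 - 1)

lemma eta_contDiff : ContDiff ℝ ∞ eta :=
  contDiff_id.mul (Real.smoothTransition.contDiff.comp ((contDiff_id.pow 2).sub contDiff_const))

lemma abs_eta_le (s : ℝ) : |eta s| ≤ |s| := by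
  rw [eta, abs_mul, abs_of_nonneg (Real.smoothTransition.nonneg _)]
  exact mul_le_of_le_one_right (abs_nonneg _) (Real.smoothTransition.le_one _)

lemma eta_eq_zero {s : ℝ} (hs : |s| ≤ 1) : eta s = 0 := by
  rw [eta, Real.smoothTransition.zero_of_nonpos, mul_zero]
  have := (sq_le_one_iff_abs_le_one s).2 hs
  linarith

lemma eta_eq_self {s : ℝ} (hs : 2 ≤ |s|) : eta s = s := by
  rw [eta, Real.smoothTransition.one_of_one_le, mul_one]
  rw [← sq_abs]
  nlinarith

lemma deriv_eta_eq_one {s : ℝ} (hs : 2 < |s|) : deriv eta s = 1 := by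
  have : eta =ᶠ[𝓝 s] id := by
    filter_upwards [(isOpen_lt continuous_const continuous_abs).mem_nhds hs] with t ht
    exact eta_eq_self ht.le
  rw [this.deriv_eq, deriv_id]

lemma deriv_eta_zero : deriv eta 0 = 0 := by
  have : eta =ᶠ[𝓝 0] fun _ => 0 := by
    filter_upwards [Metric.ball_mem_nhds (0 : ℝ) one_pos] with t ht
    exact eta_eq_zero (by simpa using (Metric.mem_ball.1 ht).le)
  rw [this.deriv_eq, deriv_const]

lemma exists_deriv_eta_bound : ∃ C : ℝ, 1 ≤ C ∧ ∀ s, |deriv eta s| ≤ C := by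
  have hc : Continuous (deriv eta) := eta_contDiff.continuous_deriv (by exact_mod_cast le_top)
  obtain ⟨C, hC⟩ := (isCompact_Icc (a := (-2 : ℝ)) (b := 2)).exists_bound_of_continuousOn
    hc.continuousOn
  refine ⟨max C 1, le_max_right _ _, fun s => ?_⟩
  by_cases hs : 2 < |s|
  · rw [deriv_eta_eq_one hs]; simp
  · exact (hC s (abs_le.1 (not_lt.1 hs))).trans (le_max_left _ _)

/-- The rescaled function `eta`. -/
noncomputable def etan (n : ℕ) (s : ℝ) : ℝ := eta ((n + 1) * s) / (n + 1)

lemma etan_contDiff (n : ℕ) : ContDiff ℝ ∞ (etan n) :=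
  (eta_contDiff.comp (contDiff_const.mul contDiff_id)).div_const _

lemma deriv_etan (n : ℕ) (s : ℝ) : deriv (etan n) s = deriv eta ((n + 1) * s) := by
  have h0 : (n : ℝ) + 1 ≠ 0 := by positivity
  have h1 : HasDerivAt (fun s : ℝ => ((n : ℝ) + 1) * s) (n + 1) s := by
    simpa using (hasDerivAt_id s).const_mul ((n : ℝ) + 1)
  have h2 := ((eta_contDiff.differentiable (by simp) _).hasDerivAt.comp s h1).div_const
    ((n : ℝ) + 1)
  rw [mul_div_assoc, div_self h0, mul_one] at h2
  exact h2.deriv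

lemma abs_etan_le (n : ℕ) (s : ℝ) : |etan n s| ≤ |s| := by
  have h0 : (0 : ℝ) < n + 1 := by positivity
  rw [etan, abs_div, abs_of_pos h0, div_le_iff₀ h0]
  refine (abs_eta_le _).trans ?_
  rw [abs_mul, abs_of_pos h0, mul_comm]

lemma etan_eq_zero {n : ℕ} {s : ℝ} (hs : |s| ≤ 1 / ((n : ℝ) + 1)) : etan n s = 0 := by
  have h0 : (0 : ℝ) < n + 1 := by positivity
  rw [etan, eta_eq_zero, zero_div]
  rw [abs_mul, abs_of_pos h0]
  rwa [le_div_iff₀ h0, mul_comm] at hs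

lemma eventually_etan_eq (s : ℝ) (hs : s ≠ 0) :
    ∀ᶠ n : ℕ in atTop, etan n s = s ∧ deriv (etan n) s = 1 := by
  have h1 : Tendsto (fun n : ℕ => ((n : ℝ) + 1) * |s|) atTop atTop :=
    (tendsto_natCast_atTop_atTop.atTop_add tendsto_const_nhds).atTop_mul_const (abs_pos.2 hs)
  filter_upwards [h1.eventually_gt_atTop 2] with n hn
  have h0 : (0 : ℝ) < n + 1 := by positivity
  have h2 : 2 < |((n : ℝ) + 1) * s| := by rwa [abs_mul, abs_of_pos h0]
  refine ⟨?_, ?_⟩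
  · rw [etan, eta_eq_self h2.le]
    field_simp
  · rw [deriv_etan, deriv_eta_eq_one h2]

lemma tendsto_etan (s : ℝ) : Tendsto (fun n => etan n s) atTop (𝓝 s) := by
  by_cases hs : s = 0
  · subst hs
    refine tendsto_const_nhds.congr fun n => ?_
    rw [etan_eq_zero]
    simp; positivity
  · exact tendsto_const_nhds.congr' ((eventually_etan_eq s hs).mono fun n hn => hn.1.symm)

/-- The limit is 0, not 1, at s = 0. The discrepancy is harmless for weak gradients: after passing
to the limit, uniqueness of weak derivatives shows that what is lost on the zero set vanishes almost
everywhere. -/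
lemma tendsto_deriv_etan (s : ℝ) :
    Tendsto (fun n => deriv (etan n) s) atTop (𝓝 (if s = 0 then 0 else 1)) := by
  split_ifs with hs
  · subst hs
    refine tendsto_const_nhds.congr fun n => ?_
    rw [deriv_etan, mul_zero, deriv_eta_zero]
  · exact tendsto_const_nhds.congr' ((eventually_etan_eq s hs).mono fun n hn => hn.2.symm)

end Calculus

end Peridynamics

namespace Peridynamics

/-! ### Extension by zero through a vanishing factor -/

section Cutoff

variable {d : ℕ}

lemma contDiff_mul_test {D : Set (E d)} (hD : IsOpen D) {q φ : E d → ℝ} {n : ℕ∞}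
    (hq : ContDiffOn ℝ n q D) (hφ : ContDiff ℝ n φ) (hs : tsupport φ ⊆ D) :
    ContDiff ℝ n fun x => q x * φ x := by
  refine contDiff_iff_contDiffAt.2 fun x => ?_
  by_cases hx : x ∈ D
  · exact (hq.contDiffAt (hD.mem_nhds hx)).mul hφ.contDiffAt
  · have h0 : (fun x => q x * φ x) =ᶠ[𝓝 x] fun _ => 0 := by
      filter_upwards [notMem_tsupport_iff_eventuallyEq.1 fun h => hx (hs h)] with y hy
      simp [hy]
    exact contDiffAt_const.congr_of_eventuallyEq h0

lemma fderiv_mul_test {D : Set (E d)} (hD : IsOpen D) {q φ : E d → ℝ}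
    (hq : ContDiffOn ℝ 1 q D) (hφ : ContDiff ℝ 1 φ) (v : E d) {x : E d} (hx : x ∈ D) :
    fderiv ℝ (fun x => q x * φ x) x v = fderiv ℝ q x v * φ x + q x * fderiv ℝ φ x v := by
  rw [fderiv_fun_mul ((hq.contDiffAt (hD.mem_nhds hx)).differentiableAt one_ne_zero)
    (hφ.differentiable one_ne_zero x)]
  simp only [add_apply, smul_apply, smul_eq_mul]
  ring

lemma tsupport_mul_test_subset (q φ : E d → ℝ) :
    tsupport (fun x => q x * φ x) ⊆ tsupport φ :=
  closure_mono (Function.support_mul_subset_right _ _)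

lemma measurable_pd (p : E d → ℝ) (v : E d) : Measurable fun x => fderiv ℝ p x v :=
  measurable_fderiv_apply_const ℝ p v

lemma aestronglyMeasurable_of_contDiffOn {D U : Set (E d)} (hD : IsOpen D) (hUD : U ⊆ D)
    {p : E d → ℝ} (hp : ContinuousOn p D) : AEStronglyMeasurable p (volume.restrict U) :=
  (hp.aestronglyMeasurable hD.measurableSet).mono_measure (Measure.restrict_mono_set _ hUD)

lemma integrable_bounded_mul {α : Type*} [MeasurableSpace α] {μ : Measure α} {f ψ : α → ℝ}
    (hf : Integrable f μ) (hψ : AEStronglyMeasurable ψ μ) {B : ℝ}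
    (hB : ∀ᵐ x ∂μ, |ψ x| ≤ B) : Integrable (fun x => ψ x * f x) μ :=
  hf.bdd_mul hψ hB

/-- The product of a weakly differentiable function with a `C^1` function. -/
lemma WeakPD.contDiffOn_mul {U : Set (E d)} (hU : IsOpen U) {i : Fin d} {p : E d → ℝ}
    (hp : ContDiffOn ℝ 1 p U) {B : ℝ} (hB : ∀ x ∈ U, |p x| ≤ B)
    (hB' : ∀ x ∈ U, |fderiv ℝ p x (basisVec i)| ≤ B) {h k : E d → ℝ}
    (hhk : WeakPD U i h k) (ih : IntegrableOn h U) (ik : IntegrableOn k U) :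
    WeakPD U i (fun x => p x * h x)
      (fun x => fderiv ℝ p x (basisVec i) * h x + p x * k x) := by
  have mp := aestronglyMeasurable_of_contDiffOn hU subset_rfl hp.continuousOn
  have aB : ∀ᵐ x ∂(volume.restrict U), |p x| ≤ B :=
    (ae_restrict_mem hU.measurableSet).mono hB
  have aB' : ∀ᵐ x ∂(volume.restrict U), |fderiv ℝ p x (basisVec i)| ≤ B :=
    (ae_restrict_mem hU.measurableSet).mono hB'
  have i1 := integrable_bounded_mul ih mp aB
  have i2 := integrable_bounded_mul ih (measurable_pd p (basisVec i)).aestronglyMeasurable aB'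
  have i3 := integrable_bounded_mul ik mp aB
  refine ⟨locallyIntegrableOn_of_integrable i1, locallyIntegrableOn_of_integrable (i2.add i3),
    fun φ hφ hc hs => ?_⟩
  have hφ1 : ContDiff ℝ 1 φ := hφ.of_le (by exact_mod_cast le_top)
  have hts := tsupport_mul_test_subset p φ
  have key := hhk.test_contDiff_one hU (contDiff_mul_test (n := 1) hU hp hφ1 hs)
    (hc.of_isClosed_subset (isClosed_tsupport _) hts) (hts.trans hs)
  obtain ⟨Bφ, -, hBφ⟩ := exists_bound_of_hasCompactSupport hφ.continuous hc
  obtain ⟨Bφ', -, hBφ'⟩ := exists_bound_of_hasCompactSupport (continuous_pd hφ1 (basisVec i))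
    (hasCompactSupport_pd hc _)
  have j1 := integrable_bounded_mul i1 (continuous_pd hφ1 (basisVec i)).aestronglyMeasurable
    (Eventually.of_forall hBφ')
  have j2 := integrable_bounded_mul i2 hφ.continuous.aestronglyMeasurable
    (Eventually.of_forall hBφ)
  have j3 := integrable_bounded_mul i3 hφ.continuous.aestronglyMeasurable
    (Eventually.of_forall hBφ)
  simp only [smul_eq_mul, mul_add]
  rw [integral_add j2 j3]
  have e1 : ∫ x in U, fderiv ℝ (fun x => p x * φ x) x (basisVec i) • h x
      = (∫ x in U, φ x * (fderiv ℝ p x (basisVec i) * h x))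
        + ∫ x in U, fderiv ℝ φ x (basisVec i) * (p x * h x) := by
    rw [← integral_add j2 j1]
    refine setIntegral_congr_fun hU.measurableSet fun x hx => ?_
    simp only [fderiv_mul_test hU hp hφ1 _ hx, smul_eq_mul]
    ring
  have e2 : ∫ x in U, (p x * φ x) • k x = ∫ x in U, φ x * (p x * k x) :=
    integral_congr_ae (Eventually.of_forall fun x => by simp only [smul_eq_mul]; ring)
  rw [e1, e2] at key
  linarith

/-- Extension by zero of the product of a weakly differentiable function on `U` with a
`C^1` function on `D` which vanishes on `D \ U`. -/
lemma WeakPD.cutoff {D U : Set (E d)} (hD : IsOpen D) (hU : IsOpen U) (hUD : U ⊆ D) {i : Fin d}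
    {p : E d → ℝ} (hp : ContDiffOn ℝ 1 p D) (hp0 : ∀ x ∈ D, x ∉ U → p x = 0) {B : ℝ}
    (hB : ∀ x ∈ D, |p x| ≤ B) (hB' : ∀ x ∈ D, |fderiv ℝ p x (basisVec i)| ≤ B) {h k : E d → ℝ}
    (hhk : WeakPD U i h k) (ih : IntegrableOn h U) (ik : IntegrableOn k U) :
    WeakPD D i (U.indicator fun x => p x * h x)
      (U.indicator fun x => fderiv ℝ p x (basisVec i) * h x + p x * k x) := by
  have mp := aestronglyMeasurable_of_contDiffOn hD hUD hp.continuousOn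
  have aB : ∀ᵐ x ∂(volume.restrict U), |p x| ≤ B :=
    (ae_restrict_mem hU.measurableSet).mono fun x hx => hB x (hUD hx)
  have aB' : ∀ᵐ x ∂(volume.restrict U), |fderiv ℝ p x (basisVec i)| ≤ B :=
    (ae_restrict_mem hU.measurableSet).mono fun x hx => hB' x (hUD hx)
  set p' : E d → ℝ := fun x => fderiv ℝ p x (basisVec i) with hp'
  have mp' : AEStronglyMeasurable p' (volume.restrict U) :=
    (measurable_pd p (basisVec i)).aestronglyMeasurable
  obtain ⟨C, hC1, hC⟩ := exists_deriv_eta_bound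
  have hC0 : 0 ≤ C := zero_le_one.trans hC1
  -- κ(p) is the limit of ηₙ'(p). The approximation first yields a derivative with κ(p) p' in place
  -- of p'; this is corrected at the end.
  set κ : ℝ → ℝ := fun s => if s = 0 then 0 else 1 with hκ
  have mκ : AEStronglyMeasurable (fun x => κ (p x) * p' x) (volume.restrict U) := by
    have : Measurable κ := Measurable.ite (measurableSet_singleton 0) measurable_const
      measurable_const
    exact (this.comp_aemeasurable mp.aemeasurable).aestronglyMeasurable.mul mp'
  have aκ : ∀ᵐ x ∂(volume.restrict U), |κ (p x) * p' x| ≤ B := by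
    filter_upwards [aB'] with x hx
    rw [abs_mul]
    have : |κ (p x)| ≤ 1 := by simp only [hκ]; split_ifs <;> simp
    exact (mul_le_of_le_one_left (abs_nonneg _) this).trans hx
  have i1 := integrable_bounded_mul ih mp aB
  have i2 := integrable_bounded_mul ih mκ aκ
  have i3 := integrable_bounded_mul ik mp aB
  have hUD' : U ∩ D = U := inter_eq_left.2 hUD
  have main : WeakPD D i (U.indicator fun x => p x * h x)
      (U.indicator fun x => κ (p x) * p' x * h x + p x * k x) := by
    refine ⟨locallyIntegrableOn_of_integrable
        (IntegrableOn.integrable_indicator i1 hU.measurableSet).restrict,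
      locallyIntegrableOn_of_integrable
        (IntegrableOn.integrable_indicator (i2.add i3) hU.measurableSet).restrict,
      fun φ hφ hc hs => ?_⟩
    have hφ1 : ContDiff ℝ 1 φ := hφ.of_le (by exact_mod_cast le_top)
    obtain ⟨Bφ, hBφ0, hBφ⟩ := exists_bound_of_hasCompactSupport hφ.continuous hc
    obtain ⟨Bφ', hBφ0', hBφ'⟩ := exists_bound_of_hasCompactSupport
      (continuous_pd hφ1 (basisVec i)) (hasCompactSupport_pd hc _)
    set φ' : E d → ℝ := fun x => fderiv ℝ φ x (basisVec i) with hφ'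
    have hφ'c : Continuous φ' := continuous_pd hφ1 _
    have hqC : ∀ n, ContDiffOn ℝ 1 (fun x => etan n (p x)) D := fun n =>
      ((etan_contDiff n).of_le (by exact_mod_cast le_top)).comp_contDiffOn hp
    have hq' : ∀ n, ∀ x ∈ D, fderiv ℝ (fun x => etan n (p x)) x (basisVec i)
        = deriv (etan n) (p x) * p' x := by
      intro n x hx
      have h3 := ((etan_contDiff n).differentiable (by simp) (p x)).hasDerivAt.comp_hasFDerivAt x
        ((hp.contDiffAt (hD.mem_nhds hx)).differentiableAt one_ne_zero).hasFDerivAt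
      rw [show (fun x => etan n (p x)) = etan n ∘ p from rfl, h3.fderiv, smul_apply, smul_eq_mul]
    -- At a point of supp φ outside U the factor p vanishes, so by continuity |p| < 1/(n+1) nearby
    -- and ηₙ(p) is zero there. Hence ηₙ(p) φ is supported inside U, where h may be tested; the test
    -- function is only C¹.
    have hts : ∀ n, tsupport (fun x => etan n (p x) * φ x) ⊆ U := by
      intro n x hx
      have hxφ := tsupport_mul_test_subset _ _ hx
      by_contra hxU
      have hpx := hp0 x (hs hxφ) hxU
      have hcp : ContinuousAt p x := hp.continuousOn.continuousAt (hD.mem_nhds (hs hxφ))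
      refine notMem_tsupport_iff_eventuallyEq.2 ?_ hx
      have hb : Metric.ball (0 : ℝ) (1 / ((n : ℝ) + 1)) ∈ 𝓝 (p x) := by
        rw [hpx]; exact Metric.ball_mem_nhds _ (by positivity)
      filter_upwards [hcp hb] with y hy
      rw [etan_eq_zero (by simpa using (Metric.mem_ball.1 hy).le), zero_mul, Pi.zero_apply]
    have key : ∀ n, ∫ x in U, (deriv (etan n) (p x) * p' x * φ x + etan n (p x) * φ' x) * h x
        = - ∫ x in U, etan n (p x) * φ x * k x := by
      intro n
      have h1 := hhk.test_contDiff_one hU (contDiff_mul_test (n := 1) hD (hqC n) hφ1 hs)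
        (hc.of_isClosed_subset (isClosed_tsupport _) (tsupport_mul_test_subset _ _)) (hts n)
      simp only [smul_eq_mul] at h1
      rw [← h1]
      refine setIntegral_congr_fun hU.measurableSet fun x hx => ?_
      simp only [fderiv_mul_test hD (hqC n) hφ1 _ (hUD hx), hq' n x (hUD hx)]
      rfl
    have mη : ∀ n, AEStronglyMeasurable (fun x => etan n (p x)) (volume.restrict U) := fun n =>
      (etan_contDiff n).continuous.comp_aestronglyMeasurable mp
    have mη' : ∀ n, AEStronglyMeasurable (fun x => deriv (etan n) (p x)) (volume.restrict U) :=
      fun n => ((etan_contDiff n).continuous_deriv (by exact_mod_cast le_top)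
        ).comp_aestronglyMeasurable mp
    have l1 : Tendsto (fun n => ∫ x in U, (deriv (etan n) (p x) * p' x * φ x
        + etan n (p x) * φ' x) * h x) atTop
        (𝓝 (∫ x in U, (κ (p x) * p' x * φ x + p x * φ' x) * h x)) := by
      refine tendsto_integral_of_dominated_convergence (fun x => (C * B * Bφ + B * Bφ') * ‖h x‖)
        (fun n => ?_) (ih.norm.const_mul _) (fun n => ?_) (Eventually.of_forall fun x => ?_)
      · exact ((((mη' n).mul mp').mul hφ.continuous.aestronglyMeasurable).add
          ((mη n).mul hφ'c.aestronglyMeasurable)).mul ih.1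
      · filter_upwards [aB, aB'] with x hx hx'
        have hB0 : 0 ≤ B := (abs_nonneg _).trans hx
        rw [norm_mul]
        refine mul_le_mul_of_nonneg_right ?_ (norm_nonneg _)
        refine (norm_add_le _ _).trans (add_le_add ?_ ?_)
        · rw [norm_mul, norm_mul]
          gcongr
          · rw [deriv_etan]; exact hC _
          · exact hx'
          · exact hBφ x
        · rw [norm_mul]
          gcongr
          · exact (abs_etan_le n _).trans hx
          · exact hBφ' x
      · exact ((((tendsto_deriv_etan (p x)).mul_const _).mul_const _).add
          ((tendsto_etan (p x)).mul_const _)).mul_const _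
    have l2 : Tendsto (fun n => ∫ x in U, etan n (p x) * φ x * k x) atTop
        (𝓝 (∫ x in U, p x * φ x * k x)) := by
      refine tendsto_integral_of_dominated_convergence (fun x => (B * Bφ) * ‖k x‖)
        (fun n => ?_) (ik.norm.const_mul _) (fun n => ?_) (Eventually.of_forall fun x => ?_)
      · exact ((mη n).mul hφ.continuous.aestronglyMeasurable).mul ik.1
      · filter_upwards [aB] with x hx
        have hB0 : 0 ≤ B := (abs_nonneg _).trans hx
        rw [norm_mul, norm_mul]
        gcongr
        · exact (abs_etan_le n _).trans hx
        · exact hBφ x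
      · exact ((tendsto_etan (p x)).mul_const _).mul_const _
    have h2 := tendsto_nhds_unique (l1.congr key) l2.neg
    have j1 := integrable_bounded_mul i1 hφ'c.aestronglyMeasurable (Eventually.of_forall hBφ')
    have j2 := integrable_bounded_mul i2 hφ.continuous.aestronglyMeasurable
      (Eventually.of_forall hBφ)
    have j3 := integrable_bounded_mul i3 hφ.continuous.aestronglyMeasurable
      (Eventually.of_forall hBφ)
    have e1 : ∫ x in U, (κ (p x) * p' x * φ x + p x * φ' x) * h x
        = (∫ x in U, φ x * (κ (p x) * p' x * h x)) + ∫ x in U, φ' x * (p x * h x) := by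
      rw [← integral_add j2 j1]
      exact integral_congr_ae (Eventually.of_forall fun x => by ring)
    have e2 : ∫ x in U, p x * φ x * k x = ∫ x in U, φ x * (p x * k x) :=
      integral_congr_ae (Eventually.of_forall fun x => by ring)
    have e3 : ∀ (ψ g : E d → ℝ), ∫ x in D, ψ x • U.indicator g x = ∫ x in U, ψ x * g x := by
      intro ψ g
      have : ∀ x, ψ x • U.indicator g x = U.indicator (fun x => ψ x * g x) x := fun x => by
        by_cases hx : x ∈ U <;> simp [hx]
      simp only [this]
      rw [integral_indicator hU.measurableSet, Measure.restrict_restrict hU.measurableSet, hUD']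
    rw [e3, e3]
    simp only [mul_add]
    rw [integral_add j2 j3]
    rw [e1, e2] at h2
    linarith
  -- Inside U the ordinary product rule holds with p' itself, so uniqueness on U replaces κ(p) p' h
  -- by p' h.
  have hloc : WeakPD U i (U.indicator fun x => p x * h x)
      (fun x => p' x * h x + p x * k x) := by
    refine (WeakPD.contDiffOn_mul hU (hp.mono hUD) (fun x hx => hB x (hUD hx))
      (fun x hx => hB' x (hUD hx)) hhk ih ik).congr_ae ?_ (EventuallyEq.refl _ _)
    filter_upwards [ae_restrict_mem hU.measurableSet] with x hx
    rw [indicator_of_mem hx]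
  have hae := (main.mono hUD).unique hU hloc
  refine main.congr_ae (EventuallyEq.refl _ _) ?_
  refine ae_restrict_of_ae ?_
  rw [EventuallyEq, ae_restrict_iff' hU.measurableSet] at hae
  filter_upwards [hae] with x hx
  by_cases hxU : x ∈ U
  · rw [hx hxU, indicator_of_mem hxU]
  · simp [hxU]

end Cutoff

/-! ### Chosen weak derivatives and approximation in H¹₀ -/

section Hone

variable {d : ℕ}

/-- Links the derivative picked by choice, in which the norms are written, to any explicit weak
derivative. -/
lemma weakPartial_ae_eq {D : Set (E d)} (hD : IsOpen D) {i : Fin d} {u g : E d → E d}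
    (h : WeakPD D i u g) : weakPartial D i u =ᵐ[volume.restrict D] g := by
  have hex : ∃ g, HasWeakPartial D i u g := ⟨g, h⟩
  rw [weakPartial, dif_pos hex]
  exact WeakPD.unique hD hex.choose_spec h

lemma weakPD_weakPartial {D : Set (E d)} {i : Fin d} {u : E d → E d}
    (h : ∃ g, HasWeakPartial D i u g) : WeakPD D i u (weakPartial D i u) := by
  rw [weakPartial, dif_pos h]
  exact h.choose_spec

/-- An equality of functions, not only almost everywhere: the two predicates from which the choice
is made are the same, so the same witness is chosen. -/
lemma weakPartial_congr_ae {D : Set (E d)} {i : Fin d} {u u' : E d → E d}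
    (h : u =ᵐ[volume.restrict D] u') : weakPartial D i u = weakPartial D i u' := by
  have : HasWeakPartial D i u = HasWeakPartial D i u' := by
    ext g
    exact ⟨fun hg => WeakPD.congr_ae hg h (EventuallyEq.refl _ _),
      fun hg => WeakPD.congr_ae hg h.symm (EventuallyEq.refl _ _)⟩
  unfold weakPartial
  rw [this]

lemma l2Norm_congr_ae {D : Set (E d)} {u u' : E d → E d}
    (h : u =ᵐ[volume.restrict D] u') : l2Norm D u = l2Norm D u' := by
  rw [l2Norm, l2Norm, eLpNorm_congr_ae h]

lemma l2Norm_le_h1Norm (D : Set (E d)) (u : E d → E d) : l2Norm D u ≤ h1Norm D u := by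
  refine Real.le_sqrt_of_sq_le (le_add_of_nonneg_right ?_)
  exact Finset.sum_nonneg fun i _ => sq_nonneg _

lemma l2Norm_partial_le_h1Norm (D : Set (E d)) (u : E d → E d) (i : Fin d) :
    l2Norm D (weakPartial D i u) ≤ h1Norm D u := by
  refine Real.le_sqrt_of_sq_le ?_
  refine le_trans ?_ (le_add_of_nonneg_left (sq_nonneg _))
  exact Finset.single_le_sum (f := fun i => l2Norm D (weakPartial D i u) ^ 2)
    (fun i _ => sq_nonneg _) (Finset.mem_univ i)

/-- Approximation of functions in `H^1_0` by test functions. -/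
lemma MemH10.exists_seq {D : Set (E d)} (hD : IsOpen D) {u : E d → E d} (hu : MemH10 D u)
    {g : Fin d → E d → E d} (hg : ∀ i, WeakPD D i u (g i)) :
    ∃ φ : ℕ → E d → E d, (∀ n, ContDiff ℝ ∞ (φ n) ∧ HasCompactSupport (φ n) ∧
      tsupport (φ n) ⊆ D) ∧
      Tendsto (fun n => eLpNorm (φ n - u) 2 (volume.restrict D)) atTop (𝓝 0) ∧
      ∀ i, Tendsto (fun n => eLpNorm ((fun x => fderiv ℝ (φ n) x (basisVec i)) - g i) 2
        (volume.restrict D)) atTop (𝓝 0) := by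
  have hpos : ∀ n : ℕ, (0 : ℝ) < 1 / ((n : ℝ) + 1) := fun n => by positivity
  choose φ h1 h2 h3 h4 using fun n : ℕ => hu.2 _ (hpos n)
  have hgL : ∀ i, MemLp (g i) 2 (volume.restrict D) := fun i => by
    obtain ⟨g', hg', hL⟩ := hu.1.2 i
    exact MemLp.ae_eq (WeakPD.unique hD hg' (hg i)) hL
  have hφ1 : ∀ n, ContDiff ℝ 1 (φ n) := fun n => (h1 n).of_le (by exact_mod_cast le_top)
  have hlim : Tendsto (fun n : ℕ => ENNReal.ofReal (1 / ((n : ℝ) + 1))) atTop (𝓝 0) := by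
    have := ENNReal.tendsto_ofReal tendsto_one_div_add_atTop_nhds_zero_nat
    rwa [ENNReal.ofReal_zero] at this
  refine ⟨φ, fun n => ⟨h1 n, h2 n, h3 n⟩, ?_, fun i => ?_⟩
  · refine tendsto_of_tendsto_of_tendsto_of_le_of_le tendsto_const_nhds hlim (fun _ => zero_le)
      fun n => ?_
    have hm : MemLp (u - φ n) 2 (volume.restrict D) := hu.1.1.sub
      (((h1 n).continuous.memLp_of_hasCompactSupport (h2 n)).restrict D)
    rw [eLpNorm_sub_comm, ← ENNReal.ofReal_toReal hm.2.ne]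
    exact ENNReal.ofReal_le_ofReal ((l2Norm_le_h1Norm D _).trans (h4 n).le)
  · refine tendsto_of_tendsto_of_tendsto_of_le_of_le tendsto_const_nhds hlim (fun _ => zero_le)
      fun n => ?_
    have hm : MemLp (g i - fun x => fderiv ℝ (φ n) x (basisVec i)) 2 (volume.restrict D) :=
      (hgL i).sub (((continuous_pd (hφ1 n) _).memLp_of_hasCompactSupport
        (hasCompactSupport_pd (h2 n) _)).restrict D)
    have hw : WeakPD D i (u - φ n) (g i - fun x => fderiv ℝ (φ n) x (basisVec i)) :=
      (hg i).sub (WeakPD.of_contDiff D i (hφ1 n))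
    rw [eLpNorm_sub_comm, ← ENNReal.ofReal_toReal hm.2.ne]
    refine ENNReal.ofReal_le_ofReal ?_
    have := l2Norm_partial_le_h1Norm D (u - φ n) i
    rw [l2Norm_congr_ae (weakPartial_ae_eq hD hw)] at this
    exact this.trans (h4 n).le

end Hone

end Peridynamics

namespace Peridynamics

/-! ### Zero boundary values and gradients in L⁴ -/

section Embedding

variable {d : ℕ}

/-- `a` is the limit in `H^1(D)` of test functions, with weak partial derivatives `a' i`. -/
structure IsH10 (D : Set (E d)) (a : E d → ℝ) (a' : Fin d → E d → ℝ) : Prop where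
  memLp : MemLp a 2 (volume.restrict D)
  memLp' : ∀ i, MemLp (a' i) 2 (volume.restrict D)
  exists_seq : ∃ φ : ℕ → E d → ℝ, (∀ n, ContDiff ℝ ∞ (φ n) ∧ HasCompactSupport (φ n) ∧
      tsupport (φ n) ⊆ D) ∧
      Tendsto (fun n => eLpNorm (φ n - a) 2 (volume.restrict D)) atTop (𝓝 0) ∧
      ∀ i, Tendsto (fun n => eLpNorm ((fun x => fderiv ℝ (φ n) x (basisVec i)) - a' i) 2
        (volume.restrict D)) atTop (𝓝 0)

/-- Reduction from vector fields to scalars: a bounded functional applied to the approximating test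
fields keeps their smoothness, support and convergence. -/
lemma MemH10.isH10 {D : Set (E d)} (hD : IsOpen D) {u : E d → E d} (hu : MemH10 D u)
    {g : Fin d → E d → E d} (hg : ∀ i, WeakPD D i u (g i)) (L : E d →L[ℝ] ℝ) :
    IsH10 D (fun x => L (u x)) (fun i x => L (g i x)) := by
  have hgL : ∀ i, MemLp (g i) 2 (volume.restrict D) := fun i => by
    obtain ⟨g', hg', hL⟩ := hu.1.2 i
    exact MemLp.ae_eq (WeakPD.unique hD hg' (hg i)) hL
  obtain ⟨φ, h1, h2, h3⟩ := hu.exists_seq hD hg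
  have hlim : ∀ (v : E d → E d) (f : ℕ → E d → E d),
      Tendsto (fun n => eLpNorm (f n - v) 2 (volume.restrict D)) atTop (𝓝 0) →
      Tendsto (fun n => eLpNorm ((fun x => L (f n x)) - fun x => L (v x)) 2 (volume.restrict D))
        atTop (𝓝 0) := by
    intro v f hf
    have h4 : Tendsto (fun n => ENNReal.ofReal ‖L‖ * eLpNorm (f n - v) 2 (volume.restrict D))
        atTop (𝓝 0) := by
      have := ENNReal.Tendsto.const_mul (a := ENNReal.ofReal ‖L‖) hf
        (Or.inr ENNReal.ofReal_ne_top)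
      rwa [mul_zero] at this
    refine tendsto_of_tendsto_of_tendsto_of_le_of_le tendsto_const_nhds h4 (fun _ => zero_le)
      fun n => eLpNorm_le_mul_eLpNorm_of_ae_le_mul (Eventually.of_forall fun x => ?_) 2
    simp only [Pi.sub_apply]
    rw [← map_sub]
    exact L.le_opNorm _
  refine ⟨L.comp_memLp' hu.1.1, fun i => L.comp_memLp' (hgL i),
    fun n x => L (φ n x), fun n => ⟨L.contDiff.comp (h1 n).1, (h1 n).2.1.comp_left (map_zero L),
      (closure_mono (Function.support_comp_subset (map_zero L) _)).trans (h1 n).2.2⟩,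
      hlim u φ h2, fun i => ?_⟩
  have h5 := hlim (g i) (fun n x => fderiv ℝ (φ n) x (basisVec i)) (h3 i)
  refine h5.congr fun n => ?_
  congr 2
  ext x
  have h6 := L.hasFDerivAt.comp x (((h1 n).1.differentiable (by simp) x).hasFDerivAt)
  change _ = fderiv ℝ (L ∘ φ n) x (basisVec i)
  rw [h6.fderiv]
  rfl

variable {D : Set (E d)} {a : E d → ℝ} {a' : Fin d → E d → ℝ}

/-- Integration by parts against a function with zero boundary values. -/
lemma IsH10.integral_mul (ha : IsH10 D a a') {i : Fin d} {b b' : E d → ℝ}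
    (hb : WeakPD D i b b') (mb : MemLp b 2 (volume.restrict D))
    (mb' : MemLp b' 2 (volume.restrict D)) :
    ∫ x in D, b x * a' i x = - ∫ x in D, b' x * a x := by
  obtain ⟨φ, h1, h2, h3⟩ := ha.exists_seq
  have hφ1 : ∀ n, ContDiff ℝ 1 (φ n) := fun n => (h1 n).1.of_le (by exact_mod_cast le_top)
  have t1 := tendsto_integral_mul_of_eLpNorm (ha.memLp' i) (fun n => memLp_test
    (continuous_pd (hφ1 n) (basisVec i)) (hasCompactSupport_pd (h1 n).2.1 _) 2 D) mb (h3 i)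
  have t2 := tendsto_integral_mul_of_eLpNorm ha.memLp (fun n => memLp_test
    (h1 n).1.continuous (h1 n).2.1 2 D) mb' h2
  refine tendsto_nhds_unique (t1.congr fun n => ?_) t2.neg
  have := hb.2.2 (φ n) (h1 n).1 (h1 n).2.1 (h1 n).2.2
  simp only [smul_eq_mul, mul_comm] at this ⊢
  exact this

/-- The test function here need not vanish near ∂D; the boundary term is absent because a is an H¹
limit of functions with compact support in D. -/
lemma IsH10.weakPD (hD : IsOpen D) (hDb : Bornology.IsBounded D) (ha : IsH10 D a a') (i : Fin d) :
    WeakPD univ i (D.indicator a) (D.indicator (a' i)) := by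
  have hfin : IsFiniteMeasure (volume.restrict D) := ⟨by simpa using hDb.measure_lt_top⟩
  refine ⟨locallyIntegrableOn_of_integrable
      (IntegrableOn.integrable_indicator (ha.memLp.integrable one_le_two) hD.measurableSet).restrict,
    locallyIntegrableOn_of_integrable (IntegrableOn.integrable_indicator
      ((ha.memLp' i).integrable one_le_two) hD.measurableSet).restrict, fun φ hφ hc _ => ?_⟩
  have hφ1 : ContDiff ℝ 1 φ := hφ.of_le (by exact_mod_cast le_top)
  have h := ha.integral_mul (WeakPD.of_contDiff D i hφ1) (memLp_test hφ.continuous hc 2 D)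
    (memLp_test (continuous_pd hφ1 _) (hasCompactSupport_pd hc _) 2 D)
  have e3 : ∀ (ψ g : E d → ℝ), ∫ x in univ, ψ x • D.indicator g x = ∫ x in D, ψ x * g x := by
    intro ψ g
    have : ∀ x, ψ x • D.indicator g x = D.indicator (fun x => ψ x * g x) x := fun x => by
      by_cases hx : x ∈ D <;> simp [hx]
    simp only [this]
    rw [integral_indicator hD.measurableSet, Measure.restrict_restrict hD.measurableSet,
      inter_univ]
  rw [e3, e3, h, neg_neg]

/-- The truncated cube. -/
noncomputable def cubeT (t s : ℝ) : ℝ := s ^ 3 / (1 + t * s ^ 2)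

/-- The truncated square. -/
noncomputable def sqT (t s : ℝ) : ℝ := s ^ 2 / (1 + t * s ^ 2)

lemma hasDerivAt_cubeT {t : ℝ} (ht : 0 < t) (s : ℝ) :
    HasDerivAt (cubeT t) ((3 * s ^ 2 + t * s ^ 4) / (1 + t * s ^ 2) ^ 2) s := by
  have h0 : 1 + t * s ^ 2 ≠ 0 := by positivity
  have h1 : HasDerivAt (fun s : ℝ => 1 + t * s ^ 2) (t * (2 * s)) s := by
    simpa using ((hasDerivAt_pow 2 s).const_mul t).const_add 1
  have h2 := (hasDerivAt_pow 3 s).div h1 h0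
  refine h2.congr_deriv ?_
  rw [div_left_inj' (by positivity)]
  push_cast
  ring

lemma contDiff_cubeT {t : ℝ} (ht : 0 < t) : ContDiff ℝ 1 (cubeT t) := by
  refine (contDiff_id.pow 3).div (contDiff_const.add (contDiff_const.mul (contDiff_id.pow 2)))
    fun s => ?_
  have : 0 < 1 + t * s ^ 2 := by positivity
  exact this.ne'

/-- The two truncations are paired so as to keep, as inequalities, (s³)' = 3s² here and (s²)² = s³ ·
s in `sqT_sq_le`, while the derivative of the cube remains bounded. -/
lemma abs_deriv_cubeT_le {t : ℝ} (ht : 0 < t) (s : ℝ) : |deriv (cubeT t) s| ≤ 3 * sqT t s := by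
  rw [(hasDerivAt_cubeT ht s).deriv, abs_of_nonneg (by positivity), sqT, div_le_iff₀ (by positivity)]
  have h0 : 0 < 1 + t * s ^ 2 := by positivity
  have : 3 * (s ^ 2 / (1 + t * s ^ 2)) * (1 + t * s ^ 2) ^ 2 = 3 * s ^ 2 * (1 + t * s ^ 2) := by
    field_simp
  rw [this]
  have : 0 ≤ t * s ^ 4 := by positivity
  nlinarith

lemma sqT_nonneg {t : ℝ} (ht : 0 < t) (s : ℝ) : 0 ≤ sqT t s := by unfold sqT; positivity

lemma sqT_le {t : ℝ} (ht : 0 < t) (s : ℝ) : sqT t s ≤ 1 / t := by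
  rw [sqT, div_le_div_iff₀ (by positivity) ht]
  nlinarith [sq_nonneg s]

lemma sqT_sq_le {t : ℝ} (ht : 0 < t) (s : ℝ) : sqT t s ^ 2 ≤ cubeT t s * s := by
  have h0 : 0 < 1 + t * s ^ 2 := by positivity
  rw [sqT, cubeT, div_pow, div_mul_eq_mul_div, div_le_div_iff₀ (by positivity) h0]
  have h1 : 0 ≤ t * s ^ 2 := by positivity
  have h2 : 0 ≤ s ^ 4 := by positivity
  have : s ^ 3 * s * (1 + t * s ^ 2) ^ 2 - (s ^ 2) ^ 2 * (1 + t * s ^ 2)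
      = s ^ 4 * (1 + t * s ^ 2) * (t * s ^ 2) := by ring
  have h3 : 0 ≤ s ^ 4 * (1 + t * s ^ 2) * (t * s ^ 2) := by positivity
  linarith

lemma continuous_sqT {t : ℝ} (ht : 0 < t) : Continuous (sqT t) := by
  refine (continuous_pow 2).div (by fun_prop) fun s => ?_
  positivity

/-- With g = ∂_i a this is ∫ g⁴ = ∫ g³ ∂_i a = -3 ∫ g² h a, truncated so that the chain rule applies
and all integrals are finite. Young's inequality 3 q |h| A ≤ q²/2 + (9/2) A² h² lets half of the
left side be absorbed, whence the 9. The bound does not depend on t. -/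
lemma integral_sqT_sq_le (hD : IsOpen D) (hDb : Bornology.IsBounded D) (ha : IsH10 D a a')
    {i : Fin d} {h : E d → ℝ} (hh : WeakPD D i (a' i) h) (mh : MemLp h 2 (volume.restrict D))
    {A : ℝ} (hA : ∀ᵐ x ∂(volume.restrict D), |a x| ≤ A) {t : ℝ} (ht : 0 < t) :
    ∫ x in D, sqT t (a' i x) ^ 2 ≤ 9 * A ^ 2 * ∫ x in D, h x ^ 2 := by
  have hfin : IsFiniteMeasure (volume.restrict D) := ⟨by simpa using hDb.measure_lt_top⟩
  have hDv : volume D ≠ ⊤ := hDb.measure_lt_top.ne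
  have hL : ∀ s, |deriv (cubeT t) s| ≤ 3 * (1 / t) := fun s =>
    (abs_deriv_cubeT_le ht s).trans (by gcongr; exact sqT_le ht s)
  have m' := ha.memLp' i
  have mq : MemLp (fun x => sqT t (a' i x)) 2 (volume.restrict D) := by
    refine MemLp.of_bound ((continuous_sqT ht).comp_aestronglyMeasurable m'.1) (1 / t)
      (Eventually.of_forall fun x => ?_)
    rw [Real.norm_of_nonneg (sqT_nonneg ht _)]
    exact sqT_le ht _
  have mT := memLp_comp_of_deriv_bounded hDv (contDiff_cubeT ht) hL m'
  have mT' : MemLp (fun x => deriv (cubeT t) (a' i x) * h x) 2 (volume.restrict D) :=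
    memLp_mul_bounded mh (((contDiff_cubeT ht).continuous_deriv le_rfl).comp_aestronglyMeasurable
      m'.1) (Eventually.of_forall fun x => hL _)
  have ibp := ha.integral_mul (WeakPD.comp hD hDv (contDiff_cubeT ht) hL hh m' mh) mT mT'
  have i1 : Integrable (fun x => sqT t (a' i x) ^ 2) (volume.restrict D) := mq.integrable_sq
  have i2 : Integrable (fun x => h x ^ 2) (volume.restrict D) := mh.integrable_sq
  have s1 : ∫ x in D, sqT t (a' i x) ^ 2 ≤ ∫ x in D, cubeT t (a' i x) * a' i x :=
    integral_mono i1 (integrable_mul_of_memLp mT m') fun x => sqT_sq_le ht _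
  have s2 : - ∫ x in D, deriv (cubeT t) (a' i x) * h x * a x
      ≤ ∫ x in D, (2⁻¹ * sqT t (a' i x) ^ 2 + 9 / 2 * A ^ 2 * h x ^ 2) := by
    rw [← integral_neg]
    refine integral_mono_ae (integrable_mul_of_memLp mT' ha.memLp).neg
      ((i1.const_mul _).add (i2.const_mul _)) ?_
    filter_upwards [hA] with x hx
    have h1 := abs_deriv_cubeT_le ht (a' i x)
    have h2 : -(deriv (cubeT t) (a' i x) * h x * a x) ≤ 3 * sqT t (a' i x) * |h x| * A := by
      refine (neg_le_abs _).trans ?_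
      rw [abs_mul, abs_mul]
      have := sqT_nonneg ht (a' i x)
      gcongr
    refine h2.trans ?_
    have h3 := sq_nonneg (sqT t (a' i x) - 3 * A * |h x|)
    have h4 : |h x| ^ 2 = h x ^ 2 := sq_abs _
    rw [← h4]
    nlinarith
  rw [integral_add (i1.const_mul _) (i2.const_mul _), integral_const_mul, integral_const_mul] at s2
  linarith

/-- Functions of `H^2 ∩ H^1_0 ∩ L^∞` have gradients in `L^4`. -/
lemma lintegral_pow_four_le (hD : IsOpen D) (hDb : Bornology.IsBounded D) (ha : IsH10 D a a')
    {i : Fin d} {h : E d → ℝ} (hh : WeakPD D i (a' i) h) (mh : MemLp h 2 (volume.restrict D))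
    {A : ℝ} (hA : ∀ᵐ x ∂(volume.restrict D), |a x| ≤ A) :
    ∫⁻ x in D, ‖a' i x‖ₑ ^ (4 : ℝ) ≤ ENNReal.ofReal (9 * A ^ 2 * ∫ x in D, h x ^ 2) := by
  have hfin : IsFiniteMeasure (volume.restrict D) := ⟨by simpa using hDb.measure_lt_top⟩
  have m' := ha.memLp' i
  have hpos : ∀ n : ℕ, (0 : ℝ) < 1 / ((n : ℝ) + 1) := fun n => by positivity
  have h1 : ∀ n : ℕ, ∫⁻ x in D, ENNReal.ofReal (sqT (1 / ((n : ℝ) + 1)) (a' i x) ^ 2)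
      ≤ ENNReal.ofReal (9 * A ^ 2 * ∫ x in D, h x ^ 2) := by
    intro n
    have mq : MemLp (fun x => sqT (1 / ((n : ℝ) + 1)) (a' i x)) 2 (volume.restrict D) := by
      refine MemLp.of_bound ((continuous_sqT (hpos n)).comp_aestronglyMeasurable m'.1)
        (1 / (1 / ((n : ℝ) + 1))) (Eventually.of_forall fun x => ?_)
      rw [Real.norm_of_nonneg (sqT_nonneg (hpos n) _)]
      exact sqT_le (hpos n) _
    rw [← ofReal_integral_eq_lintegral_ofReal mq.integrable_sq
      (Eventually.of_forall fun x => sq_nonneg _)]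
    exact ENNReal.ofReal_le_ofReal (integral_sqT_sq_le hD hDb ha hh mh hA (hpos n))
  have h2 : ∀ x, Tendsto (fun n : ℕ => ENNReal.ofReal (sqT (1 / ((n : ℝ) + 1)) (a' i x) ^ 2)) atTop
      (𝓝 (‖a' i x‖ₑ ^ (4 : ℝ))) := by
    intro x
    have e : ‖a' i x‖ₑ ^ (4 : ℝ) = ENNReal.ofReal ((a' i x ^ 2 / (1 + 0 * a' i x ^ 2)) ^ 2) := by
      rw [show (4 : ℝ) = ((4 : ℕ) : ℝ) by norm_num, ENNReal.rpow_natCast, Real.enorm_eq_ofReal_abs,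
        ← ENNReal.ofReal_pow (abs_nonneg _)]
      congr 1
      rw [zero_mul, add_zero, div_one, ← pow_mul, Even.pow_abs (by decide)]
    rw [e]
    refine ENNReal.tendsto_ofReal (Tendsto.pow ?_ 2)
    refine tendsto_const_nhds.div (tendsto_const_nhds.add
      (tendsto_one_div_add_atTop_nhds_zero_nat.mul_const _)) (by simp)
  -- Fatou's lemma along t = 1/(n+1) → 0, using that the truncated estimate is uniform in t.
  calc ∫⁻ x in D, ‖a' i x‖ₑ ^ (4 : ℝ)
      = ∫⁻ x in D, liminf (fun n : ℕ => ENNReal.ofReal (sqT (1 / ((n : ℝ) + 1)) (a' i x) ^ 2))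
          atTop := lintegral_congr fun x => (h2 x).liminf_eq.symm
    _ ≤ liminf (fun n : ℕ => ∫⁻ x in D, ENNReal.ofReal (sqT (1 / ((n : ℝ) + 1)) (a' i x) ^ 2))
          atTop := by
        refine lintegral_liminf_le' fun n => ?_
        exact (((continuous_sqT (hpos n)).comp_aestronglyMeasurable m'.1).pow 2
          ).aemeasurable.ennreal_ofReal
    _ ≤ _ := liminf_le_of_le (by isBoundedDefault) fun b hb => by
        obtain ⟨n, hn⟩ := hb.exists
        exact hn.trans (h1 n)

end Embedding

end Peridynamics

namespace Peridynamics

/-! ### Sobolev inequality and energy of truncations -/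

section Stampacchia

variable {d : ℕ}

lemma eLpNorm_two_eq {α F : Type*} [MeasurableSpace α] {μ : Measure α} [NormedAddCommGroup F]
    {f : α → F} (hf : MemLp f 2 μ) :
    eLpNorm f 2 μ = ENNReal.ofReal (Real.sqrt (∫ x, ‖f x‖ ^ 2 ∂μ)) := by
  rw [hf.eLpNorm_eq_integral_rpow_norm (by simp) (by simp), Real.sqrt_eq_rpow]
  simp

lemma tendsto_integral_sq {α : Type*} [MeasurableSpace α] {μ : Measure α} {f : ℕ → α → ℝ}
    (hf : ∀ n, MemLp (f n) 2 μ) (h : Tendsto (fun n => eLpNorm (f n) 2 μ) atTop (𝓝 0)) :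
    Tendsto (fun n => ∫ x, f n x ^ 2 ∂μ) atTop (𝓝 0) := by
  have h1 : ∀ n, ∫ x, f n x ^ 2 ∂μ = (eLpNorm (f n) 2 μ).toReal ^ 2 := by
    intro n
    rw [eLpNorm_two_eq (hf n), ENNReal.toReal_ofReal (Real.sqrt_nonneg _),
      Real.sq_sqrt (integral_nonneg fun x => sq_nonneg _)]
    simp
  simp only [h1]
  have h2 := (ENNReal.tendsto_toReal ENNReal.zero_ne_top).comp h
  simpa using h2.pow 2

lemma norm_le_sum_abs_basisVec (L : E d →L[ℝ] ℝ) : ‖L‖ ≤ ∑ i, |L (basisVec i)| := by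
  refine L.opNorm_le_bound (Finset.sum_nonneg fun i _ => abs_nonneg _) fun x => ?_
  have hx : x = ∑ i, x i • basisVec i := by
    ext j
    simp [basisVec, Pi.single_apply]
  have h1 : L x = ∑ i, x i * L (basisVec i) := by
    conv_lhs => rw [hx]
    simp
  rw [h1, Finset.sum_mul]
  refine (norm_sum_le _ _).trans (Finset.sum_le_sum fun i _ => ?_)
  rw [norm_mul, mul_comm, Real.norm_eq_abs]
  gcongr
  exact PiLp.norm_apply_le x i

lemma eLpNorm_fderiv_restrict {D : Set (E d)} {ψ : E d → ℝ} (hs : tsupport ψ ⊆ D) (p : ENNReal) :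
    eLpNorm (fderiv ℝ ψ) p (volume.restrict D) = eLpNorm (fderiv ℝ ψ) p volume := by
  have h : Function.support (fun x => ‖fderiv ℝ ψ x‖) ⊆ D := fun x hx =>
    hs (support_fderiv_subset ℝ fun h0 => hx (by simp only [h0, norm_zero]))
  refine (eLpNorm_norm _).symm.trans (Eq.trans ?_ (eLpNorm_norm _))
  exact eLpNorm_restrict_eq_of_support_subset h

/-- The Sobolev inequality in dimensions two and three. -/
lemma exists_sobolev_six (hd : d = 2 ∨ d = 3) {D : Set (E d)} (hDb : Bornology.IsBounded D) :
    ∃ C : NNReal, ∀ ψ : E d → ℝ, ContDiff ℝ 1 ψ → tsupport ψ ⊆ D →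
      eLpNorm ψ 6 volume ≤ C * eLpNorm (fderiv ℝ ψ) 2 volume := by
  rcases hd with rfl | rfl
  -- In dimension two the exponent 2 is critical. The exponent 3/2 has Sobolev conjugate 6, and
  -- Hölder on the bounded set D returns from 3/2 to 2. In dimension three the conjugate of 2 is
  -- already 6.
  · refine ⟨eLpNormLESNormFDerivOfLeConst ℝ (volume : Measure (E 2)) D (3 / 2) 6 *
      ((volume D) ^ (1 / (3 / 2 : ℝ) - 1 / 2)).toNNReal, fun ψ hψ hs => ?_⟩
    have hD : volume D ≠ ⊤ := hDb.measure_lt_top.ne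
    have h1 := eLpNorm_le_eLpNorm_fderiv_of_le (volume : Measure (E 2)) hψ
      ((subset_tsupport ψ).trans hs) (p := 3 / 2) (q := 6) (by
        rw [one_le_div (by norm_num)]; norm_num)
      (by rw [finrank_euclideanSpace_fin, div_lt_iff₀ (by norm_num)]; norm_num)
      (by rw [finrank_euclideanSpace_fin]; norm_num) hDb
    have h2 := eLpNorm_le_eLpNorm_mul_rpow_measure_univ (μ := (volume : Measure (E 2)).restrict D)
      (p := ((3 / 2 : NNReal) : ENNReal)) (q := 2) (f := fderiv ℝ ψ) (by
        rw [show (2 : ENNReal) = ((2 : NNReal) : ENNReal) from rfl, ENNReal.coe_le_coe,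
          div_le_iff₀ (by norm_num)]; norm_num)
      (hψ.continuous_fderiv one_ne_zero).aestronglyMeasurable
    rw [eLpNorm_fderiv_restrict hs, eLpNorm_fderiv_restrict hs, Measure.restrict_apply_univ] at h2
    refine h1.trans ?_
    rw [ENNReal.coe_mul, ENNReal.coe_toNNReal
      (ENNReal.rpow_ne_top_of_nonneg (by norm_num) hD), mul_assoc]
    gcongr
    refine h2.trans_eq ?_
    rw [mul_comm]
    congr 2
  · refine ⟨eLpNormLESNormFDerivOfLeConst ℝ (volume : Measure (E 3)) D 2 6, fun ψ hψ hs => ?_⟩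
    exact eLpNorm_le_eLpNorm_fderiv_of_le (volume : Measure (E 3)) hψ
      ((subset_tsupport ψ).trans hs) (p := 2) (q := 6) (by norm_num)
      (by rw [finrank_euclideanSpace_fin]; norm_num)
      (by rw [finrank_euclideanSpace_fin]; norm_num) hDb

/-- A regularized positive part of `s - k`. -/
noncomputable def lev (k σ s : ℝ) : ℝ := ∫ t in k..s, Real.smoothTransition ((t - k) / σ)

lemma continuous_smoothTransition_div (k σ : ℝ) :
    Continuous fun t => Real.smoothTransition ((t - k) / σ) :=
  Real.smoothTransition.continuous.comp (by fun_prop)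

lemma hasDerivAt_lev (k σ s : ℝ) :
    HasDerivAt (lev k σ) (Real.smoothTransition ((s - k) / σ)) s :=
  ((continuous_smoothTransition_div k σ).integral_hasStrictDerivAt k s).hasDerivAt

lemma deriv_lev (k σ s : ℝ) : deriv (lev k σ) s = Real.smoothTransition ((s - k) / σ) :=
  (hasDerivAt_lev k σ s).deriv

lemma contDiff_lev (k σ : ℝ) : ContDiff ℝ 1 (lev k σ) := by
  rw [contDiff_one_iff_deriv]
  refine ⟨fun s => (hasDerivAt_lev k σ s).differentiableAt, ?_⟩
  rw [show deriv (lev k σ) = fun s => _ from funext fun s => deriv_lev k σ s]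
  exact continuous_smoothTransition_div k σ

lemma abs_deriv_lev_le (k σ s : ℝ) : |deriv (lev k σ) s| ≤ 1 := by
  rw [deriv_lev, abs_of_nonneg (Real.smoothTransition.nonneg _)]
  exact Real.smoothTransition.le_one _

lemma lev_eq_zero {k σ s : ℝ} (hσ : 0 < σ) (hs : s ≤ k) : lev k σ s = 0 := by
  rw [lev, intervalIntegral.integral_congr (g := fun _ => 0)]
  · simp
  · intro t ht
    rw [uIcc_of_ge hs] at ht
    exact Real.smoothTransition.zero_of_nonpos
      (div_nonpos_of_nonpos_of_nonneg (by linarith [ht.2]) hσ.le)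

lemma le_lev {k σ s : ℝ} (hσ : 0 < σ) (hs : k + 2 * σ ≤ s) : σ ≤ lev k σ s := by
  have hi : ∀ a b, IntervalIntegrable (fun t => Real.smoothTransition ((t - k) / σ)) volume a b :=
    fun a b => (continuous_smoothTransition_div k σ).intervalIntegrable a b
  rw [lev, ← intervalIntegral.integral_add_adjacent_intervals (hi k (k + σ)) (hi (k + σ) s)]
  have h1 : 0 ≤ ∫ t in k..(k + σ), Real.smoothTransition ((t - k) / σ) :=
    intervalIntegral.integral_nonneg (by linarith) fun t _ => Real.smoothTransition.nonneg _
  have h2 : ∫ t in (k + σ)..s, Real.smoothTransition ((t - k) / σ)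
      = ∫ t in (k + σ)..s, (1 : ℝ) := by
    refine intervalIntegral.integral_congr fun t ht => ?_
    rw [uIcc_of_le (by linarith)] at ht
    refine Real.smoothTransition.one_of_one_le ?_
    rw [one_le_div hσ]
    linarith [ht.1]
  rw [h2, intervalIntegral.integral_const, smul_eq_mul, mul_one]
  linarith

variable {D : Set (E d)} {a : E d → ℝ} {a' : Fin d → E d → ℝ}

/-- The energy estimate for the truncations of a function in `H^2 ∩ H^1_0`. -/
lemma eLpNorm_lev_six_le (hD : IsOpen D) (hDb : Bornology.IsBounded D) {C : NNReal}
    (hC : ∀ ψ : E d → ℝ, ContDiff ℝ 1 ψ → tsupport ψ ⊆ D →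
      eLpNorm ψ 6 volume ≤ C * eLpNorm (fderiv ℝ ψ) 2 volume)
    (ha : IsH10 D a a') {h : Fin d → E d → ℝ} (hh : ∀ i, WeakPD D i (a' i) (h i))
    (mh : ∀ i, MemLp (h i) 2 (volume.restrict D)) {k σ : ℝ} (hk : 0 ≤ k) (hσ : 0 < σ) :
    eLpNorm (fun x => lev k σ (a x)) 6 (volume.restrict D)
      ≤ ENNReal.ofReal (C * Real.sqrt (d * (2 * -∫ x in D, (∑ i, h i x) * lev k σ (a x)))) := by
  have hfin : IsFiniteMeasure (volume.restrict D) := ⟨by simpa using hDb.measure_lt_top⟩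
  have hDv : volume D ≠ ⊤ := hDb.measure_lt_top.ne
  obtain ⟨φ, h1, h2, h3⟩ := ha.exists_seq
  have hφ1 : ∀ n, ContDiff ℝ 1 (φ n) := fun n => (h1 n).1.of_le (by exact_mod_cast le_top)
  set θ : ℝ → ℝ := fun s => Real.smoothTransition ((s - k) / σ) with hθ
  have hθ0 : ∀ s, 0 ≤ θ s := fun s => Real.smoothTransition.nonneg _
  have hθ1 : ∀ s, θ s ≤ 1 := fun s => Real.smoothTransition.le_one _
  set ψ : ℕ → E d → ℝ := fun n x => lev k σ (φ n x) with hψ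
  -- This is where k ≥ 0 enters: truncating at a nonnegative level keeps the approximants compactly
  -- supported in D.
  have hl0 : lev k σ 0 = 0 := lev_eq_zero hσ hk
  have hψ1 : ∀ n, ContDiff ℝ 1 (ψ n) := fun n => (contDiff_lev k σ).comp (hφ1 n)
  have hψc : ∀ n, HasCompactSupport (ψ n) := fun n => (h1 n).2.1.comp_left hl0
  have hψs : ∀ n, tsupport (ψ n) ⊆ D := fun n =>
    (closure_mono (Function.support_comp_subset hl0 _)).trans (h1 n).2.2
  set dφ : ℕ → Fin d → E d → ℝ := fun n i x => fderiv ℝ (φ n) x (basisVec i) with hdφ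
  set dψ : ℕ → Fin d → E d → ℝ := fun n i x => fderiv ℝ (ψ n) x (basisVec i) with hdψ
  have hdψe : ∀ n i x, dψ n i x = θ (φ n x) * dφ n i x := by
    intro n i x
    have h4 := (hasDerivAt_lev k σ (φ n x)).comp_hasFDerivAt x
      ((hφ1 n).differentiable one_ne_zero x).hasFDerivAt
    change fderiv ℝ (lev k σ ∘ φ n) x (basisVec i) = _
    rw [h4.fderiv]
    rfl
  have mdφ : ∀ n i, MemLp (dφ n i) 2 (volume.restrict D) := fun n i =>
    memLp_test (continuous_pd (hφ1 n) _) (hasCompactSupport_pd (h1 n).2.1 _) 2 D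
  have mdψ : ∀ n i, MemLp (dψ n i) 2 (volume.restrict D) := fun n i =>
    memLp_test (continuous_pd (hψ1 n) _) (hasCompactSupport_pd (hψc n) _) 2 D
  have mψ : ∀ n, MemLp (ψ n) 2 (volume.restrict D) := fun n =>
    memLp_test (hψ1 n).continuous (hψc n) 2 D
  have mla : MemLp (fun x => lev k σ (a x)) 2 (volume.restrict D) :=
    memLp_comp_of_deriv_bounded hDv (contDiff_lev k σ) (abs_deriv_lev_le k σ) ha.memLp
  have mdiff : ∀ n i, MemLp (fun x => dφ n i x - a' i x) 2 (volume.restrict D) := fun n i =>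
    (mdφ n i).sub (ha.memLp' i)
  have msum : MemLp (fun x => ∑ i, h i x) 2 (volume.restrict D) :=
    memLp_finsetSum _ fun i _ => mh i
  set G : ℕ → ℝ := fun n => ∑ i, ∫ x in D, dψ n i x ^ 2 with hG
  set δ : ℕ → ℝ := fun n => ∑ i, ∫ x in D, (dφ n i x - a' i x) ^ 2 with hδ
  -- Formally ∫ |∇η|² ≤ -∫ Δa η with η the truncation of a. For the approximants, ∂ψ = θ ∂φ with 0 ≤
  -- θ ≤ 1 gives (∂ψ)² ≤ ∂φ ∂ψ = a' ∂ψ + (∂φ - a') ∂ψ. The first term is integrated by parts; Young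
  -- turns the second into the error δ plus half of the left side.
  have energy : ∀ n, G n ≤ 2 * (- ∫ x in D, (∑ i, h i x) * ψ n x) + δ n := by
    intro n
    have e1 : ∀ i, ∫ x in D, dψ n i x ^ 2
        ≤ 2 * (- ∫ x in D, h i x * ψ n x) + ∫ x in D, (dφ n i x - a' i x) ^ 2 := by
      intro i
      have t1 := (hh i).test_contDiff_one hD (hψ1 n) (hψc n) (hψs n)
      have I1 : Integrable (fun x => dψ n i x * a' i x) (volume.restrict D) :=
        integrable_mul_of_memLp (mdψ n i) (ha.memLp' i)
      have I2 : Integrable (fun x => 2⁻¹ * (dφ n i x - a' i x) ^ 2) (volume.restrict D) :=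
        (mdiff n i).integrable_sq.const_mul _
      have I3 : Integrable (fun x => 2⁻¹ * dψ n i x ^ 2) (volume.restrict D) :=
        (mdψ n i).integrable_sq.const_mul _
      have I4 : Integrable (fun x => 2⁻¹ * (dφ n i x - a' i x) ^ 2 + 2⁻¹ * dψ n i x ^ 2)
        (volume.restrict D) := I2.add I3
      have t2 : ∫ x in D, dψ n i x ^ 2 ≤ ∫ x in D,
          (dψ n i x * a' i x + (2⁻¹ * (dφ n i x - a' i x) ^ 2 + 2⁻¹ * dψ n i x ^ 2)) := by
        refine integral_mono (mdψ n i).integrable_sq (I1.add I4) fun x => ?_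
        have q1 : dψ n i x ^ 2 ≤ dφ n i x * dψ n i x := by
          rw [hdψe, show (θ (φ n x) * dφ n i x) ^ 2 = θ (φ n x) * (θ (φ n x) * dφ n i x ^ 2) by ring,
            show dφ n i x * (θ (φ n x) * dφ n i x) = 1 * (θ (φ n x) * dφ n i x ^ 2) by ring]
          exact mul_le_mul_of_nonneg_right (hθ1 _) (mul_nonneg (hθ0 _) (sq_nonneg _))
        have q2 := sq_nonneg (dφ n i x - a' i x - dψ n i x)
        simp only
        nlinarith
      rw [integral_add I1 I4, integral_add I2 I3, integral_const_mul, integral_const_mul] at t2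
      simp only [smul_eq_mul] at t1
      have t3 : ∫ x in D, ψ n x * h i x = ∫ x in D, h i x * ψ n x :=
        integral_congr_ae (Eventually.of_forall fun x => mul_comm _ _)
      rw [t3] at t1
      change ∫ x in D, dψ n i x * a' i x = _ at t1
      linarith
    have e2 : ∫ x in D, (∑ i, h i x) * ψ n x = ∑ i, ∫ x in D, h i x * ψ n x := by
      simp only [Finset.sum_mul]
      exact integral_finsetSum _ fun i _ => integrable_mul_of_memLp (mh i) (mψ n)
    calc G n ≤ ∑ i, (2 * (- ∫ x in D, h i x * ψ n x) + ∫ x in D, (dφ n i x - a' i x) ^ 2) :=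
          Finset.sum_le_sum fun i _ => e1 i
      _ = _ := by
        rw [Finset.sum_add_distrib, ← Finset.mul_sum, Finset.sum_neg_distrib, e2]
  have limδ : Tendsto δ atTop (𝓝 0) := by
    have : Tendsto δ atTop (𝓝 (∑ _i : Fin d, (0 : ℝ))) :=
      tendsto_finsetSum _ fun i _ => tendsto_integral_sq (fun n => mdiff n i) (h3 i)
    simpa using this
  have limψ : Tendsto (fun n => eLpNorm (ψ n - fun x => lev k σ (a x)) 2 (volume.restrict D))
      atTop (𝓝 0) := by
    refine tendsto_of_tendsto_of_tendsto_of_le_of_le tendsto_const_nhds h2 (fun _ => zero_le)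
      fun n => eLpNorm_mono fun x => ?_
    have := abs_sub_le_of_deriv_bounded (contDiff_lev k σ) (abs_deriv_lev_le k σ) (φ n x) (a x)
    rw [one_mul] at this
    exact this
  have limI := tendsto_integral_mul_of_eLpNorm mla mψ msum limψ
  have six : ∀ n, eLpNorm (ψ n) 6 (volume.restrict D)
      ≤ ENNReal.ofReal (C * Real.sqrt (d * (2 * (- ∫ x in D, (∑ i, h i x) * ψ n x) + δ n))) := by
    intro n
    have mf : MemLp (fderiv ℝ (ψ n)) 2 (volume.restrict D) :=
      (((hψ1 n).continuous_fderiv one_ne_zero).memLp_of_hasCompactSupport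
        ((hψc n).fderiv (𝕜 := ℝ))).restrict D
    have s2 : ∫ x in D, ‖fderiv ℝ (ψ n) x‖ ^ 2 ≤ d * G n := by
      have : ∫ x in D, ‖fderiv ℝ (ψ n) x‖ ^ 2 ≤ ∫ x in D, d * ∑ i, dψ n i x ^ 2 := by
        refine integral_mono mf.integrable_norm_pow' ((integrable_finsetSum _ fun i _ =>
          (mdψ n i).integrable_sq).const_mul _) fun x => ?_
        refine (pow_le_pow_left₀ (norm_nonneg _) (norm_le_sum_abs_basisVec _) 2).trans ?_
        refine (sq_sum_le_card_mul_sum_sq).trans_eq ?_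
        simp [hdψ]
      rw [integral_const_mul, integral_finsetSum _ fun i _ => (mdψ n i).integrable_sq] at this
      exact this
    calc eLpNorm (ψ n) 6 (volume.restrict D) ≤ eLpNorm (ψ n) 6 volume :=
          eLpNorm_restrict_le _ _ _ _
      _ ≤ C * eLpNorm (fderiv ℝ (ψ n)) 2 volume := hC _ (hψ1 n) (hψs n)
      _ = ENNReal.ofReal C * ENNReal.ofReal (Real.sqrt (∫ x in D, ‖fderiv ℝ (ψ n) x‖ ^ 2)) := by
          rw [← eLpNorm_fderiv_restrict (hψs n), eLpNorm_two_eq mf,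
            ENNReal.ofReal_coe_nnreal]
      _ = ENNReal.ofReal (C * Real.sqrt (∫ x in D, ‖fderiv ℝ (ψ n) x‖ ^ 2)) := by
          rw [ENNReal.ofReal_mul C.coe_nonneg]
      _ ≤ _ := by
          refine ENNReal.ofReal_le_ofReal ?_
          gcongr
          exact s2.trans (by gcongr; exact energy n)
  have lim6 : Tendsto (fun n => ENNReal.ofReal (C * Real.sqrt (d * (2 * (- ∫ x in D,
      (∑ i, h i x) * ψ n x) + δ n)))) atTop (𝓝 (ENNReal.ofReal (C * Real.sqrt (d * (2 *
        -∫ x in D, (∑ i, h i x) * lev k σ (a x)))))) := by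
    refine ENNReal.tendsto_ofReal (Tendsto.const_mul _ (Tendsto.sqrt (Tendsto.const_mul _ ?_)))
    simpa using (limI.neg.const_mul 2).add limδ
  -- An a.e. convergent subsequence is extracted because the L⁶ norm is only lower semicontinuous
  -- under a.e. convergence.
  obtain ⟨ns, hns, hae⟩ := (tendstoInMeasure_of_tendsto_eLpNorm (by simp)
    (fun n => (mψ n).1) mla.1 limψ).exists_seq_tendsto_ae
  refine (Lp.eLpNorm_lim_le_liminf_eLpNorm (p := 6) (fun n => (mψ (ns n)).1) _ hae).trans ?_
  rw [← (lim6.comp hns.tendsto_atTop).liminf_eq]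
  exact liminf_le_liminf (Eventually.of_forall fun n => six (ns n))

end Stampacchia

end Peridynamics

namespace Peridynamics

/-! ### Stampacchia iteration and the sup bound -/

section SupBound

variable {d : ℕ}

lemma abs_integral_mul_le {α : Type*} [MeasurableSpace α] {μ : Measure α} {f g : α → ℝ}
    (hf : MemLp f 2 μ) (hg : MemLp g 2 μ) :
    |∫ x, f x * g x ∂μ| ≤ (eLpNorm f 2 μ).toReal * (eLpNorm g 2 μ).toReal := by
  rw [← ENNReal.toReal_mul, ← Real.norm_eq_abs]
  have h1 := eLpNorm_smul_le_mul_eLpNorm (p := 2) (q := 2) (r := 1) hg.1 hf.1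
  have h2 : ‖∫ x, f x * g x ∂μ‖ₑ ≤ eLpNorm f 2 μ * eLpNorm g 2 μ := by
    refine (enorm_integral_le_lintegral_enorm _).trans ?_
    rw [eLpNorm_one_eq_lintegral_enorm] at h1
    exact h1
  have h3 := ENNReal.toReal_mono (ENNReal.mul_ne_top hf.2.ne hg.2.ne) h2
  simpa using h3

/-- The iteration lemma of Stampacchia. -/
lemma stampacchia_iteration {m : ℝ → ℝ} (hm0 : ∀ k, 0 ≤ m k) (hm : Antitone m) {M Q K : ℝ}
    (hM : m 0 ≤ M) (hK : 0 < K) (hQ : Q ^ 6 * 64 ^ 3 * M ≤ K ^ 6)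
    (hstep : ∀ k σ : ℝ, 0 ≤ k → 0 < σ → σ ^ 6 * m (k + 2 * σ) ≤ Q ^ 6 * m k ^ 2) : m K = 0 := by
  have hM0 : 0 ≤ M := (hm0 0).trans hM
  -- Levels K(1 - 2^(-n)) with σ = K 2^(-n)/4 make k + 2σ the next level. One step then preserves
  -- the rate 64^(-n) provided 4⁶ · 64 · Q⁶ M ≤ K⁶, which is the hypothesis since 4⁶ · 64 = 64³.
  have key : ∀ n : ℕ, m (K * (1 - (1 / 2) ^ n)) ≤ M * (1 / 64) ^ n := by
    intro n
    induction n with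
    | zero => simpa using hM
    | succ n ih =>
      set y : ℝ := (1 / 2) ^ n with hy
      have hy0 : 0 < y := by positivity
      have hy1 : y ≤ 1 := pow_le_one₀ (by norm_num) (by norm_num)
      have h64 : ((1 : ℝ) / 64) ^ n = y ^ 6 := by
        rw [hy, ← pow_mul, mul_comm n 6, pow_mul]; norm_num
      rw [h64] at ih
      have h1 := hstep (K * (1 - y)) (K * y / 4) (mul_nonneg hK.le (by linarith)) (by positivity)
      have e1 : K * (1 - y) + 2 * (K * y / 4) = K * (1 - (1 / 2) ^ (n + 1)) := by
        rw [pow_succ, ← hy]; ring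
      rw [e1] at h1
      have h2 : m (K * (1 - y)) ^ 2 ≤ (M * y ^ 6) ^ 2 := pow_le_pow_left₀ (hm0 _) ih 2
      have h3 : (K * y / 4) ^ 6 * m (K * (1 - (1 / 2) ^ (n + 1)))
          ≤ (K * y / 4) ^ 6 * (M * (y ^ 6 * (1 / 64))) := by
        calc _ ≤ Q ^ 6 * m (K * (1 - y)) ^ 2 := h1
          _ ≤ Q ^ 6 * (M * y ^ 6) ^ 2 := by
              refine mul_le_mul_of_nonneg_left h2 ?_
              positivity
          _ = (Q ^ 6 * 64 ^ 3 * M) * (M * y ^ 12 / 64 ^ 3) := by ring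
          _ ≤ K ^ 6 * (M * y ^ 12 / 64 ^ 3) := by gcongr
          _ = _ := by ring
      have h4 := le_of_mul_le_mul_left h3 (by positivity)
      rw [pow_succ ((1 : ℝ) / 64), h64]
      exact h4
  have h5 : ∀ n : ℕ, m K ≤ M * (1 / 64) ^ n := fun n => by
    refine (hm ?_).trans (key n)
    have : (0 : ℝ) ≤ (1 / 2) ^ n := by positivity
    nlinarith
  have h6 : Tendsto (fun n : ℕ => M * ((1 : ℝ) / 64) ^ n) atTop (𝓝 (M * 0)) :=
    (tendsto_pow_atTop_nhds_zero_of_lt_one (by norm_num) (by norm_num)).const_mul M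
  rw [mul_zero] at h6
  exact le_antisymm (ge_of_tendsto' h6 h5) (hm0 K)

variable {D : Set (E d)} {a : E d → ℝ} {a' : Fin d → E d → ℝ}

lemma IsH10.neg (ha : IsH10 D a a') : IsH10 D (fun x => - a x) fun i x => - a' i x := by
  obtain ⟨φ, h1, h2, h3⟩ := ha.exists_seq
  refine ⟨ha.memLp.neg, fun i => (ha.memLp' i).neg, fun n x => - φ n x, fun n =>
    ⟨(h1 n).1.neg, (h1 n).2.1.comp_left neg_zero,
      (closure_mono (Function.support_comp_subset neg_zero _)).trans (h1 n).2.2⟩, ?_, fun i => ?_⟩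
  · refine h2.congr fun n => ?_
    rw [← eLpNorm_neg]
    congr 1
    ext x
    simp
    ring
  · refine (h3 i).congr fun n => ?_
    rw [← eLpNorm_neg]
    congr 1
    ext x
    have : fderiv ℝ (fun x => - φ n x) x = - fderiv ℝ (φ n) x := fderiv_fun_neg
    simp
    ring

/-- The decay of the superlevel sets of a function in `H^2 ∩ H^1_0`. -/
lemma level_decay (hD : IsOpen D) (hDb : Bornology.IsBounded D) {C : NNReal}
    (hC : ∀ ψ : E d → ℝ, ContDiff ℝ 1 ψ → tsupport ψ ⊆ D →
      eLpNorm ψ 6 volume ≤ C * eLpNorm (fderiv ℝ ψ) 2 volume)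
    (ha : IsH10 D a a') {h : Fin d → E d → ℝ} (hh : ∀ i, WeakPD D i (a' i) (h i))
    (mh : ∀ i, MemLp (h i) 2 (volume.restrict D)) {G : ℝ}
    (hG : (eLpNorm (fun x => ∑ i, h i x) 2 (volume.restrict D)).toReal ≤ G)
    {k σ : ℝ} (hk : 0 ≤ k) (hσ : 0 < σ) :
    σ ^ 6 * (volume.restrict D).real {x | k + 2 * σ < a x}
      ≤ (2 * d * C ^ 2 * G) ^ 6 * (volume.restrict D).real {x | k < a x} ^ 2 := by
  have hfin : IsFiniteMeasure (volume.restrict D) := ⟨by simpa using hDb.measure_lt_top⟩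
  have hDv : volume D ≠ ⊤ := hDb.measure_lt_top.ne
  set μ := (volume : Measure (E d)).restrict D with hμ
  have hG0 : 0 ≤ G := ENNReal.toReal_nonneg.trans hG
  set η : E d → ℝ := fun x => lev k σ (a x) with hη
  have mη : MemLp η 2 μ :=
    memLp_comp_of_deriv_bounded hDv (contDiff_lev k σ) (abs_deriv_lev_le k σ) ha.memLp
  have msum : MemLp (fun x => ∑ i, h i x) 2 μ := memLp_finsetSum _ fun i _ => mh i
  have energy := eLpNorm_lev_six_le hD hDb hC ha hh mh hk hσ
  have h6top : eLpNorm η 6 μ ≠ ⊤ := (energy.trans_lt ENNReal.ofReal_lt_top).ne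
  set X := (eLpNorm η 6 μ).toReal with hX
  have hX0 : 0 ≤ X := ENNReal.toReal_nonneg
  set A : Set (E d) := {x | k < a x} with hA
  set m := μ.real A with hm
  have hm0 : 0 ≤ m := measureReal_nonneg
  have hsupp : Function.support η ⊆ A := fun x hx => by
    by_contra hxA
    exact hx (lev_eq_zero hσ (not_lt.1 hxA))
  -- The truncation lives on the superlevel set A, so Hölder from L⁶ to L² gains the factor
  -- |A|^(1/3).
  have hη2 : (eLpNorm η 2 μ).toReal ≤ X * m ^ (1 / 3 : ℝ) := by
    have h1 := eLpNorm_le_eLpNorm_mul_rpow_measure_univ (μ := μ.restrict A) (p := 2) (q := 6)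
      (f := η) (by norm_num) mη.1.restrict
    rw [eLpNorm_restrict_eq_of_support_subset hsupp, eLpNorm_restrict_eq_of_support_subset hsupp,
      Measure.restrict_apply_univ] at h1
    have h2 := ENNReal.toReal_mono (ENNReal.mul_ne_top h6top
      (ENNReal.rpow_ne_top_of_nonneg (by norm_num) (measure_ne_top μ A))) h1
    rw [ENNReal.toReal_mul, ← ENNReal.toReal_rpow] at h2
    refine h2.trans_eq ?_
    congr 2
    norm_num
  have hI : - ∫ x, (∑ i, h i x) * η x ∂μ ≤ G * (X * m ^ (1 / 3 : ℝ)) :=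
    (neg_le_abs _).trans ((abs_integral_mul_le msum mη).trans
      (mul_le_mul hG hη2 ENNReal.toReal_nonneg hG0))
  have hX1 : X ≤ C * Real.sqrt (d * (2 * (G * (X * m ^ (1 / 3 : ℝ))))) := by
    have h1 := ENNReal.toReal_mono ENNReal.ofReal_ne_top energy
    rw [ENNReal.toReal_ofReal (by positivity)] at h1
    refine h1.trans ?_
    gcongr
  -- Squaring the energy bound gives X² ≤ 2dC²G m^(1/3) X, and one factor X is divided out. The
  -- sixth power of the result carries m², and this exponent above 1 drives the iteration.
  have hX2 : X ≤ 2 * d * C ^ 2 * G * m ^ (1 / 3 : ℝ) := by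
    rcases hX0.eq_or_lt with h0 | h0
    · rw [← h0]; positivity
    · have h1 : X ^ 2 ≤ (C * Real.sqrt (d * (2 * (G * (X * m ^ (1 / 3 : ℝ)))))) ^ 2 :=
        pow_le_pow_left₀ hX0 hX1 2
      rw [mul_pow, Real.sq_sqrt (by positivity)] at h1
      refine le_of_mul_le_mul_right ?_ h0
      calc X * X = X ^ 2 := by ring
        _ ≤ _ := h1
        _ = _ := by ring
  have hX6 : X ^ 6 ≤ (2 * d * C ^ 2 * G) ^ 6 * m ^ 2 := by
    refine (pow_le_pow_left₀ hX0 hX2 6).trans_eq ?_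
    rw [mul_pow]
    congr 1
    rw [← Real.rpow_natCast, ← Real.rpow_mul hm0, ← Real.rpow_natCast]
    norm_num
  refine le_trans ?_ hX6
  -- Chebyshev's inequality in L⁶: the truncation is at least σ on the set where a > k + 2σ.
  have ch := mul_meas_ge_le_pow_eLpNorm' (p := 6) μ (by simp) (by simp) mη.1 (ENNReal.ofReal σ)
  have h6 : (6 : ENNReal).toReal = ((6 : ℕ) : ℝ) := by norm_num
  rw [h6, ENNReal.rpow_natCast, ENNReal.rpow_natCast] at ch
  have ch2 := ENNReal.toReal_mono (ENNReal.pow_ne_top h6top) ch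
  rw [ENNReal.toReal_mul, ENNReal.toReal_pow, ENNReal.toReal_pow, ENNReal.toReal_ofReal hσ.le]
    at ch2
  refine le_trans ?_ ch2
  gcongr
  refine ENNReal.toReal_mono (measure_ne_top _ _) (measure_mono fun x hx => ?_)
  have hx' : σ ≤ η x := le_lev hσ (le_of_lt hx)
  rw [Set.mem_ofPred_eq, Real.enorm_of_nonneg (hσ.le.trans hx')]
  exact ENNReal.ofReal_le_ofReal hx'

/-- The embedding of `H^2 ∩ H^1_0` into `L^∞` in dimensions two and three. -/
lemma exists_sup_bound (hd : d = 2 ∨ d = 3) (hD : IsOpen D) (hDb : Bornology.IsBounded D) :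
    ∃ Λ : ℝ, 0 ≤ Λ ∧ ∀ (a : E d → ℝ) (a' : Fin d → E d → ℝ) (h : Fin d → E d → ℝ), IsH10 D a a' →
      (∀ i, WeakPD D i (a' i) (h i)) → (∀ i, MemLp (h i) 2 (volume.restrict D)) →
      ∀ᵐ x ∂(volume.restrict D),
        |a x| ≤ Λ * (eLpNorm (fun x => ∑ i, h i x) 2 (volume.restrict D)).toReal := by
  have hfin : IsFiniteMeasure (volume.restrict D) := ⟨by simpa using hDb.measure_lt_top⟩
  obtain ⟨C, hC⟩ := exists_sobolev_six hd hDb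
  set μ := (volume : Measure (E d)).restrict D with hμ
  set M := μ.real univ with hM
  have hM0 : 0 ≤ M := measureReal_nonneg
  set B : ℝ := 2 * d * C ^ 2 with hB
  have hB0 : 0 ≤ B := by positivity
  -- The 8 comes from 8⁶ = 64³. Adding 1 to B and to M makes Λ positive and gives M ≤ (1 + M)⁶.
  set Λ : ℝ := 8 * (B + 1) * (1 + M) with hΛ
  have hΛ0 : 0 < Λ := by positivity
  have hΛ6 : B ^ 6 * 64 ^ 3 * M ≤ Λ ^ 6 := by
    have h1 : B ^ 6 ≤ (B + 1) ^ 6 := by gcongr; linarith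
    have h2 : M ≤ (1 + M) ^ 6 := by
      calc M ≤ 1 + M := by linarith
        _ ≤ (1 + M) ^ 6 := le_self_pow₀ (by linarith) (by norm_num)
    calc B ^ 6 * 64 ^ 3 * M ≤ (B + 1) ^ 6 * 64 ^ 3 * (1 + M) ^ 6 := by gcongr
      _ = Λ ^ 6 := by rw [hΛ]; ring
  have one_side : ∀ (a : E d → ℝ) (a' : Fin d → E d → ℝ) (h : Fin d → E d → ℝ), IsH10 D a a' →
      (∀ i, WeakPD D i (a' i) (h i)) → (∀ i, MemLp (h i) 2 μ) →
      ∀ᵐ x ∂μ, a x ≤ Λ * (eLpNorm (fun x => ∑ i, h i x) 2 μ).toReal := by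
    intro a a' h ha hh mh
    set G := (eLpNorm (fun x => ∑ i, h i x) 2 μ).toReal with hG
    have hG0 : 0 ≤ G := ENNReal.toReal_nonneg
    -- G may be zero, whereas the iteration needs a positive level; so G is enlarged by 1/(n+1),
    -- which then tends to zero.
    have step : ∀ n : ℕ, ∀ᵐ x ∂μ, a x ≤ Λ * (G + 1 / ((n : ℝ) + 1)) := by
      intro n
      set G' := G + 1 / ((n : ℝ) + 1) with hG'
      have hpos : (0 : ℝ) < 1 / ((n : ℝ) + 1) := by positivity
      have hG'0 : 0 < G' := by linarith
      have h0 := stampacchia_iteration (m := fun k => μ.real {x | k < a x}) (M := M)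
        (Q := B * G') (K := Λ * G') (fun k => measureReal_nonneg)
        (fun k l hkl => measureReal_mono fun x hx => lt_of_le_of_lt hkl hx)
        (measureReal_mono (subset_univ _)) (by positivity) (by
          calc (B * G') ^ 6 * 64 ^ 3 * M = (B ^ 6 * 64 ^ 3 * M) * G' ^ 6 := by ring
            _ ≤ Λ ^ 6 * G' ^ 6 := by gcongr
            _ = (Λ * G') ^ 6 := by ring)
        (fun k σ hk hσ => level_decay hD hDb hC ha hh mh (by linarith) hk hσ)
      rw [measureReal_eq_zero_iff] at h0
      rw [ae_iff]
      simpa only [not_le] using h0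
    filter_upwards [ae_all_iff.2 step] with x hx
    have hl : Tendsto (fun n : ℕ => Λ * (G + 1 / ((n : ℝ) + 1))) atTop (𝓝 (Λ * (G + 0))) :=
      (tendsto_const_nhds.add tendsto_one_div_add_atTop_nhds_zero_nat).const_mul _
    rw [add_zero] at hl
    exact ge_of_tendsto' hl hx
  refine ⟨Λ, hΛ0.le, fun a a' h ha hh mh => ?_⟩
  have hn : ∀ i, WeakPD D i (fun x => - a' i x) (fun x => - h i x) := fun i => by
    simpa using (hh i).const_smul (-1)
  have e : eLpNorm (fun x => ∑ i, - h i x) 2 μ = eLpNorm (fun x => ∑ i, h i x) 2 μ := by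
    rw [← eLpNorm_neg]
    congr 1
    ext x
    simp
  filter_upwards [one_side a a' h ha hh mh,
    one_side _ _ _ ha.neg hn fun i => (mh i).neg] with x h1 h2
  rw [e] at h2
  exact abs_le.2 ⟨by linarith, h1⟩

end SupBound

end Peridynamics

namespace Peridynamics

/-! ### Morrey's inequality from an L⁴ gradient -/

section Morrey

variable {d : ℕ}

lemma enorm_sub_le_lintegral_segment {w : E d → ℝ} (hw : ContDiff ℝ 1 w) (p z : E d) :
    ‖w z - w p‖ₑ ≤ ∫⁻ t in Ioc (0 : ℝ) 1, ‖fderiv ℝ w (p + t • (z - p))‖ₑ * ‖z - p‖ₑ := by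
  have hder : ∀ t : ℝ, HasDerivAt (fun t : ℝ => w (p + t • (z - p)))
      (fderiv ℝ w (p + t • (z - p)) (z - p)) t := fun t => by
    have h1 : HasDerivAt (fun t : ℝ => p + t • (z - p)) (z - p) t := by
      simpa using ((hasDerivAt_id t).smul_const (z - p)).const_add p
    exact ((hw.differentiable one_ne_zero _).hasFDerivAt).comp_hasDerivAt t h1
  have hc : Continuous fun t : ℝ => fderiv ℝ w (p + t • (z - p)) (z - p) :=
    ((hw.continuous_fderiv one_ne_zero).comp (by fun_prop)).clm_apply continuous_const
  have h2 := intervalIntegral.integral_eq_sub_of_hasDerivAt (a := 0) (b := 1)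
    (fun t _ => hder t) (hc.intervalIntegrable 0 1)
  rw [one_smul, zero_smul, add_zero, add_sub_cancel, intervalIntegral.integral_of_le zero_le_one]
    at h2
  rw [← h2]
  refine (enorm_integral_le_lintegral_enorm _).trans (lintegral_mono fun t => ?_)
  exact ContinuousLinearMap.le_opENorm _ _

lemma lintegral_comp_homothety {g : E d → ENNReal} (hg : Measurable g) (p : E d) {t : ℝ}
    (ht : 0 < t) :
    ∫⁻ z, g (p + t • (z - p)) = ENNReal.ofReal (t ^ (-(d : ℝ))) * ∫⁻ z, g z := by
  have h1 : ∫⁻ z, g (p + t • (z - p)) = ∫⁻ z, g (p + t • z) :=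
    lintegral_sub_right_eq_self (μ := (volume : Measure (E d))) (fun z => g (p + t • z)) p
  have h2 : ∫⁻ z, g z = ∫⁻ z, g (p + z) := (lintegral_add_left_eq_self _ p).symm
  have h3 := Measure.map_addHaar_smul (volume : Measure (E d)) ht.ne'
  have h4 : ∫⁻ z, g (p + t • z) =
      ∫⁻ z, g (p + z) ∂(Measure.map (fun z => t • z) (volume : Measure (E d))) :=
    (lintegral_map (hg.comp (measurable_const_add p)) (measurable_const_smul t)).symm
  have h5 : (fun z : E d => t • z) = (t • · : E d → E d) := rfl
  rw [h1, h2, h4, h5, h3, lintegral_smul_measure, finrank_euclideanSpace_fin, smul_eq_mul,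
    abs_of_nonneg (by positivity), Real.rpow_neg ht.le, Real.rpow_natCast]

/-- Hölder with exponents 4 and 4/3 on the ball, then a homothety about p. The Jacobian t^(-d),
raised to the power 1/4, leaves t^(-d/4). -/
lemma lintegral_homothety_ball_le {g : E d → ENNReal} (hg : Measurable g) (p x : E d) (ρ : ℝ)
    {t : ℝ} (ht : 0 < t) :
    ∫⁻ z in Metric.ball x ρ, g (p + t • (z - p)) ≤
      ENNReal.ofReal (t ^ (-(d / 4 : ℝ))) * (∫⁻ z, g z ^ (4 : ℝ)) ^ (1 / 4 : ℝ) *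
        volume (Metric.ball x ρ) ^ (3 / 4 : ℝ) := by
  have hm : Measurable fun z => g (p + t • (z - p)) := hg.comp (by fun_prop)
  have h1 := ENNReal.lintegral_mul_le_Lp_mul_Lq (volume.restrict (Metric.ball x ρ))
    (p := 4) (q := 4 / 3) ⟨by norm_num, by norm_num, by norm_num⟩ hm.aemeasurable
    (g := fun _ => 1) aemeasurable_const
  simp only [Pi.mul_apply, mul_one, ENNReal.one_rpow, lintegral_const, Measure.restrict_apply
    MeasurableSet.univ, univ_inter, one_mul] at h1
  refine h1.trans ?_
  rw [show (1 / (4 / 3) : ℝ) = 3 / 4 by norm_num]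
  gcongr
  calc (∫⁻ z in Metric.ball x ρ, g (p + t • (z - p)) ^ (4 : ℝ)) ^ (1 / 4 : ℝ)
      ≤ (∫⁻ z, g (p + t • (z - p)) ^ (4 : ℝ)) ^ (1 / 4 : ℝ) := by
        gcongr
        exact Measure.restrict_le_self
    _ = _ := by
        rw [lintegral_comp_homothety (hg.pow_const 4) p ht,
          ENNReal.mul_rpow_of_nonneg _ _ (by norm_num),
          ENNReal.ofReal_rpow_of_nonneg (by positivity) (by norm_num), ← Real.rpow_mul ht.le]
        congr 3
        ring

/-- The integral equals 1/(1 - s). With s = d/4 this is where d ≤ 3 is essential to Morrey's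
inequality in L⁴. -/
lemma lintegral_rpow_neg_le {s : ℝ} (hs1 : s ≤ 3 / 4) :
    ∫⁻ t in Ioc (0 : ℝ) 1, ENNReal.ofReal (t ^ (-s)) ≤ 4 := by
  have h1 : IntervalIntegrable (fun t : ℝ => t ^ (-s)) volume 0 1 :=
    intervalIntegral.intervalIntegrable_rpow' (by linarith)
  rw [intervalIntegrable_iff_integrableOn_Ioc_of_le zero_le_one] at h1
  rw [← ofReal_integral_eq_lintegral_ofReal h1
    ((ae_restrict_mem measurableSet_Ioc).mono fun t ht => Real.rpow_nonneg ht.1.le _),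
    ← intervalIntegral.integral_of_le zero_le_one, integral_rpow (Or.inl (by linarith)),
    Real.one_rpow, Real.zero_rpow (by linarith), sub_zero]
  rw [show (4 : ENNReal) = ENNReal.ofReal 4 by norm_num]
  refine ENNReal.ofReal_le_ofReal ?_
  rw [div_le_iff₀ (by linarith)]
  linarith

/-- The increment is integrated along the segments issuing from p, and the order of integration is
exchanged so that each dilation parameter t is handled by a homothety. The point p need not be the
centre of the ball, so one lemma serves both endpoints. -/
lemma lintegral_ball_enorm_sub_le (hd : d ≤ 3) {w : E d → ℝ} (hw : ContDiff ℝ 1 w) (p x : E d)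
    {ρ : ℝ} (hp : ∀ z ∈ Metric.ball x ρ, ‖z - p‖ ≤ 2 * ρ) :
    ∫⁻ z in Metric.ball x ρ, ‖w z - w p‖ₑ ≤
      4 * ((∫⁻ z, ‖fderiv ℝ w z‖ₑ ^ (4 : ℝ)) ^ (1 / 4 : ℝ) *
        volume (Metric.ball x ρ) ^ (3 / 4 : ℝ)) * ENNReal.ofReal (2 * ρ) := by
  have hg : Measurable fun z => ‖fderiv ℝ w z‖ₑ :=
    (hw.continuous_fderiv one_ne_zero).enorm.measurable
  have hd' : ((d : ℝ) / 4) ≤ 3 / 4 := by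
    have : (d : ℝ) ≤ 3 := by exact_mod_cast hd
    linarith
  set X := (∫⁻ z, ‖fderiv ℝ w z‖ₑ ^ (4 : ℝ)) ^ (1 / 4 : ℝ) *
        volume (Metric.ball x ρ) ^ (3 / 4 : ℝ) with hX
  calc ∫⁻ z in Metric.ball x ρ, ‖w z - w p‖ₑ
      ≤ ∫⁻ z in Metric.ball x ρ, ∫⁻ t in Ioc (0 : ℝ) 1,
          ‖fderiv ℝ w (p + t • (z - p))‖ₑ * ENNReal.ofReal (2 * ρ) := by
        refine setLIntegral_mono' measurableSet_ball fun z hz => ?_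
        refine (enorm_sub_le_lintegral_segment hw p z).trans (lintegral_mono fun t => ?_)
        gcongr
        rw [← ofReal_norm]
        exact ENNReal.ofReal_le_ofReal (hp z hz)
    _ = ∫⁻ t in Ioc (0 : ℝ) 1, ∫⁻ z in Metric.ball x ρ,
          ‖fderiv ℝ w (p + t • (z - p))‖ₑ * ENNReal.ofReal (2 * ρ) := by
        refine lintegral_lintegral_swap (Measurable.aemeasurable ?_)
        exact (hg.comp (by fun_prop : Measurable fun q : E d × ℝ =>
          p + q.2 • (q.1 - p))).mul_const _
    _ ≤ ∫⁻ t in Ioc (0 : ℝ) 1, ENNReal.ofReal (t ^ (-(d / 4 : ℝ))) *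
          (X * ENNReal.ofReal (2 * ρ)) := by
        refine setLIntegral_mono' measurableSet_Ioc fun t ht => ?_
        rw [lintegral_mul_const _ (show Measurable fun z => ‖fderiv ℝ w (p + t • (z - p))‖ₑ from
          hg.comp (by fun_prop)), ← mul_assoc, hX, ← mul_assoc]
        gcongr
        exact lintegral_homothety_ball_le hg p x ρ ht.1
    _ ≤ 4 * (X * ENNReal.ofReal (2 * ρ)) := by
        rw [lintegral_mul_const _ (by fun_prop)]
        gcongr
        exact lintegral_rpow_neg_le hd'
    _ = _ := by ring

/-- Both w(x) and w(y) are compared with the values of w on the ball of radius |x - y| about x, all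
of whose points lie within 2|x - y| of y. The 16 is 2 (two endpoints) times 4 (the integral in t)
times 2 (the length of the segments). -/
theorem exists_morrey (hd : d ≤ 3) : ∃ C : ℝ, 0 ≤ C ∧ ∀ w : E d → ℝ, ContDiff ℝ 1 w →
    ∀ G : ℝ, 0 ≤ G →
      (∫⁻ z, ‖fderiv ℝ w z‖ₑ ^ (4 : ℝ)) ^ (1 / 4 : ℝ) ≤ ENNReal.ofReal G →
      ∀ x y, |w x - w y| ≤ C * G * ‖x - y‖ ^ (1 - d / 4 : ℝ) := by
  set v := (volume (Metric.ball (0 : E d) 1)).toReal with hv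
  have hv0 : 0 < v := ENNReal.toReal_pos (Metric.measure_ball_pos _ _ one_pos).ne'
    measure_ball_lt_top.ne
  refine ⟨16 * v ^ (-(1 / 4) : ℝ), by positivity, fun w hw G hG hle x y => ?_⟩
  rcases eq_or_ne x y with rfl | hxy
  · simp only [sub_self, abs_zero]
    positivity
  set ρ := ‖x - y‖ with hρ
  have hρ0 : 0 < ρ := norm_pos_iff.2 (sub_ne_zero.2 hxy)
  set V := volume (Metric.ball x ρ) with hV
  have hVr : V = ENNReal.ofReal (ρ ^ d * v) := by
    rw [hV, Measure.addHaar_ball_of_pos _ _ hρ0, finrank_euclideanSpace_fin,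
      ENNReal.ofReal_mul (by positivity), hv, ENNReal.ofReal_toReal measure_ball_lt_top.ne]
  have hVp : 0 < ρ ^ d * v := by positivity
  have hmeas : ∀ p : E d, Measurable fun z => ‖w z - w p‖ₑ := fun p =>
    ((hw.continuous.sub continuous_const).enorm).measurable
  have h1 : ‖w x - w y‖ₑ * V ≤ 2 * (4 * (ENNReal.ofReal G * V ^ (3 / 4 : ℝ)) *
      ENNReal.ofReal (2 * ρ)) := by
    calc ‖w x - w y‖ₑ * V = ∫⁻ z in Metric.ball x ρ, ‖w x - w y‖ₑ := by
          rw [lintegral_const, Measure.restrict_apply MeasurableSet.univ, univ_inter]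
      _ ≤ ∫⁻ z in Metric.ball x ρ, (‖w z - w x‖ₑ + ‖w z - w y‖ₑ) := by
          refine lintegral_mono fun z => ?_
          rw [← enorm_neg (w z - w x)]
          refine le_trans (le_of_eq ?_) (enorm_add_le _ _)
          congr 1; ring
      _ = (∫⁻ z in Metric.ball x ρ, ‖w z - w x‖ₑ) + ∫⁻ z in Metric.ball x ρ, ‖w z - w y‖ₑ :=
          lintegral_add_left (hmeas x) _
      _ ≤ _ := by
          rw [two_mul]
          refine add_le_add
            ((lintegral_ball_enorm_sub_le hd hw x x fun z hz => ?_).trans (by gcongr))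
            ((lintegral_ball_enorm_sub_le hd hw y x fun z hz => ?_).trans (by gcongr))
          · rw [Metric.mem_ball, dist_eq_norm] at hz
            linarith
          · rw [Metric.mem_ball, dist_eq_norm] at hz
            have := norm_add_le (z - x) (x - y)
            rw [sub_add_sub_cancel] at this
            linarith
  rw [hVr, ENNReal.ofReal_rpow_of_pos hVp, ← ofReal_norm,
    ← ENNReal.ofReal_mul (norm_nonneg _), ← ENNReal.ofReal_mul hG,
    show (4 : ENNReal) = ENNReal.ofReal 4 by norm_num,
    show (2 : ENNReal) = ENNReal.ofReal 2 by norm_num, ← ENNReal.ofReal_mul (by norm_num),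
    ← ENNReal.ofReal_mul (by positivity), ← ENNReal.ofReal_mul (by norm_num),
    ENNReal.ofReal_le_ofReal_iff (by positivity), Real.norm_eq_abs] at h1
  have h2 : (ρ ^ d * v) ^ (3 / 4 : ℝ) = (ρ ^ d * v) * (ρ ^ d * v) ^ (-(1 / 4) : ℝ) := by
    nth_rewrite 2 [← Real.rpow_one (ρ ^ d * v)]
    rw [← Real.rpow_add hVp]
    norm_num
  have h3 : (ρ ^ d * v) ^ (-(1 / 4) : ℝ) = ρ ^ (-(d / 4 : ℝ)) * v ^ (-(1 / 4) : ℝ) := by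
    rw [Real.mul_rpow (by positivity) hv0.le, ← Real.rpow_natCast, ← Real.rpow_mul hρ0.le]
    congr 2
    ring
  have h4 : ρ ^ (1 - d / 4 : ℝ) = ρ * ρ ^ (-(d / 4 : ℝ)) := by
    rw [sub_eq_add_neg, Real.rpow_add hρ0, Real.rpow_one]
  rw [h2, h3] at h1
  rw [h4]
  refine le_of_mul_le_mul_right (h1.trans (le_of_eq ?_)) hVp
  ring

end Morrey

end Peridynamics

namespace Peridynamics

/-! ### Sup, L⁴ and Hölder bounds for scalar functions -/

section ScalarBounds

variable {d : ℕ} {D : Set (E d)}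

lemma integral_sq_le_of_eLpNorm_le {α : Type*} [MeasurableSpace α] {μ : Measure α} {h : α → ℝ}
    (mh : MemLp h 2 μ) {N : ℝ} (hN : 0 ≤ N) (hle : eLpNorm h 2 μ ≤ ENNReal.ofReal N) :
    ∫ x, h x ^ 2 ∂μ ≤ N ^ 2 := by
  rw [eLpNorm_two_eq mh, ENNReal.ofReal_le_ofReal_iff hN] at hle
  simp only [Real.norm_eq_abs, sq_abs] at hle
  exact (Real.sqrt_le_left hN).1 hle

lemma eLpNorm_sum_le_card {α ι F : Type*} [Fintype ι] [MeasurableSpace α] {μ : Measure α}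
    [NormedAddCommGroup F] {f : ι → α → F} (hf : ∀ i, AEStronglyMeasurable (f i) μ)
    {p : ENNReal} (hp : 1 ≤ p) {N : ℝ} (hle : ∀ i, eLpNorm (f i) p μ ≤ ENNReal.ofReal N) :
    eLpNorm (fun x => ∑ i, f i x) p μ ≤ ENNReal.ofReal (Fintype.card ι * N) := by
  have h1 : (fun x => ∑ i, f i x) = ∑ i, f i := by
    ext x
    simp
  rw [h1]
  refine (eLpNorm_sum_le (fun i _ => hf i) hp).trans ?_
  refine (Finset.sum_le_sum fun i _ => hle i).trans ?_
  rw [Finset.sum_const, Finset.card_univ, nsmul_eq_mul, ENNReal.ofReal_mul (by positivity),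
    ENNReal.ofReal_natCast]

/-- Sup bound, `L^4` gradient bound and Hölder bound for scalar functions in `H^2 ∩ H^1_0`. -/
theorem exists_scalar_bounds (hd : d = 2 ∨ d = 3) (hD : IsOpen D) (hDb : Bornology.IsBounded D) :
    ∃ C : ℝ, 0 ≤ C ∧ ∀ (a : E d → ℝ) (a' h : Fin d → E d → ℝ) (N : ℝ), 0 ≤ N → IsH10 D a a' →
      (∀ i, WeakPD D i (a' i) (h i)) → (∀ i, MemLp (h i) 2 (volume.restrict D)) →
      (∀ i, eLpNorm (h i) 2 (volume.restrict D) ≤ ENNReal.ofReal N) →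
      (∀ᵐ x ∂(volume.restrict D), |a x| ≤ C * N) ∧
      (∀ i, eLpNorm (a' i) 4 (volume.restrict D) ≤ ENNReal.ofReal (C * N)) ∧
      ∀ z : E d, ‖z‖ ≤ 1 →
        ∀ᵐ x, |D.indicator a (x + z) - D.indicator a x| ≤ C * N * ‖z‖ ^ (1 / 4 : ℝ) := by
  obtain ⟨Λ, hΛ0, hΛ⟩ := exists_sup_bound hd hD hDb
  have hd3 : d ≤ 3 := by omega
  obtain ⟨K, hK0, hK⟩ := exists_morrey hd3
  set A := Λ * d with hA
  -- With |a| ≤ A N and second derivatives bounded by N, the L⁴ estimate reads 9 (A N)² N² = (3A)²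
  -- N⁴ = (B N)⁴.
  set B := Real.sqrt (3 * A) with hB
  have hA0 : 0 ≤ A := by positivity
  have hB0 : 0 ≤ B := Real.sqrt_nonneg _
  have hB2 : B ^ 2 = 3 * A := Real.sq_sqrt (by positivity)
  refine ⟨A + B + K * (d * B), by positivity, fun a a' h N hN ha hh mh hle => ?_⟩
  have hsup : ∀ᵐ x ∂(volume.restrict D), |a x| ≤ A * N := by
    filter_upwards [hΛ a a' h ha hh mh] with x hx
    refine hx.trans ?_
    have h1 := eLpNorm_sum_le_card (fun i => (mh i).1) one_le_two hle
    have h2 := ENNReal.toReal_mono ENNReal.ofReal_ne_top h1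
    rw [ENNReal.toReal_ofReal (by positivity), Fintype.card_fin] at h2
    rw [hA, mul_assoc]
    gcongr
  have hfour : ∀ i, eLpNorm (a' i) 4 (volume.restrict D) ≤ ENNReal.ofReal (B * N) := by
    intro i
    have h1 := lintegral_pow_four_le hD hDb ha (hh i) (mh i) hsup
    have h2 : 9 * (A * N) ^ 2 * ∫ x in D, h i x ^ 2 ≤ (B * N) ^ 4 := by
      calc 9 * (A * N) ^ 2 * ∫ x in D, h i x ^ 2 ≤ 9 * (A * N) ^ 2 * N ^ 2 := by
            gcongr
            exact integral_sq_le_of_eLpNorm_le (mh i) hN (hle i)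
        _ = (3 * A) ^ 2 * N ^ 4 := by ring
        _ = (B * N) ^ 4 := by rw [← hB2]; ring
    rw [eLpNorm_eq_lintegral_rpow_enorm_toReal (by norm_num) (by norm_num)]
    have h3 := h1.trans (ENNReal.ofReal_le_ofReal h2)
    have h4 := ENNReal.rpow_le_rpow h3 (by norm_num : (0 : ℝ) ≤ 1 / 4)
    rw [ENNReal.ofReal_rpow_of_nonneg (by positivity) (by norm_num), ← Real.rpow_natCast,
      ← Real.rpow_mul (by positivity)] at h4
    simpa using h4
  have hmon : ∀ t, t ≤ A + B + K * (d * B) → t * N ≤ (A + B + K * (d * B)) * N := fun t ht =>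
    mul_le_mul_of_nonneg_right ht hN
  have hKB : 0 ≤ K * (d * B) := by positivity
  refine ⟨hsup.mono fun x hx => hx.trans (hmon _ (by linarith)), fun i => (hfour i).trans
    (ENNReal.ofReal_le_ofReal (hmon _ (by linarith))), fun z hz => ?_⟩
  have hfin : IsFiniteMeasure (volume.restrict D) := ⟨by simpa using hDb.measure_lt_top⟩
  have ia : Integrable (D.indicator a) := by
    rw [integrable_indicator_iff hD.measurableSet]
    exact ha.memLp.integrable one_le_two
  -- Morrey is applied to mollifications of the extension by zero, whose gradients are mollified
  -- gradients and hence no larger in L⁴. The bound is uniform in n and passes to the limit at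
  -- almost every point.
  have hhol : ∀ n x y, |mol n (D.indicator a) x - mol n (D.indicator a) y| ≤
      K * (d * (B * N)) * ‖x - y‖ ^ (1 - d / 4 : ℝ) := by
    intro n x y
    have hsm : ContDiff ℝ ∞ (mol n (D.indicator a)) := mol_contDiff n ia.locallyIntegrable
    refine hK _ (hsm.of_le (by exact_mod_cast le_top)) _ (by positivity) ?_ x y
    have hpd : ∀ i x, fderiv ℝ (mol n (D.indicator a)) x (basisVec i) =
        mol n (D.indicator (a' i)) x := fun i x =>
      fderiv_mol (IsH10.weakPD hD hDb ha i) ia.locallyIntegrable MeasurableSet.univ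
        (fun _ _ => rfl) (fun _ _ => rfl) n (subset_univ _)
    have hm : ∀ i, AEStronglyMeasurable (D.indicator (a' i)) volume := fun i => by
      rw [aestronglyMeasurable_indicator_iff hD.measurableSet]
      exact (ha.memLp' i).1
    have hi : ∀ i, LocallyIntegrable (D.indicator (a' i)) := fun i => by
      refine Integrable.locallyIntegrable ?_
      rw [integrable_indicator_iff hD.measurableSet]
      exact (ha.memLp' i).integrable one_le_two
    have h4 : ENNReal.ofReal 4 = 4 := by norm_num
    have hsum := eLpNorm_sum_le_card (p := 4) (N := B * N)
      (f := fun i x => ‖mol n (D.indicator (a' i)) x‖)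
      (fun i => ((mol_contDiff n (hi i)).continuous.norm).aestronglyMeasurable) (by norm_num)
      (μ := (volume : Measure (E d))) (fun i => by
        rw [eLpNorm_norm, ← h4]
        refine (eLpNorm_mol_le n (hm i) (by norm_num)).trans ?_
        rw [h4, eLpNorm_indicator_eq_eLpNorm_restrict hD.measurableSet]
        exact hfour i)
    rw [Fintype.card_fin] at hsum
    refine le_trans ?_ hsum
    rw [eLpNorm_eq_lintegral_rpow_enorm_toReal (by norm_num) (by norm_num)]
    simp only [ENNReal.toReal_ofNat]
    gcongr with x
    refine enorm_le_iff_norm_le.2 ?_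
    rw [Real.norm_of_nonneg (Finset.sum_nonneg fun i _ => norm_nonneg _)]
    refine (norm_le_sum_abs_basisVec _).trans (le_of_eq ?_)
    exact Finset.sum_congr rfl fun i _ => by rw [hpd, Real.norm_eq_abs]
  have h1 := tendsto_mol_ae ia.locallyIntegrable
  have h2 := (measurePreserving_add_right (volume : Measure (E d)) z).quasiMeasurePreserving.ae h1
  filter_upwards [h1, h2] with x hx hx'
  have h3 : |D.indicator a (x + z) - D.indicator a x| ≤
      K * (d * (B * N)) * ‖z‖ ^ (1 - d / 4 : ℝ) := by
    refine le_of_tendsto' ((hx'.sub hx).abs) fun n => ?_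
    have := hhol n (x + z) x
    rwa [add_sub_cancel_left] at this
  refine h3.trans ?_
  -- For |z| ≤ 1 the exponent may be lowered to 1/4, its value in the worst dimension d = 3.
  have h5 : ‖z‖ ^ (1 - d / 4 : ℝ) ≤ ‖z‖ ^ (1 / 4 : ℝ) := by
    refine Real.rpow_le_rpow_of_exponent_ge' (norm_nonneg _) hz (by norm_num) ?_
    have : (d : ℝ) ≤ 3 := by exact_mod_cast hd3
    linarith
  calc K * (d * (B * N)) * ‖z‖ ^ (1 - d / 4 : ℝ) = (K * (d * B)) * N * ‖z‖ ^ (1 - d / 4 : ℝ) := by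
        ring
    _ ≤ _ := by
        gcongr
        linarith

end ScalarBounds

/-! ### Regular representatives of fields in W -/

section Regular

variable {d : ℕ}

/-- Representatives `u`, `u₁ i`, `u₂ i j` of a field in `H^2 ∩ H^1_0`, extended by zero, and of
its weak derivatives, with all the bounds that are needed controlled by `K`. -/
structure IsRegular (D : Set (E d)) (K : ℝ) (u : E d → E d) (u₁ : Fin d → E d → E d)
    (u₂ : Fin d → Fin d → E d → E d) : Prop where
  meas : StronglyMeasurable u
  meas₁ : ∀ i, StronglyMeasurable (u₁ i)
  meas₂ : ∀ i j, StronglyMeasurable (u₂ i j)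
  zero : ∀ x ∉ D, u x = 0
  zero₁ : ∀ i, ∀ x ∉ D, u₁ i x = 0
  zero₂ : ∀ i j, ∀ x ∉ D, u₂ i j x = 0
  weak : ∀ i, WeakPD D i u (u₁ i)
  weak₁ : ∀ i j, WeakPD D j (u₁ i) (u₂ i j)
  sup : ∀ᵐ x, ‖u x‖ ≤ K
  four : ∀ i, eLpNorm (u₁ i) 4 volume ≤ ENNReal.ofReal K
  two : ∀ i j, eLpNorm (u₂ i j) 2 volume ≤ ENNReal.ofReal K
  holder : ∀ z : E d, ‖z‖ ≤ 1 → ∀ᵐ x, ‖u (x + z) - u x‖ ≤ K * ‖z‖ ^ (1 / 4 : ℝ)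

lemma norm_le_sum_abs_apply (x : E d) : ‖x‖ ≤ ∑ k, |x k| := by
  have hx : x = ∑ k, x k • basisVec k := by
    ext j
    simp [basisVec, Pi.single_apply]
  conv_lhs => rw [hx]
  refine (norm_sum_le _ _).trans (Finset.sum_le_sum fun k _ => ?_)
  rw [norm_smul, Real.norm_eq_abs, basisVec]
  simp

lemma l2Norm_second_le_h2Norm (D : Set (E d)) (u : E d → E d) (i j : Fin d) :
    l2Norm D (weakPartial D j (weakPartial D i u)) ≤ h2Norm D u := by
  refine Real.le_sqrt_of_sq_le ?_
  have h1 : ∀ i, 0 ≤ ∑ j, l2Norm D (weakPartial D j (weakPartial D i u)) ^ 2 := fun i =>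
    Finset.sum_nonneg fun _ _ => sq_nonneg _
  have h2 : l2Norm D (weakPartial D j (weakPartial D i u)) ^ 2 ≤
      ∑ i, ∑ j, l2Norm D (weakPartial D j (weakPartial D i u)) ^ 2 :=
    (Finset.single_le_sum (f := fun j => l2Norm D (weakPartial D j (weakPartial D i u)) ^ 2)
      (fun i _ => sq_nonneg _) (Finset.mem_univ j)).trans
    (Finset.single_le_sum
      (f := fun i => ∑ j, l2Norm D (weakPartial D j (weakPartial D i u)) ^ 2)
      (fun i _ => h1 i) (Finset.mem_univ i))
  refine h2.trans (le_add_of_nonneg_left ?_)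
  exact add_nonneg (sq_nonneg _) (Finset.sum_nonneg fun i _ => sq_nonneg _)

/-- The scalar bounds are applied componentwise; summing components costs a factor d, and C + 1 also
covers the trivial bound of the second derivatives by the norm. Representatives that are strongly
measurable and vanish everywhere off D, not just almost everywhere, are chosen so that the kernels
below become jointly measurable in bond and point. -/
theorem exists_isRegular (hd : d = 2 ∨ d = 3) {D : Set (E d)} (hD : IsOpen D)
    (hDb : Bornology.IsBounded D) :
    ∃ C : ℝ, 0 ≤ C ∧ ∀ u : E d → E d, MemW D u → ∃ u₀ u₁ u₂,
      IsRegular D (C * h2Norm D u) u₀ u₁ u₂ ∧ D.indicator u =ᵐ[volume] u₀ := by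
  obtain ⟨C, hC0, hC⟩ := exists_scalar_bounds hd hD hDb
  refine ⟨d * (C + 1), by positivity, fun u hu => ?_⟩
  set N := h2Norm D u with hN
  have hN0 : 0 ≤ N := Real.sqrt_nonneg _
  set g : Fin d → E d → E d := fun i => weakPartial D i u with hg
  set h : Fin d → Fin d → E d → E d := fun i j => weakPartial D j (weakPartial D i u) with hh
  have wg : ∀ i, WeakPD D i u (g i) := fun i =>
    weakPD_weakPartial (let ⟨g', hg', _⟩ := hu.1.2 i; ⟨g', hg'⟩)
  have hgH : ∀ i, MemH1 D (g i) := fun i => by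
    obtain ⟨g', hg', hL, hL'⟩ := hu.1.2 i
    have e := weakPartial_ae_eq hD hg'
    refine ⟨hL.ae_eq e.symm, fun j => ?_⟩
    obtain ⟨k, hk, hkL⟩ := hL' j
    exact ⟨k, WeakPD.congr_ae hk e.symm (ae_eq_refl _), hkL⟩
  have wh : ∀ i j, WeakPD D j (g i) (h i j) := fun i j =>
    weakPD_weakPartial (let ⟨g', hg', _⟩ := (hgH i).2 j; ⟨g', hg'⟩)
  have mh : ∀ i j, MemLp (h i j) 2 (volume.restrict D) := fun i j => by
    obtain ⟨k, hk, hkL⟩ := (hgH i).2 j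
    exact hkL.ae_eq (weakPartial_ae_eq hD hk).symm
  have bh : ∀ i j, eLpNorm (h i j) 2 (volume.restrict D) ≤ ENNReal.ofReal N := fun i j => by
    rw [← ENNReal.ofReal_toReal (mh i j).2.ne]
    exact ENNReal.ofReal_le_ofReal (l2Norm_second_le_h2Norm D u i j)
  -- Only the pure second derivatives ∂_ii enter the scalar estimates.
  have bk : ∀ k : Fin d, _ := fun k =>
    hC (fun x => EuclideanSpace.proj k (u x)) (fun i x => EuclideanSpace.proj k (g i x))
      (fun i x => EuclideanSpace.proj k (h i i x)) N hN0
      (MemH10.isH10 hD hu.2 wg (EuclideanSpace.proj k : E d →L[ℝ] ℝ))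
      (fun i => (wh i i).clm_comp (EuclideanSpace.proj k : E d →L[ℝ] ℝ))
      (fun i => (EuclideanSpace.proj k : E d →L[ℝ] ℝ).comp_memLp' (mh i i))
      (fun i => (eLpNorm_mono fun x => by
        simpa using PiLp.norm_apply_le (h i i x) k).trans (bh i i))
  have mu : AEStronglyMeasurable u (volume.restrict D) := hu.1.1.1
  have mg : ∀ i, AEStronglyMeasurable (g i) (volume.restrict D) := fun i => (hgH i).1.1
  have ind : ∀ {v : E d → E d} (mv : AEStronglyMeasurable v (volume.restrict D)),
      D.indicator v =ᵐ[volume] D.indicator (mv.mk v) := fun {v} mv => by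
    have := mv.ae_eq_mk
    rw [EventuallyEq, ae_restrict_iff' hD.measurableSet] at this
    filter_upwards [this] with x hx
    by_cases hxD : x ∈ D
    · rw [indicator_of_mem hxD, indicator_of_mem hxD, hx hxD]
    · rw [indicator_of_notMem hxD, indicator_of_notMem hxD]
  have indr : ∀ {v : E d → E d} (mv : AEStronglyMeasurable v (volume.restrict D)),
      v =ᵐ[volume.restrict D] D.indicator (mv.mk v) := fun {v} mv =>
    mv.ae_eq_mk.trans (indicator_ae_eq_restrict hD.measurableSet).symm
  have hle : ∀ t : ℝ, t ≤ C + 1 → d * (t * N) ≤ d * (C + 1) * N := fun t ht => by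
    rw [← mul_assoc]
    gcongr
  have hd1 : (1 : ℝ) ≤ d := by
    have : 1 ≤ d := by omega
    exact_mod_cast this
  refine ⟨D.indicator (mu.mk u), fun i => D.indicator ((mg i).mk (g i)),
    fun i j => D.indicator ((mh i j).1.mk (h i j)), ⟨mu.stronglyMeasurable_mk.indicator
    hD.measurableSet, fun i => (mg i).stronglyMeasurable_mk.indicator hD.measurableSet,
    fun i j => (mh i j).1.stronglyMeasurable_mk.indicator hD.measurableSet,
    fun x hx => indicator_of_notMem hx _, fun i x hx => indicator_of_notMem hx _,
    fun i j x hx => indicator_of_notMem hx _, fun i => (wg i).congr_ae (indr mu) (indr (mg i)),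
    fun i j => (wh i j).congr_ae (indr (mg i)) (indr (mh i j).1), ?_, fun i => ?_,
    fun i j => ?_, fun z hz => ?_⟩, ind mu⟩
  · have h1 := ae_all_iff.2 fun k => (bk k).1
    rw [ae_restrict_iff' hD.measurableSet] at h1
    filter_upwards [ind mu, h1] with x hx h1
    rw [← hx]
    by_cases hxD : x ∈ D
    · rw [indicator_of_mem hxD]
      refine (norm_le_sum_abs_apply _).trans ((Finset.sum_le_sum fun k _ => h1 hxD k).trans ?_)
      rw [Finset.sum_const, Finset.card_univ, Fintype.card_fin, nsmul_eq_mul]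
      exact hle C (by linarith)
    · rw [indicator_of_notMem hxD, norm_zero]
      positivity
  · rw [← eLpNorm_congr_ae (ind (mg i)), eLpNorm_indicator_eq_eLpNorm_restrict hD.measurableSet]
    refine le_trans ?_ (ENNReal.ofReal_le_ofReal (hle C (by linarith)))
    have h1 := eLpNorm_sum_le_card (p := 4) (N := C * N) (μ := volume.restrict D)
      (f := fun k x => ‖EuclideanSpace.proj k (g i x)‖)
      (fun k => ((EuclideanSpace.proj k : E d →L[ℝ] ℝ).continuous.comp_aestronglyMeasurable
        (mg i)).norm) (by norm_num) (fun k => by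
          rw [eLpNorm_norm]
          exact (bk k).2.1 i)
    rw [Fintype.card_fin] at h1
    refine le_trans (eLpNorm_mono fun x => ?_) h1
    rw [Real.norm_of_nonneg (Finset.sum_nonneg fun _ _ => norm_nonneg _)]
    exact norm_le_sum_abs_apply _
  · rw [← eLpNorm_congr_ae (ind (mh i j).1),
      eLpNorm_indicator_eq_eLpNorm_restrict hD.measurableSet]
    refine (bh i j).trans (ENNReal.ofReal_le_ofReal ?_)
    calc N = 1 * (1 * N) := by ring
      _ ≤ d * ((C + 1) * N) := by gcongr; linarith
      _ = _ := by ring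
  · have h1 := ae_all_iff.2 fun k => (bk k).2.2 z hz
    have h2 := (measurePreserving_add_right (volume : Measure (E d)) z).quasiMeasurePreserving.ae
      (ind mu)
    filter_upwards [ind mu, h1, h2] with x hx h1 hx'
    rw [← hx, ← hx']
    refine (norm_le_sum_abs_apply _).trans ((Finset.sum_le_sum fun k _ => ?_).trans
      (b := ∑ k : Fin d, C * N * ‖z‖ ^ (1 / 4 : ℝ)) ?_)
    · have := h1 k
      have e : ∀ y, D.indicator (fun x => EuclideanSpace.proj k (u x)) y =
          (D.indicator u y) k := fun y => by
        by_cases hy : y ∈ D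
        · simp [indicator_of_mem hy]
        · simp [indicator_of_notMem hy]
      rwa [e, e] at this
    · rw [Finset.sum_const, Finset.card_univ, Fintype.card_fin, nsmul_eq_mul, ← mul_assoc]
      exact mul_le_mul_of_nonneg_right (hle C (by linarith)) (by positivity)

end Regular

end Peridynamics

namespace Peridynamics

/-! ### Quantitative L^p bookkeeping -/

section LpBounds

variable {α F : Type*} [MeasurableSpace α] [NormedAddCommGroup F] {μ : Measure α} {p : ENNReal}

/-- `f` is measurable with `L^p` norm at most `N`. -/
def LpLe (p : ENNReal) (μ : Measure α) (f : α → F) (N : ℝ) : Prop :=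
  AEStronglyMeasurable f μ ∧ eLpNorm f p μ ≤ ENNReal.ofReal N

lemma LpLe.memLp {f : α → F} {N : ℝ} (hf : LpLe p μ f N) : MemLp f p μ :=
  ⟨hf.1, hf.2.trans_lt ENNReal.ofReal_lt_top⟩

lemma LpLe.mono {f : α → F} {N N' : ℝ} (hf : LpLe p μ f N) (h : N ≤ N') : LpLe p μ f N' :=
  ⟨hf.1, hf.2.trans (ENNReal.ofReal_le_ofReal h)⟩

lemma LpLe.restrict {f : α → F} {N : ℝ} (hf : LpLe p μ f N) (s : Set α) :
    LpLe p (μ.restrict s) f N :=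
  ⟨hf.1.restrict, (eLpNorm_mono_measure f Measure.restrict_le_self).trans hf.2⟩

lemma LpLe.indicator {f : α → F} {N : ℝ} {s : Set α} (hs : MeasurableSet s)
    (hf : LpLe p (μ.restrict s) f N) : LpLe p μ (s.indicator f) N :=
  ⟨(aestronglyMeasurable_indicator_iff hs).2 hf.1, by
    rw [eLpNorm_indicator_eq_eLpNorm_restrict hs]
    exact hf.2⟩

lemma LpLe.add {f g : α → F} {N N' : ℝ} (hf : LpLe p μ f N) (hg : LpLe p μ g N') (hp : 1 ≤ p)
    (hN : 0 ≤ N) (hN' : 0 ≤ N') : LpLe p μ (fun x => f x + g x) (N + N') := by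
  refine ⟨hf.1.add hg.1, (eLpNorm_add_le hf.1 hg.1 hp).trans ?_⟩
  rw [ENNReal.ofReal_add hN hN']
  exact add_le_add hf.2 hg.2

lemma LpLe.sub {f g : α → F} {N N' : ℝ} (hf : LpLe p μ f N) (hg : LpLe p μ g N') (hp : 1 ≤ p)
    (hN : 0 ≤ N) (hN' : 0 ≤ N') : LpLe p μ (fun x => f x - g x) (N + N') := by
  refine ⟨hf.1.sub hg.1, (eLpNorm_sub_le hf.1 hg.1 hp).trans ?_⟩
  rw [ENNReal.ofReal_add hN hN']
  exact add_le_add hf.2 hg.2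

lemma LpLe.of_le_mul {G : Type*} [NormedAddCommGroup G] {f : α → F} {g : α → G} {N B : ℝ}
    (hg : LpLe p μ g N) (hf : AEStronglyMeasurable f μ) (hB0 : 0 ≤ B)
    (hB : ∀ᵐ x ∂μ, ‖f x‖ ≤ B * ‖g x‖) : LpLe p μ f (B * N) := by
  refine ⟨hf, (eLpNorm_le_mul_eLpNorm_of_ae_le_mul hB p).trans ?_⟩
  rw [ENNReal.ofReal_mul hB0]
  gcongr
  exact hg.2

lemma LpLe.bdd_mul {f ψ : α → ℝ} {N B : ℝ} (hf : LpLe p μ f N) (hψ : AEStronglyMeasurable ψ μ)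
    (hB0 : 0 ≤ B) (hB : ∀ᵐ x ∂μ, |ψ x| ≤ B) : LpLe p μ (fun x => ψ x * f x) (B * N) := by
  refine hf.of_le_mul (hψ.mul hf.1) hB0 ?_
  filter_upwards [hB] with x hx
  rw [norm_mul]
  gcongr
  exact hx

lemma LpLe.mul_bdd {f ψ : α → ℝ} {N B : ℝ} (hf : LpLe p μ f N) (hψ : AEStronglyMeasurable ψ μ)
    (hB0 : 0 ≤ B) (hB : ∀ᵐ x ∂μ, |ψ x| ≤ B) : LpLe p μ (fun x => f x * ψ x) (B * N) := by
  simpa only [mul_comm] using hf.bdd_mul hψ hB0 hB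

lemma LpLe.four_mul_four {f g : α → ℝ} {N N' : ℝ} (hf : LpLe 4 μ f N) (hg : LpLe 4 μ g N')
    (hN : 0 ≤ N) : LpLe 2 μ (fun x => f x * g x) (N * N') := by
  have : ENNReal.HolderTriple 4 4 2 := ⟨by
    have h4 : (4 : ENNReal) = 2 * 2 := by norm_num
    rw [h4, ENNReal.mul_inv (by simp) (by simp), ← two_mul, ← mul_assoc,
      ENNReal.mul_inv_cancel (by simp) (by simp), one_mul]⟩
  refine ⟨hf.1.mul hg.1, ?_⟩
  have h := eLpNorm_smul_le_mul_eLpNorm (p := 4) (q := 4) (r := 2) hg.1 hf.1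
  refine (show eLpNorm (fun x => f x * g x) 2 μ ≤ _ from h).trans ?_
  rw [ENNReal.ofReal_mul hN]
  exact mul_le_mul' hf.2 hg.2

/-- Since V ≥ 1, the natural factor V^(1/p) may be replaced by V, which gives one constant for all
exponents. -/
lemma LpLe.of_bdd {f : α → F} {B V : ℝ} (hf : AEStronglyMeasurable f μ)
    (hV : μ univ ≤ ENNReal.ofReal V) (hV1 : 1 ≤ V) (hp : 1 ≤ p) (hB0 : 0 ≤ B)
    (hB : ∀ᵐ x ∂μ, ‖f x‖ ≤ B) : LpLe p μ f (B * V) := by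
  refine ⟨hf, (eLpNorm_le_of_ae_bound hB).trans ?_⟩
  rw [mul_comm, ENNReal.ofReal_mul hB0]
  gcongr
  calc μ univ ^ p.toReal⁻¹ ≤ ENNReal.ofReal V ^ p.toReal⁻¹ := by gcongr
    _ ≤ ENNReal.ofReal V ^ (1 : ℝ) := by
        refine ENNReal.rpow_le_rpow_of_exponent_le (by simpa using hV1) ?_
        rcases eq_or_ne p ⊤ with rfl | hpt
        · simp
        · refine inv_le_one_of_one_le₀ ?_
          rw [← ENNReal.toReal_one]
          exact ENNReal.toReal_mono hpt hp
    _ = _ := ENNReal.rpow_one _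

lemma LpLe.two_of_four {f : α → F} {N V : ℝ} (hf : LpLe 4 μ f N)
    (hV : μ univ ≤ ENNReal.ofReal V) (hV1 : 1 ≤ V) (hN : 0 ≤ N) : LpLe 2 μ f (N * V) := by
  refine ⟨hf.1, (eLpNorm_le_eLpNorm_mul_rpow_measure_univ (p := 2) (q := 4)
    (by norm_num) hf.1).trans ?_⟩
  rw [ENNReal.ofReal_mul hN]
  gcongr
  · exact hf.2
  · refine (ENNReal.rpow_le_rpow hV (by norm_num)).trans ?_
    calc ENNReal.ofReal V ^ (1 / (2 : ENNReal).toReal - 1 / (4 : ENNReal).toReal)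
        ≤ ENNReal.ofReal V ^ (1 : ℝ) :=
          ENNReal.rpow_le_rpow_of_exponent_le (by simpa using hV1) (by norm_num)
      _ = _ := ENNReal.rpow_one _

end LpBounds

/-! ### Second derivatives of F(a) b and of products with a cutoff -/

section Composite

variable {d : ℕ}

/-- `a` is twice weakly differentiable in `U` with first derivatives in `L^4` and second
derivatives in `L^2`, all bounded by `A`. -/
structure HasSecondWeak (U : Set (E d)) (A : ℝ) (a : E d → ℝ) (a₁ : Fin d → E d → ℝ)
    (a₂ : Fin d → Fin d → E d → ℝ) : Prop where
  memLp : MemLp a 2 (volume.restrict U)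
  weak : ∀ i, WeakPD U i a (a₁ i)
  weak₁ : ∀ i j, WeakPD U j (a₁ i) (a₂ i j)
  four : ∀ i, LpLe 4 (volume.restrict U) (a₁ i) A
  two : ∀ i j, LpLe 2 (volume.restrict U) (a₂ i j) A

/-- Bounds for a `C^2` function and its first two derivatives. -/
structure IsBddC2 (F : ℝ → ℝ) (C : ℝ) : Prop where
  contDiff : ContDiff ℝ 2 F
  bd : ∀ s, |F s| ≤ C
  bd₁ : ∀ s, |deriv F s| ≤ C
  bd₂ : ∀ s, |deriv (deriv F) s| ≤ C

/-- First weak derivatives of `F(a) b`. -/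
noncomputable def bond₁ (F : ℝ → ℝ) (a b : E d → ℝ) (a₁ b₁ : Fin d → E d → ℝ) (i : Fin d)
    (x : E d) : ℝ :=
  deriv F (a x) * (a₁ i x * b x) + F (a x) * b₁ i x

/-- Second weak derivatives of `F(a) b`. -/
noncomputable def bond₂ (F : ℝ → ℝ) (a b : E d → ℝ) (a₁ b₁ : Fin d → E d → ℝ)
    (a₂ b₂ : Fin d → Fin d → E d → ℝ) (i j : Fin d) (x : E d) : ℝ :=
  (deriv (deriv F) (a x) * a₁ j x * (a₁ i x * b x)
    + deriv F (a x) * (a₂ i j x * b x + a₁ i x * b₁ j x))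
    + (deriv F (a x) * a₁ j x * b₁ i x + F (a x) * b₂ i j x)

variable {U : Set (E d)} {A B Bb V C : ℝ} {F : ℝ → ℝ} {a b : E d → ℝ} {a₁ b₁ : Fin d → E d → ℝ}
  {a₂ b₂ : Fin d → Fin d → E d → ℝ}

/-- The products of two first derivatives are L⁴ · L⁴ ⊂ L², and every other term is an L² function
times bounded factors. This is the reason for requiring gradients in L⁴ and b in L^∞. -/
theorem HasSecondWeak.bond (hU : IsOpen U) (ha : HasSecondWeak U A a a₁ a₂)
    (hb : HasSecondWeak U B b b₁ b₂) (hF : IsBddC2 F C) (hbb : ∀ᵐ x ∂(volume.restrict U), |b x| ≤ Bb)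
    (hV : volume U ≤ ENNReal.ofReal V) (hV1 : 1 ≤ V) (hA : 0 ≤ A) (hB : 0 ≤ B) (hBb : 0 ≤ Bb) :
    ((∀ i, WeakPD U i (fun x => F (a x) * b x) (bond₁ F a b a₁ b₁ i)) ∧
      ∀ i j, WeakPD U j (bond₁ F a b a₁ b₁ i) (bond₂ F a b a₁ b₁ a₂ b₂ i j)) ∧
    LpLe 2 (volume.restrict U) (fun x => F (a x) * b x) (C * (Bb * V)) ∧
    (∀ i, LpLe 2 (volume.restrict U) (bond₁ F a b a₁ b₁ i) (C * (Bb * (A * V)) + C * (B * V))) ∧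
    ∀ i j, LpLe 2 (volume.restrict U) (bond₂ F a b a₁ b₁ a₂ b₂ i j)
      ((C * (A * A * Bb) + C * (Bb * A + A * B)) + (C * (A * B) + C * B)) := by
  set μ := volume.restrict U with hμ
  have hVu : μ univ ≤ ENNReal.ofReal V := by rwa [hμ, Measure.restrict_apply_univ]
  have hUv : volume U ≠ ⊤ := (hV.trans_lt ENNReal.ofReal_lt_top).ne
  have hC : 0 ≤ C := (abs_nonneg _).trans (hF.bd 0)
  have hF1 : ContDiff ℝ 1 (deriv F) := by
    have := hF.contDiff
    rw [show (2 : WithTop ℕ∞) = 1 + 1 by norm_num, contDiff_succ_iff_deriv] at this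
    exact this.2.2
  have hF0 : ContDiff ℝ 1 F := hF.contDiff.of_le (by norm_num)
  have mF : AEStronglyMeasurable (fun x => F (a x)) μ :=
    hF0.continuous.comp_aestronglyMeasurable ha.memLp.1
  have mF' : AEStronglyMeasurable (fun x => deriv F (a x)) μ :=
    hF1.continuous.comp_aestronglyMeasurable ha.memLp.1
  have mF'' : AEStronglyMeasurable (fun x => deriv (deriv F) (a x)) μ :=
    (hF1.continuous_deriv le_rfl).comp_aestronglyMeasurable ha.memLp.1
  have bF : ∀ᵐ x ∂μ, |F (a x)| ≤ C := Eventually.of_forall fun x => hF.bd _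
  have bF' : ∀ᵐ x ∂μ, |deriv F (a x)| ≤ C := Eventually.of_forall fun x => hF.bd₁ _
  have bF'' : ∀ᵐ x ∂μ, |deriv (deriv F) (a x)| ≤ C := Eventually.of_forall fun x => hF.bd₂ _
  have mb := hb.memLp.1
  have hab : ∀ i, LpLe 2 μ (fun x => a₁ i x * b x) (Bb * (A * V)) := fun i =>
    ((ha.four i).two_of_four hVu hV1 hA).mul_bdd mb hBb hbb
  have hb2 : ∀ i, LpLe 2 μ (b₁ i) (B * V) := fun i => (hb.four i).two_of_four hVu hV1 hB
  have ha2 : ∀ i, LpLe 2 μ (a₁ i) (A * V) := fun i => (ha.four i).two_of_four hVu hV1 hA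
  have lb : LpLe 2 μ b (Bb * V) := LpLe.of_bdd mb hVu hV1 one_le_two hBb hbb
  have hab' : ∀ i j, LpLe 2 μ (fun x => a₂ i j x * b x + a₁ i x * b₁ j x) (Bb * A + A * B) :=
    fun i j => ((ha.two i j).mul_bdd mb hBb hbb).add ((ha.four i).four_mul_four (hb.four j) hA)
      one_le_two (by positivity) (by positivity)
  -- The product a_i b is differentiated as a unit. In this grouping each factor and its derivative
  -- are in L², which is what the product rule requires; the ungrouped triple products would not fit
  -- it.
  have wab : ∀ i j, WeakPD U j (fun x => a₁ i x * b x)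
      (fun x => a₂ i j x * b x + a₁ i x * b₁ j x) := fun i j =>
    (ha.weak₁ i j).mul hU (hb.weak j) (ha2 i).memLp (ha.two i j).memLp hb.memLp (hb2 j).memLp
  have wF : ∀ i, WeakPD U i (fun x => F (a x)) (fun x => deriv F (a x) * a₁ i x) := fun i =>
    (ha.weak i).comp hU hUv hF0 hF.bd₁ ha.memLp (ha2 i).memLp
  have wF' : ∀ i, WeakPD U i (fun x => deriv F (a x)) (fun x => deriv (deriv F) (a x) * a₁ i x) :=
    fun i => (ha.weak i).comp hU hUv hF1 hF.bd₂ ha.memLp (ha2 i).memLp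
  have lF : LpLe 2 μ (fun x => F (a x)) (C * V) := LpLe.of_bdd mF hVu hV1 one_le_two hC bF
  have lF' : LpLe 2 μ (fun x => deriv F (a x)) (C * V) :=
    LpLe.of_bdd mF' hVu hV1 one_le_two hC bF'
  have dF : ∀ i, LpLe 2 μ (fun x => deriv F (a x) * a₁ i x) (C * (A * V)) := fun i =>
    (ha2 i).bdd_mul mF' hC bF'
  have dF' : ∀ i, LpLe 2 μ (fun x => deriv (deriv F) (a x) * a₁ i x) (C * (A * V)) := fun i =>
    (ha2 i).bdd_mul mF'' hC bF''
  refine ⟨⟨fun i => ?_, fun i j => ?_⟩, lb.bdd_mul mF hC bF, fun i => ?_, fun i j => ?_⟩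
  · have := (wF i).mul hU (hb.weak i) lF.memLp (dF i).memLp hb.memLp (hb2 i).memLp
    refine this.congr_ae (ae_eq_refl _) (Eventually.of_forall fun x => ?_)
    simp only [bond₁]
    ring
  · exact ((wF' j).mul hU (wab i j) lF'.memLp (dF' j).memLp (hab i).memLp (hab' i j).memLp).add
      ((wF j).mul hU (hb.weak₁ i j) lF.memLp (dF j).memLp (hb2 i).memLp (hb.two i j).memLp)
  · exact ((hab i).bdd_mul mF' hC bF').add ((hb2 i).bdd_mul mF hC bF) one_le_two (by positivity)
      (by positivity)
  · refine LpLe.add (LpLe.add ?_ ((hab' i j).bdd_mul mF' hC bF') one_le_two (by positivity)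
      (by positivity)) (LpLe.add ?_ ((hb.two i j).bdd_mul mF hC bF) one_le_two (by positivity)
      (by positivity)) one_le_two (by positivity) (by positivity)
    · have h1 := ((ha.four j).four_mul_four (ha.four i) hA).mul_bdd mb hBb hbb
      have h2 := h1.bdd_mul mF'' hC bF''
      rw [mul_comm Bb] at h2
      convert h2 using 2
      ring
    · have h1 := ((ha.four j).four_mul_four (hb.four i) hA).bdd_mul mF' hC bF'
      convert h1 using 2
      ring

/-- First derivatives of `p h`. -/
noncomputable def cut₁ (p h : E d → ℝ) (h₁ : Fin d → E d → ℝ) (i : Fin d) (x : E d) : ℝ :=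
  fderiv ℝ p x (basisVec i) * h x + p x * h₁ i x

/-- Second derivatives of `p h`. -/
noncomputable def cut₂ (p h : E d → ℝ) (h₁ : Fin d → E d → ℝ) (h₂ : Fin d → Fin d → E d → ℝ)
    (i j : Fin d) (x : E d) : ℝ :=
  (fderiv ℝ (fun y => fderiv ℝ p y (basisVec i)) x (basisVec j) * h x
    + fderiv ℝ p x (basisVec i) * h₁ j x)
    + (fderiv ℝ p x (basisVec j) * h₁ i x + p x * h₂ i j x)

/-- Cutting off with a nonnegative `C^2` function of `D` that vanishes in `D \ U`. -/
theorem WeakPD.cutoff_two {D : Set (E d)} (hD : IsOpen D) (hU : IsOpen U) (hUD : U ⊆ D)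
    {p : E d → ℝ} (hp : ContDiffOn ℝ 2 p D) (hpos : ∀ x ∈ D, 0 ≤ p x)
    (hp0 : ∀ x ∈ D, x ∉ U → p x = 0) {P : ℝ} (hP0 : 0 ≤ P) (hp1 : ∀ x ∈ D, p x ≤ 1)
    (hP : ∀ x ∈ D, ∀ i, |fderiv ℝ p x (basisVec i)| ≤ P)
    (hP' : ∀ x ∈ D, ∀ i j, |fderiv ℝ (fun y => fderiv ℝ p y (basisVec i)) x (basisVec j)| ≤ P)
    (hUv : volume U ≠ ⊤)
    {h : E d → ℝ} {h₁ : Fin d → E d → ℝ} {h₂ : Fin d → Fin d → E d → ℝ} {H : ℝ} (hH : 0 ≤ H)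
    (wh : ∀ i, WeakPD U i h (h₁ i)) (wh₁ : ∀ i j, WeakPD U j (h₁ i) (h₂ i j))
    (lh : LpLe 2 (volume.restrict U) h H) (lh₁ : ∀ i, LpLe 2 (volume.restrict U) (h₁ i) H)
    (lh₂ : ∀ i j, LpLe 2 (volume.restrict U) (h₂ i j) H) :
    ((∀ i, WeakPD D i (U.indicator fun x => p x * h x) (U.indicator (cut₁ p h h₁ i))) ∧
      ∀ i j, WeakPD D j (U.indicator (cut₁ p h h₁ i)) (U.indicator (cut₂ p h h₁ h₂ i j))) ∧
    LpLe 2 volume (U.indicator fun x => p x * h x) ((1 + P) * H * 4) ∧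
    (∀ i, LpLe 2 volume (U.indicator (cut₁ p h h₁ i)) ((1 + P) * H * 4)) ∧
    ∀ i j, LpLe 2 volume (U.indicator (cut₂ p h h₁ h₂ i j)) ((1 + P) * H * 4) := by
  have hfin : IsFiniteMeasure (volume.restrict U) := ⟨by simpa using hUv.lt_top⟩
  have hmU : ∀ {q : E d → Prop}, (∀ x ∈ D, q x) → ∀ᵐ x ∂(volume.restrict U), q x := fun hq =>
    (ae_restrict_mem hU.measurableSet).mono fun x hx => hq x (hUD hx)
  have hp1' : ∀ x ∈ D, |p x| ≤ 1 := fun x hx => by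
    rw [abs_of_nonneg (hpos x hx)]
    exact hp1 x hx
  have hpd : ∀ i, ContDiffOn ℝ 1 (fun x => fderiv ℝ p x (basisVec i)) D := fun i =>
    (hp.fderiv_of_isOpen hD (m := 1) (by norm_num)).clm_apply contDiffOn_const
  -- A nonnegative function has a local minimum at each zero in the open set D, so its gradient
  -- vanishes there too. The partial derivatives of p are therefore admissible cutoff factors, and
  -- the derivative can be taken a second time.
  have hpd0 : ∀ i, ∀ x ∈ D, x ∉ U → fderiv ℝ p x (basisVec i) = 0 := fun i x hx hxU => by
    have hmin : IsLocalMin p x := by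
      filter_upwards [hD.mem_nhds hx] with y hy
      rw [hp0 x hx hxU]
      exact hpos y hy
    rw [hmin.fderiv_eq_zero]
    rfl
  have mp := aestronglyMeasurable_of_contDiffOn hD hUD hp.continuousOn
  have mpi : ∀ i, AEStronglyMeasurable (fun x => fderiv ℝ p x (basisVec i)) (volume.restrict U) :=
    fun i => aestronglyMeasurable_of_contDiffOn hD hUD (hpd i).continuousOn
  have mpij : ∀ i j, AEStronglyMeasurable
      (fun x => fderiv ℝ (fun y => fderiv ℝ p y (basisVec i)) x (basisVec j))
      (volume.restrict U) := fun i j =>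
    (measurable_pd _ (basisVec j)).aestronglyMeasurable
  have i0 := lh.memLp.integrable one_le_two
  have i1 := fun i => (lh₁ i).memLp.integrable one_le_two
  have i2 := fun i j => (lh₂ i j).memLp.integrable one_le_two
  have w1 : ∀ i, WeakPD D i (U.indicator fun x => p x * h x) (U.indicator (cut₁ p h h₁ i)) :=
    fun i => WeakPD.cutoff hD hU hUD (hp.of_le (by norm_num)) hp0 (B := 1 + P)
      (fun x hx => (hp1' x hx).trans (by linarith)) (fun x hx => (hP x hx i).trans (by linarith))
      (wh i) i0 (i1 i)
  have t0 : LpLe 2 (volume.restrict U) (fun x => p x * h x) (1 * H) :=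
    lh.bdd_mul mp zero_le_one (hmU hp1')
  have t1 : ∀ i, LpLe 2 (volume.restrict U) (cut₁ p h h₁ i) (P * H + 1 * H) := fun i =>
    (lh.bdd_mul (mpi i) hP0 (hmU fun x hx => hP x hx i)).add
      ((lh₁ i).bdd_mul mp zero_le_one (hmU hp1')) one_le_two (by positivity) (by positivity)
  have t2 : ∀ i j, LpLe 2 (volume.restrict U) (cut₂ p h h₁ h₂ i j)
      ((P * H + P * H) + (P * H + 1 * H)) := fun i j =>
    ((lh.bdd_mul (mpij i j) hP0 (hmU fun x hx => hP' x hx i j)).add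
      ((lh₁ j).bdd_mul (mpi i) hP0 (hmU fun x hx => hP x hx i)) one_le_two (by positivity)
      (by positivity)).add
      (((lh₁ i).bdd_mul (mpi j) hP0 (hmU fun x hx => hP x hx j)).add
      ((lh₂ i j).bdd_mul mp zero_le_one (hmU hp1')) one_le_two (by positivity) (by positivity))
      one_le_two (by positivity) (by positivity)
  have hPH : 0 ≤ P * H := by positivity
  refine ⟨⟨w1, fun i j => ?_⟩, (t0.mono (by linarith)).indicator hU.measurableSet,
    fun i => ((t1 i).mono (by linarith)).indicator hU.measurableSet,
    fun i j => ((t2 i j).mono (by linarith)).indicator hU.measurableSet⟩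
  have a1 := WeakPD.cutoff hD hU hUD (hpd i) (hpd0 i) (fun x hx => hP x hx i)
    (fun x hx => hP' x hx i j) (wh j) i0 (i1 j)
  have a2 := WeakPD.cutoff hD hU hUD (hp.of_le (by norm_num)) hp0 (B := 1 + P)
    (fun x hx => (hp1' x hx).trans (by linarith)) (fun x hx => (hP x hx j).trans (by linarith))
    (wh₁ i j) (i1 i) (i2 i j)
  refine (a1.add a2).congr_ae (Eventually.of_forall fun x => ?_) (Eventually.of_forall fun x => ?_)
  · by_cases hx : x ∈ U
    · simp only [indicator_of_mem hx, cut₁]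
    · simp only [indicator_of_notMem hx, add_zero]
  · by_cases hx : x ∈ U
    · simp only [indicator_of_mem hx, cut₂]
    · simp only [indicator_of_notMem hx, add_zero]

end Composite

end Peridynamics

namespace Peridynamics

/-! ### Strain along a fixed bond -/

section Strain

variable {d : ℕ} {D : Set (E d)}

/-- The strain along the bond `ε ξ`. -/
noncomputable def bondStrain (ε : ℝ) (w : E d → E d) (ξ x : E d) : ℝ :=
  (ε * ‖ξ‖)⁻¹ * inner ℝ (‖ξ‖⁻¹ • ξ) (w (x + ε • ξ) - w x)

/-- The points of `D` that the bond `ε ξ` does not join to the boundary. -/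
def bondDomain (D : Set (E d)) (ε : ℝ) (ξ : E d) : Set (E d) :=
  {x | x ∈ D ∧ x + ε • ξ ∉ frontier D}

lemma bondDomain_subset (D : Set (E d)) (ε : ℝ) (ξ : E d) : bondDomain D ε ξ ⊆ D :=
  fun _ hx => hx.1

lemma isOpen_bondDomain (hD : IsOpen D) (ε : ℝ) (ξ : E d) : IsOpen (bondDomain D ε ξ) :=
  hD.inter (isClosed_frontier.isOpen_compl.preimage (continuous_add_const (ε • ξ)))

lemma norm_normalize_le_one (ξ : E d) : ‖‖ξ‖⁻¹ • ξ‖ ≤ 1 := by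
  rw [norm_smul, norm_inv, norm_norm]
  exact inv_mul_le_one

lemma abs_bondStrain_le {ε : ℝ} (hε : 0 < ε) (w : E d → E d) (ξ x : E d) :
    |bondStrain ε w ξ x| ≤ (ε * ‖ξ‖)⁻¹ * ‖w (x + ε • ξ) - w x‖ := by
  rw [bondStrain, abs_mul, abs_of_nonneg (by positivity)]
  gcongr
  refine (abs_real_inner_le_norm _ _).trans ?_
  exact mul_le_of_le_one_left (norm_nonneg _) (norm_normalize_le_one ξ)

lemma LpLe.comp_add_right {F : Type*} [NormedAddCommGroup F] {p : ENNReal} {w : E d → F} {N : ℝ}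
    (hw : LpLe p volume w N) (z : E d) : LpLe p volume (fun x => w (x + z)) N := by
  have hm := measurePreserving_add_right (volume : Measure (E d)) z
  refine ⟨hw.1.comp_measurePreserving hm, ?_⟩
  have := eLpNorm_comp_measurePreserving (p := p) hw.1 hm
  exact (le_of_eq this).trans hw.2

lemma aestronglyMeasurable_bondStrain (ε : ℝ) {w : E d → E d} (hw : StronglyMeasurable w)
    (ξ : E d) : AEStronglyMeasurable (bondStrain ε w ξ) := by
  have h1 : StronglyMeasurable fun x => w (x + ε • ξ) :=
    hw.comp_measurable (measurable_add_const _)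
  exact ((stronglyMeasurable_const.inner (h1.sub hw)).const_mul _).aestronglyMeasurable

lemma LpLe.bondStrain {p : ENNReal} (hp : 1 ≤ p) {ε : ℝ} (hε : 0 < ε) {w : E d → E d} {N : ℝ}
    (hN : 0 ≤ N) (hm : StronglyMeasurable w) (hw : LpLe p volume w N) (ξ : E d) :
    LpLe p volume (bondStrain ε w ξ) ((ε * ‖ξ‖)⁻¹ * (2 * N)) := by
  have h1 := (hw.comp_add_right (ε • ξ)).sub hw hp hN hN
  rw [← two_mul] at h1
  exact h1.of_le_mul (aestronglyMeasurable_bondStrain ε hm ξ) (by positivity)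
    (Eventually.of_forall fun x => abs_bondStrain_le hε w ξ x)

/-- The extension by zero is weakly differentiable off ∂D, and at a point x of the bond domain
neither x nor x + εξ lies on ∂D. -/
lemma WeakPD.bondStrain (hD : IsOpen D) {i : Fin d} {w g : E d → E d} (h : WeakPD D i w g)
    (iw : IntegrableOn w D) (ig : IntegrableOn g D) (zw : ∀ x ∉ D, w x = 0)
    (zg : ∀ x ∉ D, g x = 0) (ε : ℝ) (ξ : E d) :
    WeakPD (bondDomain D ε ξ) i (bondStrain ε w ξ) (bondStrain ε g ξ) := by
  have ew : D.indicator w = w := indicator_eq_self.2 fun x hx => by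
    by_contra hxD
    exact hx (zw x hxD)
  have eg : D.indicator g = g := indicator_eq_self.2 fun x hx => by
    by_contra hxD
    exact hx (zg x hxD)
  have h1 := (WeakPD.extend_zero hD h iw ig).translate (ε • ξ)
  rw [ew, eg] at h1
  have h2 : WeakPD (bondDomain D ε ξ) i (fun x => w (x + ε • ξ)) fun x => g (x + ε • ξ) :=
    h1.mono fun x hx => hx.2
  have h3 := h2.sub (h.mono (bondDomain_subset D ε ξ))
  exact (h3.clm_comp (innerSL ℝ (‖ξ‖⁻¹ • ξ))).const_smul (ε * ‖ξ‖)⁻¹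

variable {K : ℝ} {u : E d → E d} {u₁ : Fin d → E d → E d} {u₂ : Fin d → Fin d → E d → E d}

lemma IsRegular.lpLe_four (hu : IsRegular D K u u₁ u₂) (i : Fin d) : LpLe 4 volume (u₁ i) K :=
  ⟨(hu.meas₁ i).aestronglyMeasurable, hu.four i⟩

lemma IsRegular.lpLe_two (hu : IsRegular D K u u₁ u₂) (i j : Fin d) : LpLe 2 volume (u₂ i j) K :=
  ⟨(hu.meas₂ i j).aestronglyMeasurable, hu.two i j⟩

lemma IsRegular.hasSecondWeak (hD : IsOpen D) (hDb : Bornology.IsBounded D) (hK : 0 ≤ K)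
    (hu : IsRegular D K u u₁ u₂) {ε : ℝ} (hε : 0 < ε) (ξ : E d) :
    HasSecondWeak (bondDomain D ε ξ) ((ε * ‖ξ‖)⁻¹ * (2 * K)) (bondStrain ε u ξ)
      (fun i => bondStrain ε (u₁ i) ξ) (fun i j => bondStrain ε (u₂ i j) ξ) := by
  have hfin : IsFiniteMeasure (volume.restrict D) := ⟨by simpa using hDb.measure_lt_top⟩
  have hfin' : IsFiniteMeasure (volume.restrict (bondDomain D ε ξ)) :=
    ⟨by simpa using (hDb.subset (bondDomain_subset D ε ξ)).measure_lt_top⟩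
  have i0 : IntegrableOn u D := Measure.integrableOn_of_bounded hDb.measure_lt_top.ne
    hu.meas.aestronglyMeasurable (ae_restrict_of_ae hu.sup)
  have i1 : ∀ i, IntegrableOn (u₁ i) D := fun i =>
    ((hu.lpLe_four i).restrict D).memLp.integrable (by norm_num)
  have i2 : ∀ i j, IntegrableOn (u₂ i j) D := fun i j =>
    ((hu.lpLe_two i j).restrict D).memLp.integrable (by norm_num)
  have l0 : LpLe ⊤ volume u K := ⟨hu.meas.aestronglyMeasurable, by
    rw [eLpNorm_exponent_top]
    exact eLpNormEssSup_le_of_ae_bound hu.sup⟩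
  refine ⟨?_, fun i => (hu.weak i).bondStrain hD i0 (i1 i) hu.zero (hu.zero₁ i) ε ξ,
    fun i j => (hu.weak₁ i j).bondStrain hD (i1 i) (i2 i j) (hu.zero₁ i) (hu.zero₂ i j) ε ξ,
    fun i => ((hu.lpLe_four i).bondStrain (by norm_num) hε hK (hu.meas₁ i) ξ).restrict _,
    fun i j => ((hu.lpLe_two i j).bondStrain (by norm_num) hε hK (hu.meas₂ i j) ξ).restrict _⟩
  exact ((l0.bondStrain le_top hε hK hu.meas ξ).restrict _).memLp.mono_exponent le_top

lemma HasSecondWeak.const_mul {U : Set (E d)} {A c : ℝ} {a : E d → ℝ} {a₁ : Fin d → E d → ℝ}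
    {a₂ : Fin d → Fin d → E d → ℝ} (h : HasSecondWeak U A a a₁ a₂) (hc : 0 ≤ c) :
    HasSecondWeak U (c * A) (fun x => c * a x) (fun i x => c * a₁ i x)
      (fun i j x => c * a₂ i j x) where
  memLp := h.memLp.const_mul c
  weak i := (h.weak i).const_smul c
  weak₁ i j := (h.weak₁ i j).const_smul c
  four i := (h.four i).bdd_mul aestronglyMeasurable_const hc
    (Eventually.of_forall fun _ => (abs_of_nonneg hc).le)
  two i j := (h.two i j).bdd_mul aestronglyMeasurable_const hc
    (Eventually.of_forall fun _ => (abs_of_nonneg hc).le)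

/-- The difference quotient loses r^(-1) and Hölder continuity regains r^(1/4), where r = ε|ξ|. -/
lemma IsRegular.abs_bondStrain_le_rpow (hu : IsRegular D K u u₁ u₂) {ε : ℝ} (hε : 0 < ε)
    (hε1 : ε < 1) {ξ : E d} (hξ : ξ ∈ Metric.ball (0 : E d) 1) (hξ0 : ξ ≠ 0) :
    ∀ᵐ x, |bondStrain ε u ξ x| ≤ K * (ε * ‖ξ‖) ^ (-(3 / 4) : ℝ) := by
  have hn : 0 < ‖ξ‖ := norm_pos_iff.2 hξ0
  have hr : 0 < ε * ‖ξ‖ := by positivity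
  have hz : ‖ε • ξ‖ = ε * ‖ξ‖ := by rw [norm_smul, Real.norm_of_nonneg hε.le]
  have h1 : ‖ξ‖ < 1 := by simpa using hξ
  filter_upwards [hu.holder (ε • ξ) (by rw [hz]; nlinarith)] with x hx
  refine (abs_bondStrain_le hε u ξ x).trans ?_
  rw [hz] at hx
  calc (ε * ‖ξ‖)⁻¹ * ‖u (x + ε • ξ) - u x‖ ≤ (ε * ‖ξ‖)⁻¹ * (K * (ε * ‖ξ‖) ^ (1 / 4 : ℝ)) := by
        gcongr
    _ = K * ((ε * ‖ξ‖) ^ (-1 : ℝ) * (ε * ‖ξ‖) ^ (1 / 4 : ℝ)) := by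
        rw [Real.rpow_neg_one]; ring
    _ = _ := by
        rw [← Real.rpow_add hr]
        norm_num

end Strain

/-! ### The H² estimate for one bond -/

section Kernel

variable {d : ℕ} {D : Set (E d)}

/-- The contribution of the bond `ε ξ` to `Q`, up to a factor depending on `ξ` only. -/
noncomputable def kern (D : Set (E d)) (F : ℝ → ℝ) (om : E d → ℝ) (ε : ℝ) (u v : E d → E d)
    (ξ : E d) : E d → ℝ :=
  (bondDomain D ε ξ).indicator fun x => omegaBar om ε ξ x *
    (F (√(ε * ‖ξ‖) * bondStrain ε u ξ x) * bondStrain ε v ξ x)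

/-- The first derivatives of `kern`. -/
noncomputable def kern₁ (D : Set (E d)) (F : ℝ → ℝ) (om : E d → ℝ) (ε : ℝ) (u v : E d → E d)
    (u₁ v₁ : Fin d → E d → E d) (i : Fin d) (ξ : E d) : E d → ℝ :=
  (bondDomain D ε ξ).indicator (cut₁ (omegaBar om ε ξ)
    (fun x => F (√(ε * ‖ξ‖) * bondStrain ε u ξ x) * bondStrain ε v ξ x)
    (bond₁ F (fun x => √(ε * ‖ξ‖) * bondStrain ε u ξ x) (bondStrain ε v ξ)
      (fun i x => √(ε * ‖ξ‖) * bondStrain ε (u₁ i) ξ x) (fun i => bondStrain ε (v₁ i) ξ)) i)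

/-- The second derivatives of `kern`. -/
noncomputable def kern₂ (D : Set (E d)) (F : ℝ → ℝ) (om : E d → ℝ) (ε : ℝ) (u v : E d → E d)
    (u₁ v₁ : Fin d → E d → E d) (u₂ v₂ : Fin d → Fin d → E d → E d) (i j : Fin d) (ξ : E d) :
    E d → ℝ :=
  (bondDomain D ε ξ).indicator (cut₂ (omegaBar om ε ξ)
    (fun x => F (√(ε * ‖ξ‖) * bondStrain ε u ξ x) * bondStrain ε v ξ x)
    (bond₁ F (fun x => √(ε * ‖ξ‖) * bondStrain ε u ξ x) (bondStrain ε v ξ)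
      (fun i x => √(ε * ‖ξ‖) * bondStrain ε (u₁ i) ξ x) (fun i => bondStrain ε (v₁ i) ξ))
    (bond₂ F (fun x => √(ε * ‖ξ‖) * bondStrain ε u ξ x) (bondStrain ε v ξ)
      (fun i x => √(ε * ‖ξ‖) * bondStrain ε (u₁ i) ξ x) (fun i => bondStrain ε (v₁ i) ξ)
      (fun i j x => √(ε * ‖ξ‖) * bondStrain ε (u₂ i j) ξ x)
      (fun i j => bondStrain ε (v₂ i j) ξ)) i j)

lemma norm_basisVec (i : Fin d) : ‖(basisVec i : E d)‖ = 1 := by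
  rw [basisVec]
  simp

lemma IsBoundaryFunction.abs_fderiv_le {ε C₁ C₂ : ℝ} {om : E d → ℝ}
    (h : IsBoundaryFunction D ε C₁ C₂ om) {ξ : E d} (hξ : ξ ∈ Metric.ball (0 : E d) 1) {x : E d}
    (hx : x ∈ D) (i : Fin d) : |fderiv ℝ (omegaBar om ε ξ) x (basisVec i)| ≤ |C₁| + |C₂| := by
  have h1 := (fderiv ℝ (omegaBar om ε ξ) x).le_opNorm (basisVec i)
  rw [norm_basisVec, mul_one, Real.norm_eq_abs] at h1
  have h2 := h.bound_fst ξ hξ x hx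
  have := le_abs_self C₁
  have := abs_nonneg C₂
  linarith

lemma IsBoundaryFunction.differentiableAt_fderiv (hD : IsOpen D) {ε C₁ C₂ : ℝ} {om : E d → ℝ}
    (h : IsBoundaryFunction D ε C₁ C₂ om) {ξ : E d} (hξ : ξ ∈ Metric.ball (0 : E d) 1) {x : E d}
    (hx : x ∈ D) : DifferentiableAt ℝ (fderiv ℝ (omegaBar om ε ξ)) x :=
  (((h.smooth ξ hξ).fderiv_of_isOpen hD (m := 1) (by norm_num)).differentiableOn
    one_ne_zero).differentiableAt (hD.mem_nhds hx)

lemma IsBoundaryFunction.abs_fderiv_fderiv_le (hD : IsOpen D) {ε C₁ C₂ : ℝ} {om : E d → ℝ}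
    (h : IsBoundaryFunction D ε C₁ C₂ om) {ξ : E d} (hξ : ξ ∈ Metric.ball (0 : E d) 1) {x : E d}
    (hx : x ∈ D) (i j : Fin d) :
    |fderiv ℝ (fun y => fderiv ℝ (omegaBar om ε ξ) y (basisVec i)) x (basisVec j)| ≤
      |C₁| + |C₂| := by
  have hdf := h.differentiableAt_fderiv hD hξ hx
  have h1 : fderiv ℝ (fun y => fderiv ℝ (omegaBar om ε ξ) y (basisVec i)) x (basisVec j) =
      iteratedFDeriv ℝ 2 (omegaBar om ε ξ) x ![basisVec j, basisVec i] := by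
    rw [iteratedFDeriv_two_apply, fderiv_clm_apply hdf (differentiableAt_const _)]
    simp
  have h2 := (iteratedFDeriv ℝ 2 (omegaBar om ε ξ) x).le_opNorm ![basisVec j, basisVec i]
  rw [Fin.prod_univ_two] at h2
  simp only [Matrix.cons_val_zero, Matrix.cons_val_one, norm_basisVec, mul_one,
    Real.norm_eq_abs] at h2
  rw [h1]
  have h3 := h.bound_snd ξ hξ x hx
  have := le_abs_self C₂
  have := abs_nonneg C₁
  linarith

lemma IsBoundaryFunction.omegaBar_nonneg {ε C₁ C₂ : ℝ} {om : E d → ℝ}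
    (h : IsBoundaryFunction D ε C₁ C₂ om) (ξ x : E d) : 0 ≤ omegaBar om ε ξ x :=
  mul_nonneg (h.nonneg _) (h.nonneg _)

lemma IsBoundaryFunction.omegaBar_le {ε C₁ C₂ : ℝ} {om : E d → ℝ}
    (h : IsBoundaryFunction D ε C₁ C₂ om) (ξ x : E d) : omegaBar om ε ξ x ≤ om x :=
  mul_le_of_le_one_right (h.nonneg _) (h.le_one _)

/-- The `H^2` estimate for the contribution of a single bond. -/
theorem kern_weakPD (hD : IsOpen D) (hDb : Bornology.IsBounded D) {F : ℝ → ℝ} {CF V : ℝ}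
    (hF : IsBddC2 F CF) (hV : volume D ≤ ENNReal.ofReal V) (hV1 : 1 ≤ V) {ε C₁ C₂ : ℝ}
    (hε : 0 < ε) (hε1 : ε < 1) {om : E d → ℝ} (hom : IsBoundaryFunction D ε C₁ C₂ om)
    {Ku Kv : ℝ} (hKu : 0 ≤ Ku) (hKv : 0 ≤ Kv) {u v : E d → E d} {u₁ v₁ : Fin d → E d → E d}
    {u₂ v₂ : Fin d → Fin d → E d → E d} (hu : IsRegular D Ku u u₁ u₂)
    (hv : IsRegular D Kv v v₁ v₂) {ξ : E d} (hξ : ξ ∈ Metric.ball (0 : E d) 1) (hξ0 : ξ ≠ 0)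
    {Z : ℝ} (hZ : Z = (1 + (|C₁| + |C₂|)) *
      (10 * CF * V * (1 + Ku + Ku ^ 2) * Kv * (ε * ‖ξ‖) ^ (-(7 / 4) : ℝ)) * 4) :
    ((∀ i, WeakPD D i (kern D F om ε u v ξ) (kern₁ D F om ε u v u₁ v₁ i ξ)) ∧
      ∀ i j, WeakPD D j (kern₁ D F om ε u v u₁ v₁ i ξ) (kern₂ D F om ε u v u₁ v₁ u₂ v₂ i j ξ)) ∧
    LpLe 2 volume (kern D F om ε u v ξ) Z ∧
    (∀ i, LpLe 2 volume (kern₁ D F om ε u v u₁ v₁ i ξ) Z) ∧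
    ∀ i j, LpLe 2 volume (kern₂ D F om ε u v u₁ v₁ u₂ v₂ i j ξ) Z := by
  have hn : 0 < ‖ξ‖ := norm_pos_iff.2 hξ0
  have hn1 : ‖ξ‖ < 1 := by simpa using hξ
  set r := ε * ‖ξ‖ with hr
  have hr0 : 0 < r := by positivity
  have hr1 : r ≤ 1 := by nlinarith
  -- In terms of t ≥ 1 every power of r that occurs is a natural power: t² for the derivatives of √r
  -- S_ξu, t⁴ for those of S_ξv, t³ for the sup bound of S_ξv. The largest exponent, 2 + 2 + 3 = 7,
  -- comes from F''(a) a_i a_j b.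
  set t := r ^ (-(1 / 4) : ℝ) with ht
  have ht1 : 1 ≤ t := Real.one_le_rpow_of_pos_of_le_one_of_nonpos hr0 hr1 (by norm_num)
  have ht0 : 0 ≤ t := by linarith
  have e7 : r ^ (-(7 / 4) : ℝ) = t ^ 7 := by
    rw [ht, ← Real.rpow_natCast, ← Real.rpow_mul hr0.le]; norm_num
  have e3 : r ^ (-(3 / 4) : ℝ) = t ^ 3 := by
    rw [ht, ← Real.rpow_natCast, ← Real.rpow_mul hr0.le]; norm_num
  have e4 : r⁻¹ = t ^ 4 := by
    rw [ht, ← Real.rpow_natCast, ← Real.rpow_mul hr0.le, ← Real.rpow_neg_one]; norm_num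
  have e2 : √r * r⁻¹ = t ^ 2 := by
    rw [ht, ← Real.rpow_natCast, ← Real.rpow_mul hr0.le, ← Real.rpow_neg_one, Real.sqrt_eq_rpow,
      ← Real.rpow_add hr0]
    norm_num
  have hCF : 0 ≤ CF := (abs_nonneg _).trans (hF.bd 0)
  have hV0 : 0 ≤ V := zero_le_one.trans hV1
  set Uξ := bondDomain D ε ξ with hUξ
  have hU : IsOpen Uξ := isOpen_bondDomain hD ε ξ
  have hUD : Uξ ⊆ D := bondDomain_subset D ε ξ
  have hUV : volume Uξ ≤ ENNReal.ofReal V := (measure_mono hUD).trans hV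
  have ha := (hu.hasSecondWeak hD hDb hKu hε ξ).const_mul (Real.sqrt_nonneg r)
  have hb := hv.hasSecondWeak hD hDb hKv hε ξ
  rw [← hr, ← mul_assoc, e2] at ha
  rw [← hr, e4] at hb
  have hbb := ae_restrict_of_ae (s := Uξ) (hv.abs_bondStrain_le_rpow hε hε1 hξ hξ0)
  rw [← hr, e3] at hbb
  obtain ⟨⟨w1, w2⟩, l0, l1, l2⟩ := ha.bond hU hb hF hbb hUV hV1 (by positivity) (by positivity)
    (by positivity)
  -- The 10 covers the coefficients of the second derivatives: 4Ku² t⁷, 2Ku t⁵, 8Ku t⁶ and 2t⁴,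
  -- hence 2 + 8 in front of Ku.
  set H := 10 * CF * V * (1 + Ku + Ku ^ 2) * Kv * t ^ 7 with hH
  have hpow : ∀ k, k ≤ 7 → t ^ k ≤ t ^ 7 := fun k hk => pow_le_pow_right₀ ht1 hk
  have hmon : ∀ (k : ℕ) (q n w : ℝ), k ≤ 7 → 0 ≤ q → q ≤ 1 + Ku + Ku ^ 2 → 0 ≤ n → 0 ≤ w → w ≤ V →
      n * (CF * w * q * Kv * t ^ k) ≤ n * (CF * V * (1 + Ku + Ku ^ 2) * Kv * t ^ 7) := by
    intro k q n w hk hq0 hq hn hw0 hw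
    have := hpow k hk
    gcongr
  have hu2 : 0 ≤ Ku ^ 2 := sq_nonneg _
  have hX : 0 ≤ CF * V * (1 + Ku + Ku ^ 2) * Kv * t ^ 7 := by positivity
  have b0 : CF * (Kv * t ^ 3 * V) ≤ H := by
    have := hmon 3 1 1 V (by norm_num) zero_le_one (by linarith) zero_le_one hV0 le_rfl
    rw [hH]; linarith
  have b1 : CF * (Kv * t ^ 3 * (t ^ 2 * (2 * Ku) * V)) + CF * (t ^ 4 * (2 * Kv) * V) ≤ H := by
    have h1 := hmon 5 Ku 2 V (by norm_num) hKu (by linarith) zero_le_two hV0 le_rfl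
    have h2 := hmon 4 1 2 V (by norm_num) zero_le_one (by linarith) zero_le_two hV0 le_rfl
    have h3 : CF * (Kv * t ^ 3 * (t ^ 2 * (2 * Ku) * V)) = 2 * (CF * V * Ku * Kv * t ^ 5) := by ring
    have h4 : CF * (t ^ 4 * (2 * Kv) * V) = 2 * (CF * V * 1 * Kv * t ^ 4) := by ring
    rw [hH]; linarith
  have b2 : (CF * (t ^ 2 * (2 * Ku) * (t ^ 2 * (2 * Ku)) * (Kv * t ^ 3))
      + CF * (Kv * t ^ 3 * (t ^ 2 * (2 * Ku)) + t ^ 2 * (2 * Ku) * (t ^ 4 * (2 * Kv))))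
      + (CF * (t ^ 2 * (2 * Ku) * (t ^ 4 * (2 * Kv))) + CF * (t ^ 4 * (2 * Kv))) ≤ H := by
    have h1 : CF * 1 * (4 * Ku ^ 2) * Kv * t ^ 7 ≤ CF * V * (4 * Ku ^ 2) * Kv * t ^ 7 := by gcongr
    have h2 : CF * 1 * (2 * Ku) * Kv * t ^ 5 ≤ CF * V * (2 * Ku) * Kv * t ^ 7 := by
      have := hpow 5 (by norm_num)
      gcongr
    have h3 : CF * 1 * (8 * Ku) * Kv * t ^ 6 ≤ CF * V * (8 * Ku) * Kv * t ^ 7 := by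
      have := hpow 6 (by norm_num)
      gcongr
    have h4 : CF * 1 * 2 * Kv * t ^ 4 ≤ CF * V * 2 * Kv * t ^ 7 := by
      have := hpow 4 (by norm_num)
      gcongr
    have h5 : 0 ≤ CF * V * (8 + 6 * Ku ^ 2) * Kv * t ^ 7 := by positivity
    rw [hH]
    linarith
  rw [e7, ← hH] at hZ
  rw [hZ]
  -- A point of D outside the bond domain has x + εξ on ∂D, where `om` vanishes; so `omegaBar`
  -- vanishes exactly where it must.
  exact WeakPD.cutoff_two hD hU hUD (hom.smooth ξ hξ) (fun x _ => hom.omegaBar_nonneg ξ x)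
    (fun x hx hxU => by
      have hxf : x + ε • ξ ∈ frontier D := by
        by_contra hc
        exact hxU ⟨hx, hc⟩
      rw [omegaBar, hom.eq_zero _ hxf, mul_zero]) (by positivity)
    (fun x _ => (hom.omegaBar_le ξ x).trans (hom.le_one x))
    (fun x hx i => hom.abs_fderiv_le hξ hx i)
    (fun x hx i j => hom.abs_fderiv_fderiv_le hD hξ hx i j)
    (hUV.trans_lt ENNReal.ofReal_lt_top).ne (by positivity) w1 w2 (l0.mono b0)
    (fun i => (l1 i).mono b1) (fun i j => (l2 i j).mono b2)

end Kernel

end Peridynamics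

namespace Peridynamics

/-! ### Integration over the bonds -/

section Superposition

variable {α β F : Type*} [MeasurableSpace α] [MeasurableSpace β] [NormedAddCommGroup F]
  {ν : Measure α} {μ : Measure β}

/-- Minkowski's inequality for the integral of a family of `L^2` functions. -/
lemma LpLe.integral [NormedSpace ℝ F] [SFinite ν] [SFinite μ] {G : α → β → F} (hG : AEStronglyMeasurable (Function.uncurry G) (ν.prod μ))
    {w : α → ℝ} (hw : Integrable w ν) (hw0 : ∀ᵐ ξ ∂ν, 0 < w ξ) {B : ℝ} (hB : 0 ≤ B)
    (hle : ∀ᵐ ξ ∂ν, LpLe 2 μ (G ξ) (B * w ξ)) :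
    LpLe 2 μ (fun x => ∫ ξ, G ξ x ∂ν) (B * ∫ ξ, w ξ ∂ν) := by
  have hsw : AEStronglyMeasurable (fun q : β × α => G q.2 q.1) (μ.prod ν) := hG.prod_swap
  refine ⟨hsw.integral_prod_right', ?_⟩
  set W := ∫ ξ, w ξ ∂ν with hW
  have hW0 : 0 ≤ W := integral_nonneg_of_ae (hw0.mono fun _ h => h.le)
  set wE : α → ENNReal := fun ξ => ENNReal.ofReal (w ξ) with wE_def
  have wEm : AEMeasurable wE ν := hw.1.aemeasurable.ennreal_ofReal
  have wEW : ∫⁻ ξ, wE ξ ∂ν = ENNReal.ofReal W :=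
    (ofReal_integral_eq_lintegral_ofReal hw (hw0.mono fun _ h => h.le)).symm
  have hGe : AEMeasurable (fun q : β × α => ‖G q.2 q.1‖ₑ) (μ.prod ν) := hsw.enorm
  have hGx : ∀ᵐ x ∂μ, AEStronglyMeasurable (fun ξ => G ξ x) ν := hsw.prodMk_left
  -- Weighted Cauchy–Schwarz: |∫ G|² ≤ (∫ w) ∫ w⁻¹ |G|². Tonelli then reduces the claim to the L²
  -- bound of each G ξ, and the positivity of w permits the division.
  have hcs : ∀ᵐ x ∂μ, ‖∫ ξ, G ξ x ∂ν‖ₑ ^ (2 : ℝ) ≤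
      ENNReal.ofReal W * ∫⁻ ξ, (wE ξ)⁻¹ * ‖G ξ x‖ₑ ^ (2 : ℝ) ∂ν := by
    filter_upwards [hGx] with x hx
    have h1 : ∫⁻ ξ, ‖G ξ x‖ₑ ∂ν = ∫⁻ ξ, wE ξ ^ (1 / 2 : ℝ) * (wE ξ ^ (-(1 / 2) : ℝ) * ‖G ξ x‖ₑ) ∂ν := by
      refine lintegral_congr_ae ?_
      filter_upwards [hw0] with ξ hξ
      have hp : wE ξ ≠ 0 := by simpa [wE_def] using hξ
      rw [← mul_assoc, ← ENNReal.rpow_add _ _ hp ENNReal.ofReal_ne_top]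
      norm_num
    have h2 := ENNReal.lintegral_mul_le_Lp_mul_Lq ν (p := 2) (q := 2)
      ⟨by norm_num, by norm_num, by norm_num⟩ (wEm.pow_const (1 / 2 : ℝ))
      ((wEm.pow_const (-(1 / 2) : ℝ)).mul hx.enorm)
    simp only [Pi.mul_apply] at h2
    rw [← h1] at h2
    have h3 : ∀ ξ, (wE ξ ^ (1 / 2 : ℝ)) ^ (2 : ℝ) = wE ξ := fun ξ => by
      rw [← ENNReal.rpow_mul]; norm_num
    have h4 : ∀ ξ, (wE ξ ^ (-(1 / 2) : ℝ) * ‖G ξ x‖ₑ) ^ (2 : ℝ) = (wE ξ)⁻¹ * ‖G ξ x‖ₑ ^ (2 : ℝ) :=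
      fun ξ => by
        rw [ENNReal.mul_rpow_of_nonneg _ _ (by norm_num), ← ENNReal.rpow_mul,
          ← ENNReal.rpow_neg_one]
        norm_num
    simp only [h3, h4, wEW] at h2
    have h5 := (enorm_integral_le_lintegral_enorm (μ := ν) fun ξ => G ξ x).trans h2
    refine (ENNReal.rpow_le_rpow h5 zero_le_two).trans (le_of_eq ?_)
    rw [← ENNReal.mul_rpow_of_nonneg _ _ (by norm_num), ← ENNReal.rpow_mul]
    norm_num
  have hG2 : ∀ᵐ ξ ∂ν, ∫⁻ x, (wE ξ)⁻¹ * ‖G ξ x‖ₑ ^ (2 : ℝ) ∂μ ≤ ENNReal.ofReal (B ^ 2) * wE ξ := by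
    filter_upwards [hle, hw0] with ξ hξ hξ0
    have hp : wE ξ ≠ 0 := by simpa [wE_def] using hξ0
    have h1 := hξ.2
    rw [eLpNorm_eq_lintegral_rpow_enorm_toReal (by norm_num) (by norm_num)] at h1
    simp only [ENNReal.toReal_ofNat] at h1
    have h2 := ENNReal.rpow_le_rpow h1 (zero_le_two (α := ℝ))
    rw [← ENNReal.rpow_mul, one_div, inv_mul_cancel₀ two_ne_zero, ENNReal.rpow_one,
      ENNReal.rpow_two, ← ENNReal.ofReal_pow (by positivity), mul_pow,
      ENNReal.ofReal_mul (by positivity), ENNReal.ofReal_pow hξ0.le] at h2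
    rw [lintegral_const_mul'' _ (hξ.1.enorm.pow_const _)]
    calc (wE ξ)⁻¹ * ∫⁻ x, ‖G ξ x‖ₑ ^ (2 : ℝ) ∂μ
        ≤ (wE ξ)⁻¹ * (ENNReal.ofReal (B ^ 2) * wE ξ ^ 2) := by gcongr
      _ = ENNReal.ofReal (B ^ 2) * ((wE ξ)⁻¹ * wE ξ) * wE ξ := by ring
      _ = _ := by rw [ENNReal.inv_mul_cancel hp ENNReal.ofReal_ne_top, mul_one]
  have hmain : ∫⁻ x, ‖∫ ξ, G ξ x ∂ν‖ₑ ^ (2 : ℝ) ∂μ ≤ ENNReal.ofReal ((B * W) ^ 2) := by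
    calc ∫⁻ x, ‖∫ ξ, G ξ x ∂ν‖ₑ ^ (2 : ℝ) ∂μ
        ≤ ∫⁻ x, ENNReal.ofReal W * ∫⁻ ξ, (wE ξ)⁻¹ * ‖G ξ x‖ₑ ^ (2 : ℝ) ∂ν ∂μ :=
          lintegral_mono_ae hcs
      _ = ENNReal.ofReal W * ∫⁻ x, ∫⁻ ξ, (wE ξ)⁻¹ * ‖G ξ x‖ₑ ^ (2 : ℝ) ∂ν ∂μ :=
          lintegral_const_mul' _ _ ENNReal.ofReal_ne_top
      _ = ENNReal.ofReal W * ∫⁻ ξ, ∫⁻ x, (wE ξ)⁻¹ * ‖G ξ x‖ₑ ^ (2 : ℝ) ∂μ ∂ν := by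
          rw [lintegral_lintegral_swap]
          exact (wEm.inv.comp_snd).mul (hGe.pow_const _)
      _ ≤ ENNReal.ofReal W * ∫⁻ ξ, ENNReal.ofReal (B ^ 2) * wE ξ ∂ν := by
          gcongr ENNReal.ofReal W * ?_
          exact lintegral_mono_ae hG2
      _ = _ := by
          rw [lintegral_const_mul' _ _ ENNReal.ofReal_ne_top, wEW,
            ← ENNReal.ofReal_mul (by positivity), ← ENNReal.ofReal_mul hW0]
          congr 1
          ring
  rw [eLpNorm_eq_lintegral_rpow_enorm_toReal (by norm_num) (by norm_num)]
  simp only [ENNReal.toReal_ofNat]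
  refine (ENNReal.rpow_le_rpow hmain (by norm_num)).trans (le_of_eq ?_)
  rw [ENNReal.ofReal_rpow_of_nonneg (by positivity) (by norm_num), ← Real.rpow_natCast,
    ← Real.rpow_mul (by positivity)]
  norm_num

/-- Supplies the hypothesis of Fubini's theorem when a test function is moved inside the integral
over the bonds; on a finite measure space the L² bounds give L¹ bounds with the same weight. -/
lemma integrable_uncurry_of_lpLe [SFinite ν] [IsFiniteMeasure μ] {G : α → β → F}
    (hG : AEStronglyMeasurable (Function.uncurry G) (ν.prod μ))
    {w : α → ℝ} (hw : Integrable w ν) {B : ℝ} (hle : ∀ᵐ ξ ∂ν, LpLe 2 μ (G ξ) (B * w ξ)) :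
    Integrable (Function.uncurry G) (ν.prod μ) := by
  refine ⟨hG, ?_⟩
  rw [HasFiniteIntegral, lintegral_prod _ hG.enorm]
  have h1 : ∀ᵐ ξ ∂ν, ∫⁻ x, ‖Function.uncurry G (ξ, x)‖ₑ ∂μ ≤
      ENNReal.ofReal (B * w ξ) * μ univ ^ (1 / 2 : ℝ) := by
    filter_upwards [hle] with ξ hξ
    have h2 := eLpNorm_le_eLpNorm_mul_rpow_measure_univ (p := 1) (q := 2) one_le_two hξ.1
    rw [eLpNorm_one_eq_lintegral_enorm] at h2
    refine h2.trans ?_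
    rw [show (1 / (1 : ENNReal).toReal - 1 / (2 : ENNReal).toReal) = (1 / 2 : ℝ) by norm_num]
    gcongr
    exact hξ.2
  refine (lintegral_mono_ae h1).trans_lt ?_
  rw [lintegral_mul_const' _ _ (ENNReal.rpow_ne_top_of_nonneg (by norm_num) (measure_ne_top _ _))]
  refine ENNReal.mul_lt_top ?_
    (ENNReal.rpow_lt_top_of_nonneg (by norm_num) (measure_ne_top _ _))
  exact (hw.const_mul B).lintegral_lt_top

/-- The integral over a parameter of weakly differentiable functions is weakly differentiable. -/
theorem WeakPD.integral [NormedSpace ℝ F] [SFinite ν] {d : ℕ} {D : Set (E d)} {i : Fin d} [CompleteSpace F]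
    {G G' : α → E d → F}
    (hG : Integrable (Function.uncurry G) (ν.prod (volume.restrict D)))
    (hG' : Integrable (Function.uncurry G') (ν.prod (volume.restrict D)))
    (h : ∀ᵐ ξ ∂ν, WeakPD D i (G ξ) (G' ξ)) :
    WeakPD D i (fun x => ∫ ξ, G ξ x ∂ν) fun x => ∫ ξ, G' ξ x ∂ν := by
  have hswap : ∀ {H : α → E d → F} {ψ : E d → ℝ}, Continuous ψ → HasCompactSupport ψ →
      Integrable (Function.uncurry H) (ν.prod (volume.restrict D)) →
      ∫ x in D, ψ x • ∫ ξ, H ξ x ∂ν = ∫ ξ, (∫ x in D, ψ x • H ξ x) ∂ν := by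
    intro H ψ hψ hc hH
    obtain ⟨B, -, hB⟩ := exists_bound_of_hasCompactSupport hψ hc
    simp only [← integral_smul]
    refine (integral_integral_swap (f := fun ξ x => ψ x • H ξ x) ?_).symm
    exact hH.bdd_smul (φ := fun q : α × E d => ψ q.2) B
      (hψ.comp_aestronglyMeasurable measurable_snd.aestronglyMeasurable)
      (Eventually.of_forall fun q => hB q.2)
  refine ⟨locallyIntegrableOn_of_integrable hG.integral_prod_right,
    locallyIntegrableOn_of_integrable hG'.integral_prod_right, fun φ hφ hc hs => ?_⟩
  rw [hswap (continuous_pd (hφ.of_le (by exact_mod_cast le_top)) _) (hasCompactSupport_pd hc _) hG,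
    hswap hφ.continuous hc hG', ← integral_neg]
  refine integral_congr_ae ?_
  filter_upwards [h] with ξ hξ
  exact hξ.2.2 φ hφ hc hs

end Superposition

/-! ### Joint measurability in bond and point -/

section Measurability

variable {d : ℕ} {D : Set (E d)}

lemma measurable_bondStrain (ε : ℝ) {w : E d → E d} (hw : StronglyMeasurable w) :
    Measurable fun q : E d × E d => bondStrain ε w q.1 q.2 := by
  have h1 : Measurable fun q : E d × E d => w (q.2 + ε • q.1) :=
    hw.measurable.comp (by fun_prop)
  have h2 : Measurable fun q : E d × E d => w q.2 := hw.measurable.comp measurable_snd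
  have h3 : Measurable fun q : E d × E d => ‖q.1‖⁻¹ • q.1 := by fun_prop
  exact (Measurable.inv (by fun_prop)).mul (h3.inner (h1.sub h2))

lemma measurableSet_bondDomain (hD : IsOpen D) (ε : ℝ) :
    MeasurableSet {q : E d × E d | q.2 ∈ bondDomain D ε q.1} := by
  have h1 : IsOpen {q : E d × E d | q.2 ∈ D} := hD.preimage continuous_snd
  have h2 : IsOpen {q : E d × E d | q.2 + ε • q.1 ∉ frontier D} :=
    isClosed_frontier.isOpen_compl.preimage (by fun_prop)
  exact (h1.inter h2).measurableSet

lemma measurable_fderiv_omegaBar {om : E d → ℝ} (hom : Continuous om) (ε : ℝ) (i : Fin d) :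
    Measurable fun q : E d × E d => fderiv ℝ (omegaBar om ε q.1) q.2 (basisVec i) := by
  have h1 : Continuous (Function.uncurry fun ξ x : E d => omegaBar om ε ξ x) := by
    unfold omegaBar Function.uncurry
    fun_prop
  have h2 := measurable_fderiv_with_param ℝ h1
  exact (ContinuousLinearMap.apply ℝ ℝ (basisVec i : E d)).continuous.measurable.comp h2

/-- Smoothness is given in x for each fixed ξ only, so the first derivative is known to be jointly
measurable but not jointly continuous. Its derivative is therefore obtained as a pointwise limit of
difference quotients, restricted to the set where it exists. -/
lemma exists_measurable_fderiv_fderiv (hD : IsOpen D) {ε C₁ C₂ : ℝ} {om : E d → ℝ}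
    (hom : IsBoundaryFunction D ε C₁ C₂ om) (i j : Fin d) :
    ∃ P : E d × E d → ℝ, Measurable P ∧ ∀ ξ ∈ Metric.ball (0 : E d) 1, ∀ x ∈ D,
      fderiv ℝ (fun y => fderiv ℝ (omegaBar om ε ξ) y (basisVec i)) x (basisVec j) = P (ξ, x) := by
  set S : Set (E d × E d) := Metric.ball (0 : E d) 1 ×ˢ D with hS
  have hSm : MeasurableSet S := measurableSet_ball.prod hD.measurableSet
  set p : E d → E d → ℝ := fun ξ y => fderiv ℝ (omegaBar om ε ξ) y (basisVec i) with hp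
  have hpm : Measurable fun q : E d × E d => p q.1 q.2 := measurable_fderiv_omegaBar hom.cont ε i
  set P : E d × E d → ℝ := S.indicator fun q => fderiv ℝ (p q.1) q.2 (basisVec j) with hP
  refine ⟨P, ?_, fun ξ hξ x hx => by rw [hP, indicator_of_mem (show (ξ, x) ∈ S from ⟨hξ, hx⟩)]⟩
  have hm : ∀ n : ℕ, Measurable (S.indicator fun q : E d × E d =>
      ((n : ℝ) + 1) * (p q.1 (q.2 + (1 / ((n : ℝ) + 1)) • basisVec j) - p q.1 q.2)) := fun n => by
    refine Measurable.indicator (Measurable.const_mul (Measurable.sub ?_ hpm) _) hSm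
    exact hpm.comp (g := fun q : E d × E d => p q.1 q.2)
      (f := fun q : E d × E d => (q.1, q.2 + (1 / ((n : ℝ) + 1)) • basisVec j)) (by fun_prop)
  refine measurable_of_tendsto_metrizable hm (tendsto_pi_nhds.2 fun q => ?_)
  by_cases hq : q ∈ S
  · simp only [hP, indicator_of_mem hq]
    have hdf : DifferentiableAt ℝ (p q.1) q.2 :=
      (hom.differentiableAt_fderiv hD hq.1 hq.2).clm_apply (differentiableAt_const _)
    have h1 := (hdf.hasFDerivAt.lim_real (basisVec j)).comp
      (tendsto_atTop_add_const_right atTop (1 : ℝ) tendsto_natCast_atTop_atTop)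
    simpa only [Function.comp_def, one_div, smul_eq_mul] using h1
  · simp only [hP, indicator_of_notMem hq]
    exact tendsto_const_nhds

end Measurability

end Peridynamics

namespace Peridynamics

/-! ### The weighted bond fields and their superposition -/

section VectorKernel

variable {d : ℕ} {D : Set (E d)}

/-- The vector field obtained from a scalar kernel by weighting with the influence function and
the direction of the bond. -/
noncomputable def bondField (J : ℝ → ℝ) (ε : ℝ) (k : E d → E d → ℝ) (ξ x : E d) : E d :=
  (J ‖ξ‖ / ε * k ξ x) • (‖ξ‖⁻¹ • ξ)

lemma aestronglyMeasurable_bondField {J : ℝ → ℝ} (hJ : Measurable J) (ε : ℝ)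
    {k : E d → E d → ℝ} {k' : E d × E d → ℝ} (hk' : Measurable k')
    (hk : ∀ ξ ∈ Metric.ball (0 : E d) 1, ∀ x, k ξ x = k' (ξ, x)) (μ : Measure (E d)) [SFinite μ] :
    AEStronglyMeasurable (Function.uncurry (bondField J ε k))
      ((volume.restrict (Metric.ball (0 : E d) 1)).prod μ) := by
  have h1 : Measurable fun q : E d × E d => (J ‖q.1‖ / ε * k' q) • (‖q.1‖⁻¹ • q.1) := by
    have h2 : Measurable fun q : E d × E d => J ‖q.1‖ := hJ.comp (by fun_prop)
    exact ((h2.div_const ε).mul hk').smul (by fun_prop)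
  refine h1.aestronglyMeasurable.congr ?_
  have h3 : ∀ᵐ q ∂((volume.restrict (Metric.ball (0 : E d) 1)).prod μ),
      q.1 ∈ Metric.ball (0 : E d) 1 :=
    Measure.quasiMeasurePreserving_fst.ae (ae_restrict_mem measurableSet_ball)
  filter_upwards [h3] with q hq
  simp only [Function.uncurry, bondField, hk q.1 hq]

lemma LpLe.bondField {J : ℝ → ℝ} {M : ℝ} (hJ : IsInfluenceFunction J M) {ε : ℝ} (hε : 0 < ε)
    {k : E d → E d → ℝ} {ξ : E d} (hξ : ξ ∈ Metric.ball (0 : E d) 1) {μ : Measure (E d)} {N : ℝ}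
    (hk : LpLe 2 μ (k ξ) N) : LpLe 2 μ (bondField J ε k ξ) (M / ε * N) := by
  have h1 : ‖ξ‖ < 1 := by simpa using hξ
  have hJ0 := hJ.nonneg _ (norm_nonneg ξ) h1
  have hJM := hJ.le _ (norm_nonneg ξ) h1
  have hM : 0 ≤ M := hJ0.trans hJM
  refine hk.of_le_mul ((aestronglyMeasurable_const.mul hk.1).smul aestronglyMeasurable_const)
    (by positivity) (Eventually.of_forall fun x => ?_)
  rw [Peridynamics.bondField, norm_smul, norm_mul, Real.norm_of_nonneg (by positivity)]
  calc J ‖ξ‖ / ε * ‖k ξ x‖ * ‖‖ξ‖⁻¹ • ξ‖ ≤ M / ε * ‖k ξ x‖ * 1 := by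
        gcongr
        exact norm_normalize_le_one ξ
    _ = _ := mul_one _

lemma WeakPD.bondField {J : ℝ → ℝ} {ε : ℝ} {k k' : E d → E d → ℝ} {ξ : E d} {i : Fin d}
    (h : WeakPD D i (k ξ) (k' ξ)) : WeakPD D i (bondField J ε k ξ) (bondField J ε k' ξ) :=
  (h.const_smul (J ‖ξ‖ / ε)).clm_comp (ContinuousLinearMap.toSpanSingleton ℝ (‖ξ‖⁻¹ • ξ))

lemma measurable_bondIntegrand {F : ℝ → ℝ} (hF : Measurable F) (ε : ℝ) {u v : E d → E d}
    (hu : StronglyMeasurable u) (hv : StronglyMeasurable v) :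
    Measurable fun q : E d × E d =>
      F (√(ε * ‖q.1‖) * bondStrain ε u q.1 q.2) * bondStrain ε v q.1 q.2 := by
  have h1 : Measurable fun q : E d × E d => √(ε * ‖q.1‖) * bondStrain ε u q.1 q.2 :=
    Measurable.mul (by fun_prop) (measurable_bondStrain ε hu)
  exact (hF.comp h1).mul (measurable_bondStrain ε hv)

lemma measurable_omegaBar {om : E d → ℝ} (hom : Continuous om) (ε : ℝ) :
    Measurable fun q : E d × E d => omegaBar om ε q.1 q.2 := by
  unfold omegaBar
  exact Continuous.measurable (by fun_prop)

variable {F : ℝ → ℝ} {CF V ε C₁ C₂ Ku Kv : ℝ} {om : E d → ℝ} {u v : E d → E d}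
  {u₁ v₁ : Fin d → E d → E d} {u₂ v₂ : Fin d → Fin d → E d → E d}

lemma exists_measurable_kern (hD : IsOpen D) (hF : IsBddC2 F CF) (hom : Continuous om)
    (hu : IsRegular D Ku u u₁ u₂) (hv : IsRegular D Kv v v₁ v₂) :
    ∃ k' : E d × E d → ℝ, Measurable k' ∧ ∀ ξ x, kern D F om ε u v ξ x = k' (ξ, x) := by
  refine ⟨{q : E d × E d | q.2 ∈ bondDomain D ε q.1}.indicator fun q => omegaBar om ε q.1 q.2 *
    (F (√(ε * ‖q.1‖) * bondStrain ε u q.1 q.2) * bondStrain ε v q.1 q.2),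
    Measurable.indicator ?_ (measurableSet_bondDomain hD ε), fun ξ x => rfl⟩
  exact (measurable_omegaBar hom ε).mul
    (measurable_bondIntegrand hF.contDiff.continuous.measurable ε hu.meas hv.meas)

lemma measurable_scaled_bondStrain (ε : ℝ) {w : E d → E d} (hw : StronglyMeasurable w) :
    Measurable fun q : E d × E d => √(ε * ‖q.1‖) * bondStrain ε w q.1 q.2 :=
  Measurable.mul (by fun_prop) (measurable_bondStrain ε hw)

lemma measurable_bond₁ (hF : IsBddC2 F CF) (hu : IsRegular D Ku u u₁ u₂)
    (hv : IsRegular D Kv v v₁ v₂) (i : Fin d) :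
    Measurable fun q : E d × E d =>
      bond₁ F (fun x => √(ε * ‖q.1‖) * bondStrain ε u q.1 x) (bondStrain ε v q.1)
      (fun i x => √(ε * ‖q.1‖) * bondStrain ε (u₁ i) q.1 x) (fun i => bondStrain ε (v₁ i) q.1) i
        q.2 := by
  have hFm := hF.contDiff.continuous.measurable
  have a0 := measurable_scaled_bondStrain ε hu.meas
  have a1 := fun i => measurable_scaled_bondStrain ε (hu.meas₁ i)
  have b0 := measurable_bondStrain ε hv.meas
  have b1 := fun i => measurable_bondStrain ε (hv.meas₁ i)
  exact (((measurable_deriv F).comp a0).mul ((a1 i).mul b0)).add ((hFm.comp a0).mul (b1 i))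

lemma measurable_bond₂ (hF : IsBddC2 F CF) (hu : IsRegular D Ku u u₁ u₂)
    (hv : IsRegular D Kv v v₁ v₂) (i j : Fin d) :
    Measurable fun q : E d × E d =>
      bond₂ F (fun x => √(ε * ‖q.1‖) * bondStrain ε u q.1 x) (bondStrain ε v q.1)
      (fun i x => √(ε * ‖q.1‖) * bondStrain ε (u₁ i) q.1 x) (fun i => bondStrain ε (v₁ i) q.1)
      (fun i j x => √(ε * ‖q.1‖) * bondStrain ε (u₂ i j) q.1 x)
      (fun i j => bondStrain ε (v₂ i j) q.1) i j q.2 := by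
  have hFm := hF.contDiff.continuous.measurable
  have a0 := measurable_scaled_bondStrain ε hu.meas
  have a1 := fun i => measurable_scaled_bondStrain ε (hu.meas₁ i)
  have a2 := fun i j => measurable_scaled_bondStrain ε (hu.meas₂ i j)
  have b0 := measurable_bondStrain ε hv.meas
  have b1 := fun i => measurable_bondStrain ε (hv.meas₁ i)
  have b2 := fun i j => measurable_bondStrain ε (hv.meas₂ i j)
  have d1 := (measurable_deriv F).comp a0
  have d2 := (measurable_deriv (deriv F)).comp a0
  exact (((d2.mul (a1 j)).mul ((a1 i).mul b0)).add
    (d1.mul (((a2 i j).mul b0).add ((a1 i).mul (b1 j))))).add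
    (((d1.mul (a1 j)).mul (b1 i)).add ((hFm.comp a0).mul (b2 i j)))

lemma exists_measurable_kern₁ (hD : IsOpen D) (hF : IsBddC2 F CF) (hom : Continuous om)
    (hu : IsRegular D Ku u u₁ u₂) (hv : IsRegular D Kv v v₁ v₂) (i : Fin d) :
    ∃ k' : E d × E d → ℝ, Measurable k' ∧
      ∀ ξ x, kern₁ D F om ε u v u₁ v₁ i ξ x = k' (ξ, x) := by
  refine ⟨{q : E d × E d | q.2 ∈ bondDomain D ε q.1}.indicator fun q =>
    fderiv ℝ (omegaBar om ε q.1) q.2 (basisVec i) *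
      (F (√(ε * ‖q.1‖) * bondStrain ε u q.1 q.2) * bondStrain ε v q.1 q.2) +
    omegaBar om ε q.1 q.2 *
      bond₁ F (fun x => √(ε * ‖q.1‖) * bondStrain ε u q.1 x) (bondStrain ε v q.1)
      (fun i x => √(ε * ‖q.1‖) * bondStrain ε (u₁ i) q.1 x) (fun i => bondStrain ε (v₁ i) q.1) i
        q.2,
    Measurable.indicator ?_ (measurableSet_bondDomain hD ε), fun ξ x => rfl⟩
  exact ((measurable_fderiv_omegaBar hom ε i).mul
    (measurable_bondIntegrand hF.contDiff.continuous.measurable ε hu.meas hv.meas)).add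
    ((measurable_omegaBar hom ε).mul (measurable_bond₁ hF hu hv i))

lemma exists_measurable_kern₂ (hD : IsOpen D) (hF : IsBddC2 F CF)
    (hom : IsBoundaryFunction D ε C₁ C₂ om)
    (hu : IsRegular D Ku u u₁ u₂) (hv : IsRegular D Kv v v₁ v₂) (i j : Fin d) :
    ∃ k' : E d × E d → ℝ, Measurable k' ∧ ∀ ξ ∈ Metric.ball (0 : E d) 1, ∀ x,
      kern₂ D F om ε u v u₁ v₁ u₂ v₂ i j ξ x = k' (ξ, x) := by
  obtain ⟨P, hPm, hP⟩ := exists_measurable_fderiv_fderiv hD hom i j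
  refine ⟨{q : E d × E d | q.2 ∈ bondDomain D ε q.1}.indicator fun q =>
    (P q * (F (√(ε * ‖q.1‖) * bondStrain ε u q.1 q.2) * bondStrain ε v q.1 q.2) +
    fderiv ℝ (omegaBar om ε q.1) q.2 (basisVec i) *
      bond₁ F (fun x => √(ε * ‖q.1‖) * bondStrain ε u q.1 x) (bondStrain ε v q.1)
      (fun i x => √(ε * ‖q.1‖) * bondStrain ε (u₁ i) q.1 x) (fun i => bondStrain ε (v₁ i) q.1) j
        q.2) +
    (fderiv ℝ (omegaBar om ε q.1) q.2 (basisVec j) *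
      bond₁ F (fun x => √(ε * ‖q.1‖) * bondStrain ε u q.1 x) (bondStrain ε v q.1)
      (fun i x => √(ε * ‖q.1‖) * bondStrain ε (u₁ i) q.1 x) (fun i => bondStrain ε (v₁ i) q.1) i
        q.2 +
    omegaBar om ε q.1 q.2 *
      bond₂ F (fun x => √(ε * ‖q.1‖) * bondStrain ε u q.1 x) (bondStrain ε v q.1)
      (fun i x => √(ε * ‖q.1‖) * bondStrain ε (u₁ i) q.1 x) (fun i => bondStrain ε (v₁ i) q.1)
      (fun i j x => √(ε * ‖q.1‖) * bondStrain ε (u₂ i j) q.1 x)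
      (fun i j => bondStrain ε (v₂ i j) q.1) i j q.2),
    Measurable.indicator ?_ (measurableSet_bondDomain hD ε), fun ξ hξ x => ?_⟩
  · have m0 := measurable_bondIntegrand hF.contDiff.continuous.measurable ε hu.meas hv.meas
    have m1 := fun i => measurable_fderiv_omegaBar hom.cont ε i
    exact ((hPm.mul m0).add ((m1 i).mul (measurable_bond₁ hF hu hv j))).add
      (((m1 j).mul (measurable_bond₁ hF hu hv i)).add
      ((measurable_omegaBar hom.cont ε).mul (measurable_bond₂ hF hu hv i j)))
  · by_cases hx : x ∈ bondDomain D ε ξ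
    · rw [kern₂, indicator_of_mem hx,
        indicator_of_mem (show (ξ, x) ∈ {q : E d × E d | q.2 ∈ bondDomain D ε q.1} from hx), cut₂,
        hP ξ hξ x hx.1]
    · rw [kern₂, indicator_of_notMem hx,
        indicator_of_notMem (show (ξ, x) ∉ {q : E d × E d | q.2 ∈ bondDomain D ε q.1} from hx)]

/-- The weight that dominates the contributions of the bonds. -/
noncomputable def bondWeight (d : ℕ) : ℝ :=
  ∫ ξ in Metric.ball (0 : E d) 1, ‖ξ‖ ^ (-(7 / 4) : ℝ)

/-- Integrability at the origin needs s < d, and s < 2 ≤ d suffices; the case of interest is s =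
7/4. -/
lemma integrableOn_rpow_norm (hd : 2 ≤ d) {s : ℝ} (hs : s < 2) :
    IntegrableOn (fun ξ : E d => ‖ξ‖ ^ (-s)) (Metric.ball 0 1) := by
  refine integrableOn_ball_of_norm_le_rpow (C := 1) (α := s) ?_ ?_
    (Eventually.of_forall fun x => ?_) (Measurable.aestronglyMeasurable (by fun_prop))
  · rw [finrank_euclideanSpace_fin]; omega
  · rw [finrank_euclideanSpace_fin]
    have : (2 : ℝ) ≤ d := by exact_mod_cast hd
    linarith
  · rw [one_mul, Real.norm_of_nonneg (by positivity)]

lemma ae_ball_ne_zero (hd : 2 ≤ d) :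
    ∀ᵐ ξ ∂(volume.restrict (Metric.ball (0 : E d) 1)), ξ ∈ Metric.ball (0 : E d) 1 ∧ ξ ≠ 0 := by
  have : Nonempty (Fin d) := ⟨⟨0, by omega⟩⟩
  have : Nontrivial (E d) := inferInstance
  filter_upwards [ae_restrict_mem measurableSet_ball,
    ae_restrict_of_ae (Measure.ae_ne (volume : Measure (E d)) 0)] with ξ h1 h2
  exact ⟨h1, h2⟩

/-- The `H^2` estimate for the superposition of all bonds. -/
theorem integral_bondField_weakPD (hd : 2 ≤ d) (hD : IsOpen D) (hDb : Bornology.IsBounded D)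
    (hF : IsBddC2 F CF) (hV : volume D ≤ ENNReal.ofReal V) (hV1 : 1 ≤ V) {J : ℝ → ℝ} {M : ℝ}
    (hJ : IsInfluenceFunction J M)
    (hε : 0 < ε) (hε1 : ε < 1) (hom : IsBoundaryFunction D ε C₁ C₂ om)
    (hKu : 0 ≤ Ku) (hKv : 0 ≤ Kv) (hu : IsRegular D Ku u u₁ u₂)
    (hv : IsRegular D Kv v v₁ v₂) {Z : ℝ} (hZ : Z = M / ε * ((1 + (|C₁| + |C₂|)) *
      (10 * CF * V * (1 + Ku + Ku ^ 2) * Kv * ε ^ (-(7 / 4) : ℝ)) * 4) * bondWeight d) :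
    ∃ (q₁ : Fin d → E d → E d) (q₂ : Fin d → Fin d → E d → E d),
      (∀ i, WeakPD D i (fun x => ∫ ξ in Metric.ball (0 : E d) 1,
        bondField J ε (kern D F om ε u v) ξ x) (q₁ i)) ∧
      (∀ i j, WeakPD D j (q₁ i) (q₂ i j)) ∧
      LpLe 2 volume (fun x => ∫ ξ in Metric.ball (0 : E d) 1,
        bondField J ε (kern D F om ε u v) ξ x) Z ∧
      (∀ i, LpLe 2 volume (q₁ i) Z) ∧ ∀ i j, LpLe 2 volume (q₂ i j) Z := by
  have hfin : IsFiniteMeasure (volume.restrict D) := ⟨by simpa using hDb.measure_lt_top⟩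
  set ν := (volume : Measure (E d)).restrict (Metric.ball 0 1) with hν
  set N := (1 + (|C₁| + |C₂|)) *
      (10 * CF * V * (1 + Ku + Ku ^ 2) * Kv * ε ^ (-(7 / 4) : ℝ)) * 4 with hN
  have hCF : 0 ≤ CF := (abs_nonneg _).trans (hF.bd 0)
  have hM : 0 ≤ M := (hJ.nonneg 0 le_rfl one_pos).trans (hJ.le 0 le_rfl one_pos)
  have hV0 : 0 ≤ V := zero_le_one.trans hV1
  have hB : 0 ≤ M / ε * N := by positivity
  have hw : Integrable (fun ξ : E d => ‖ξ‖ ^ (-(7 / 4) : ℝ)) ν :=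
    integrableOn_rpow_norm hd (by norm_num)
  have hw0 : ∀ᵐ ξ ∂ν, 0 < ‖ξ‖ ^ (-(7 / 4) : ℝ) := by
    filter_upwards [ae_ball_ne_zero hd] with ξ hξ
    exact Real.rpow_pos_of_pos (norm_pos_iff.2 hξ.2) _
  have hk : ∀ᵐ ξ ∂ν, ((∀ i, WeakPD D i (kern D F om ε u v ξ) (kern₁ D F om ε u v u₁ v₁ i ξ)) ∧
      ∀ i j, WeakPD D j (kern₁ D F om ε u v u₁ v₁ i ξ) (kern₂ D F om ε u v u₁ v₁ u₂ v₂ i j ξ)) ∧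
      LpLe 2 volume (bondField J ε (kern D F om ε u v) ξ)
        (M / ε * N * ‖ξ‖ ^ (-(7 / 4) : ℝ)) ∧
      (∀ i, LpLe 2 volume (bondField J ε (kern₁ D F om ε u v u₁ v₁ i) ξ)
        (M / ε * N * ‖ξ‖ ^ (-(7 / 4) : ℝ))) ∧
      ∀ i j, LpLe 2 volume (bondField J ε (kern₂ D F om ε u v u₁ v₁ u₂ v₂ i j) ξ)
        (M / ε * N * ‖ξ‖ ^ (-(7 / 4) : ℝ)) := by
    filter_upwards [ae_ball_ne_zero hd] with ξ hξ
    obtain ⟨h1, h2, h3, h4⟩ := kern_weakPD hD hDb hF hV hV1 hε hε1 hom hKu hKv hu hv hξ.1 hξ.2 rfl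
    -- The power (ε|ξ|)^(-7/4) factors into the constant ε^(-7/4) and the integrable weight in ξ.
    have e : M / ε * ((1 + (|C₁| + |C₂|)) *
        (10 * CF * V * (1 + Ku + Ku ^ 2) * Kv * (ε * ‖ξ‖) ^ (-(7 / 4) : ℝ)) * 4) =
        M / ε * N * ‖ξ‖ ^ (-(7 / 4) : ℝ) := by
      rw [Real.mul_rpow hε.le (norm_nonneg _), hN]
      ring
    refine ⟨h1, ?_, fun i => ?_, fun i j => ?_⟩
    · rw [← e]
      exact h2.bondField hJ hε hξ.1
    · rw [← e]
      exact (h3 i).bondField hJ hε hξ.1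
    · rw [← e]
      exact (h4 i j).bondField hJ hε hξ.1
  obtain ⟨k0, hk0, ek0⟩ := exists_measurable_kern (ε := ε) hD hF hom.cont hu hv
  have hm0 : ∀ (μ : Measure (E d)) [SFinite μ], AEStronglyMeasurable
      (Function.uncurry (bondField J ε (kern D F om ε u v))) (ν.prod μ) := fun μ _ =>
    aestronglyMeasurable_bondField hJ.meas ε hk0 (fun ξ _ x => ek0 ξ x) μ
  have hm1 : ∀ (i : Fin d) (μ : Measure (E d)) [SFinite μ], AEStronglyMeasurable
      (Function.uncurry (bondField J ε (kern₁ D F om ε u v u₁ v₁ i))) (ν.prod μ) := by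
    intro i μ _
    obtain ⟨k1, hk1, ek1⟩ := exists_measurable_kern₁ (ε := ε) hD hF hom.cont hu hv i
    exact aestronglyMeasurable_bondField hJ.meas ε hk1 (fun ξ _ x => ek1 ξ x) μ
  have hm2 : ∀ (i j : Fin d) (μ : Measure (E d)) [SFinite μ], AEStronglyMeasurable
      (Function.uncurry (bondField J ε (kern₂ D F om ε u v u₁ v₁ u₂ v₂ i j))) (ν.prod μ) := by
    intro i j μ _
    obtain ⟨k2, hk2, ek2⟩ := exists_measurable_kern₂ (ε := ε) hD hF hom hu hv i j
    exact aestronglyMeasurable_bondField hJ.meas ε hk2 ek2 μ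
  have i0 := integrable_uncurry_of_lpLe (hm0 (volume.restrict D)) hw
    (hk.mono fun ξ h => h.2.1.restrict D)
  have i1 := fun i => integrable_uncurry_of_lpLe (hm1 i (volume.restrict D)) hw
    (hk.mono fun ξ h => (h.2.2.1 i).restrict D)
  have i2 := fun i j => integrable_uncurry_of_lpLe (hm2 i j (volume.restrict D)) hw
    (hk.mono fun ξ h => (h.2.2.2 i j).restrict D)
  have hZ' : Z = M / ε * N * ∫ ξ, ‖ξ‖ ^ (-(7 / 4) : ℝ) ∂ν := hZ
  rw [hZ']
  refine ⟨fun i x => ∫ ξ, bondField J ε (kern₁ D F om ε u v u₁ v₁ i) ξ x ∂ν,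
    fun i j x => ∫ ξ, bondField J ε (kern₂ D F om ε u v u₁ v₁ u₂ v₂ i j) ξ x ∂ν,
    fun i => WeakPD.integral i0 (i1 i) (hk.mono fun ξ h => (h.1.1 i).bondField),
    fun i j => WeakPD.integral (i1 i) (i2 i j) (hk.mono fun ξ h => (h.1.2 i j).bondField),
    LpLe.integral (hm0 volume) hw hw0 hB (hk.mono fun ξ h => h.2.1),
    fun i => LpLe.integral (hm1 i volume) hw hw0 hB (hk.mono fun ξ h => h.2.2.1 i),
    fun i j => LpLe.integral (hm2 i j volume) hw hw0 hB (hk.mono fun ξ h => h.2.2.2 i j)⟩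

end VectorKernel

end Peridynamics

namespace Peridynamics

/-! ### Identification of Q with a superposition of bonds -/

section Operator

variable {d : ℕ} {D : Set (E d)}

/-- The second derivative of `F₁(r) = f(r²)`. -/
noncomputable def potDeriv (f : ℝ → ℝ) : ℝ → ℝ := iteratedDeriv 2 fun t : ℝ => f (t ^ 2)

lemma IsPotentialFunction.contDiff_sq {f : ℝ → ℝ} (hf : IsPotentialFunction f) :
    ContDiff ℝ ∞ fun t : ℝ => f (t ^ 2) := by
  rw [← contDiffOn_univ]
  exact hf.smooth.comp (s := univ) (contDiff_id.pow 2).contDiffOn fun t _ => sq_nonneg t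

lemma IsPotentialFunction.exists_isBddC2 {f : ℝ → ℝ} (hf : IsPotentialFunction f) :
    ∃ C, IsBddC2 (potDeriv f) C := by
  obtain ⟨A, hA⟩ := hf.bounded_deriv 2 (by norm_num) (by norm_num)
  obtain ⟨B, hB⟩ := hf.bounded_deriv 3 (by norm_num) (by norm_num)
  obtain ⟨C, hC⟩ := hf.bounded_deriv 4 (by norm_num) (by norm_num)
  have e3 : deriv (potDeriv f) = iteratedDeriv 3 fun t : ℝ => f (t ^ 2) := iteratedDeriv_succ.symm
  have e4 : deriv (deriv (potDeriv f)) = iteratedDeriv 4 fun t : ℝ => f (t ^ 2) := by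
    rw [e3, ← iteratedDeriv_succ]
  refine ⟨max A (max B C), ?_, fun s => (hA s).trans (le_max_left _ _), fun s => ?_, fun s => ?_⟩
  · have h4 := ContDiff.iterate_deriv' 2 2 (contDiff_infty.1 hf.contDiff_sq (2 + 2))
    rw [potDeriv, iteratedDeriv_eq_iterate]
    exact_mod_cast h4
  · rw [e3]
    exact (hB s).trans ((le_max_left _ _).trans (le_max_right _ _))
  · rw [e4]
    exact (hC s).trans ((le_max_right _ _).trans (le_max_right _ _))

/-- Since ρS² = (√ρ S)² with ρ = |y - x|, the potential is F₁(√ρ S) times a prefactor, and two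
derivatives bring out ρ. This ρ cancels the 1/ρ of the prefactor. -/
lemma iteratedDeriv_bondPotential {f : ℝ → ℝ} (hf : IsPotentialFunction f) (J : ℝ → ℝ)
    (om : E d → ℝ) (ε : ℝ) (x y : E d) (S : ℝ) :
    iteratedDeriv 2 (bondPotential f J om ε x y) S =
      om x * om y * (J (‖y - x‖ / ε) / (ε * ‖y - x‖)) *
        (‖y - x‖ * potDeriv f (√‖y - x‖ * S)) := by
  have h1 : bondPotential f J om ε x y = fun S => (om x * om y * (J (‖y - x‖ / ε) / (ε * ‖y - x‖))) *
      (fun S => (fun t : ℝ => f (t ^ 2)) (√‖y - x‖ * S)) S := by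
    ext S
    rw [bondPotential]
    simp only [mul_pow, Real.sq_sqrt (norm_nonneg _)]
  have h2 : ContDiff ℝ (2 : ℕ) fun t : ℝ => f (t ^ 2) :=
    contDiff_infty.1 hf.contDiff_sq 2
  rw [h1, iteratedDeriv_const_mul_field, iteratedDeriv_comp_const_mul h2,
    Real.sq_sqrt (norm_nonneg _), potDeriv]

/-- If x + εξ lies on ∂D the right side is zero by definition of the bond domain, and the left side
is zero because `om` vanishes there; otherwise the factors match. -/
lemma bondForceDeriv_eq_bondField {f : ℝ → ℝ} (hf : IsPotentialFunction f) (J : ℝ → ℝ)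
    {ε C₁ C₂ : ℝ} (hε : 0 < ε) {om : E d → ℝ} (hom : IsBoundaryFunction D ε C₁ C₂ om)
    (u v : E d → E d) {x ξ : E d} (hx : x ∈ D) (hξ : ξ ≠ 0) :
    bondForceDeriv f J om ε v u x (x + ε • ξ) =
      bondField J ε (kern D (potDeriv f) om ε u v) ξ x := by
  have hn : 0 < ‖ξ‖ := norm_pos_iff.2 hξ
  have hρ : ‖x + ε • ξ - x‖ = ε * ‖ξ‖ := by
    rw [add_sub_cancel_left, norm_smul, Real.norm_of_nonneg hε.le]
  have hdir : dir x (x + ε • ξ) = ‖ξ‖⁻¹ • ξ := by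
    rw [dir, hρ, add_sub_cancel_left, smul_smul]
    congr 1
    field_simp
  have hst : ∀ w : E d → E d, strain w (x + ε • ξ) x = bondStrain ε w ξ x := fun w => by
    rw [strain, hdir, hρ, bondStrain, real_inner_smul_left, real_inner_comm]
  rw [bondForceDeriv, iteratedDeriv_bondPotential hf, hst, hst, hdir, hρ, bondField]
  congr 1
  have hJ : ε * ‖ξ‖ / ε = ‖ξ‖ := by field_simp
  rw [hJ]
  by_cases hfr : x + ε • ξ ∈ frontier D
  · rw [kern, indicator_of_notMem (fun h => h.2 hfr), hom.eq_zero _ hfr]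
    simp
  · rw [kern, indicator_of_mem (show x ∈ bondDomain D ε ξ from ⟨hx, hfr⟩), omegaBar]
    field_simp

lemma setIntegral_ball_eq {F : Type*} [NormedAddCommGroup F] [NormedSpace ℝ F] (g : E d → F)
    (x : E d) {ε : ℝ} (hε : 0 < ε) :
    ∫ y in Metric.ball x ε, g y = ε ^ d • ∫ ξ in Metric.ball (0 : E d) 1, g (x + ε • ξ) := by
  have h1 := Measure.setIntegral_comp_smul_of_pos (volume : Measure (E d)) (fun z => g (x + z))
    (Metric.ball 0 1) hε
  rw [smul_unitBall_of_pos hε, finrank_euclideanSpace_fin] at h1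
  have h2 := (measurePreserving_add_left (volume : Measure (E d)) x).setIntegral_preimage_emb
    (measurableEmbedding_addLeft x) g (Metric.ball x ε)
  have h3 : (fun z => x + z) ⁻¹' Metric.ball x ε = Metric.ball 0 ε := by
    ext z
    simp
  rw [h3] at h2
  rw [h1, ← h2, smul_smul, mul_inv_cancel₀ (pow_pos hε d).ne', one_smul]

lemma norm_dir_le_one (x y : E d) : ‖dir x y‖ ≤ 1 := norm_normalize_le_one (y - x)

lemma abs_strain_le (w : E d → E d) (x y : E d) : |strain w y x| ≤ ‖y - x‖⁻¹ * ‖w y - w x‖ := by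
  refine (abs_real_inner_le_norm _ _).trans ?_
  rw [norm_smul, norm_inv, norm_norm]
  exact mul_le_of_le_one_right (by positivity) (norm_dir_le_one x y)

/-- The factor om x is kept, as it later forces Q to vanish at the boundary. For bounded v the
remaining singularity is 1/|y - x|, which is integrable for d ≥ 2. At y = x the direction has the
default value 0. -/
lemma norm_bondForceDeriv_le {f : ℝ → ℝ} (hf : IsPotentialFunction f) {CF : ℝ}
    (hF : IsBddC2 (potDeriv f) CF) {J : ℝ → ℝ} {M : ℝ} (hJ : IsInfluenceFunction J M)
    {ε C₁ C₂ : ℝ} (hε : 0 < ε) {om : E d → ℝ} (hom : IsBoundaryFunction D ε C₁ C₂ om)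
    (u v : E d → E d) {x y : E d} (hy : y ∈ Metric.ball x ε) :
    ‖bondForceDeriv f J om ε v u x y‖ ≤
      om x * (M / ε * CF) * (‖y - x‖⁻¹ * ‖v y - v x‖) := by
  rcases eq_or_ne y x with rfl | hyx
  · simp [bondForceDeriv, dir]
  have hρ : 0 < ‖y - x‖ := norm_pos_iff.2 (sub_ne_zero.2 hyx)
  have hr : ‖y - x‖ / ε < 1 := by
    rw [div_lt_one hε]
    simpa [dist_eq_norm] using hy
  have hr0 : 0 ≤ ‖y - x‖ / ε := by positivity
  have hJ0 := hJ.nonneg _ hr0 hr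
  have hJM := hJ.le _ hr0 hr
  rw [bondForceDeriv, iteratedDeriv_bondPotential hf, norm_smul, norm_mul, Real.norm_eq_abs,
    Real.norm_eq_abs]
  have h1 : |om x * om y * (J (‖y - x‖ / ε) / (ε * ‖y - x‖)) *
      (‖y - x‖ * potDeriv f (√‖y - x‖ * strain u y x))| ≤ om x * (M / ε * CF) := by
    have e : om x * om y * (J (‖y - x‖ / ε) / (ε * ‖y - x‖)) *
        (‖y - x‖ * potDeriv f (√‖y - x‖ * strain u y x)) =
        om x * (om y * (J (‖y - x‖ / ε) / ε * potDeriv f (√‖y - x‖ * strain u y x))) := by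
      field_simp
    rw [e, abs_mul, abs_mul, abs_mul, abs_of_nonneg (hom.nonneg x), abs_of_nonneg (hom.nonneg y),
      abs_of_nonneg (div_nonneg hJ0 hε.le)]
    have hCF := hF.bd (√‖y - x‖ * strain u y x)
    have hM : 0 ≤ M := hJ0.trans hJM
    calc om x * (om y * (J (‖y - x‖ / ε) / ε * |potDeriv f (√‖y - x‖ * strain u y x)|))
        ≤ om x * (1 * (M / ε * CF)) := by
          gcongr
          · exact hom.nonneg x
          · exact hom.le_one y
      _ = _ := by rw [one_mul]
  have h0 : 0 ≤ om x * (M / ε * CF) := (abs_nonneg _).trans h1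
  calc _ ≤ om x * (M / ε * CF) * (‖y - x‖⁻¹ * ‖v y - v x‖) * 1 := by
        gcongr
        · exact abs_strain_le v x y
        · exact norm_dir_le_one x y
    _ = _ := mul_one _

lemma integrableOn_inv_norm_sub (hd : 2 ≤ d) (x : E d) (ε : ℝ) :
    IntegrableOn (fun y => ‖y - x‖⁻¹) (Metric.ball x ε) ∧
      ∫ y in Metric.ball x ε, ‖y - x‖⁻¹ = ∫ z in Metric.ball (0 : E d) ε, ‖z‖⁻¹ := by
  have hm := measurePreserving_sub_right (volume : Measure (E d)) x
  have hemb : MeasurableEmbedding fun y : E d => y - x := by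
    simpa only [sub_eq_add_neg] using measurableEmbedding_addRight (-x)
  have hpre : (fun y => y - x) ⁻¹' Metric.ball 0 ε = Metric.ball x ε := by
    ext y
    simp [dist_eq_norm]
  constructor
  · rw [← hpre]
    refine (hm.integrableOn_comp_preimage hemb (f := fun z : E d => ‖z‖⁻¹)).2 ?_
    refine integrableOn_ball_of_norm_le_rpow (C := 1) (α := 1) ?_ ?_
      (Eventually.of_forall fun z => ?_) (Measurable.aestronglyMeasurable (by fun_prop))
    · rw [finrank_euclideanSpace_fin]; omega
    · rw [finrank_euclideanSpace_fin]
      have : (2 : ℝ) ≤ d := by exact_mod_cast hd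
      linarith
    · rw [one_mul, Real.rpow_neg_one, norm_inv, norm_norm]
  · rw [← hpre]
    exact hm.setIntegral_preimage_emb hemb (fun z => ‖z‖⁻¹) _

lemma aestronglyMeasurable_bondForceDeriv {f : ℝ → ℝ} (hf : IsPotentialFunction f) {CF : ℝ}
    (hF : IsBddC2 (potDeriv f) CF) {J : ℝ → ℝ} {M : ℝ} (hJ : IsInfluenceFunction J M)
    {ε : ℝ} {om : E d → ℝ} (hom : Continuous om)
    {u v : E d → E d} (hu : AEStronglyMeasurable u) (hv : AEStronglyMeasurable v) (x : E d) :
    AEStronglyMeasurable (bondForceDeriv f J om ε v u x) := by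
  have hdir : Measurable fun y : E d => dir x y := by
    unfold dir
    fun_prop
  have hst : ∀ {w : E d → E d}, AEStronglyMeasurable w →
      AEStronglyMeasurable (fun y => strain w y x) := fun {w} hw => by
    refine AEStronglyMeasurable.inner ?_ hdir.aestronglyMeasurable
    exact (show Measurable fun y : E d => ‖y - x‖⁻¹ by fun_prop).aestronglyMeasurable.smul
      (hw.sub aestronglyMeasurable_const)
  have hJm : Measurable fun y : E d => om x * om y * (J (‖y - x‖ / ε) / (ε * ‖y - x‖)) := by
    have h1 : Measurable fun y : E d => J (‖y - x‖ / ε) := hJ.meas.comp (by fun_prop)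
    exact (hom.measurable.const_mul _).mul (h1.div (by fun_prop))
  have hFm : AEStronglyMeasurable fun y : E d =>
      ‖y - x‖ * potDeriv f (√‖y - x‖ * strain u y x) :=
    (show Measurable fun y : E d => ‖y - x‖ by fun_prop).aestronglyMeasurable.mul
      (hF.contDiff.continuous.comp_aestronglyMeasurable
        ((show Measurable fun y : E d => √‖y - x‖ by fun_prop).aestronglyMeasurable.mul
          (hst hu)))
  unfold bondForceDeriv
  simp only [iteratedDeriv_bondPotential hf]
  exact ((hJm.aestronglyMeasurable.mul hFm).mul (hst hv)).smul hdir.aestronglyMeasurable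

/-- Absolute convergence of the integral that defines `Q`, with a bound. -/
theorem integrableOn_bondForceDeriv (hd : 2 ≤ d) {f : ℝ → ℝ} (hf : IsPotentialFunction f) {CF : ℝ}
    (hF : IsBddC2 (potDeriv f) CF) {J : ℝ → ℝ} {M : ℝ} (hJ : IsInfluenceFunction J M)
    {ε C₁ C₂ : ℝ} (hε : 0 < ε) {om : E d → ℝ} (hom : IsBoundaryFunction D ε C₁ C₂ om)
    {u v : E d → E d} (hu : AEStronglyMeasurable u) (hv : AEStronglyMeasurable v) {K : ℝ}
    (hK : ∀ᵐ y, ‖v y‖ ≤ K) (x : E d) :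
    IntegrableOn (bondForceDeriv f J om ε v u x) (Metric.ball x ε) ∧
      ‖∫ y in Metric.ball x ε, bondForceDeriv f J om ε v u x y‖ ≤
        om x * (M / ε * CF) * ((K + ‖v x‖) * ∫ z in Metric.ball (0 : E d) ε, ‖z‖⁻¹) := by
  obtain ⟨hi, he⟩ := integrableOn_inv_norm_sub hd x ε
  have hCF : 0 ≤ CF := (abs_nonneg _).trans (hF.bd 0)
  have hM : 0 ≤ M := (hJ.nonneg 0 le_rfl one_pos).trans (hJ.le 0 le_rfl one_pos)
  have h0 : 0 ≤ om x * (M / ε * CF) := mul_nonneg (hom.nonneg x) (by positivity)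
  -- Only v y needs the a.e. bound K; v x enters through its actual value at the fixed point, so
  -- convergence holds for every x.
  have hb : ∀ᵐ y ∂(volume.restrict (Metric.ball x ε)), ‖bondForceDeriv f J om ε v u x y‖ ≤
      om x * (M / ε * CF) * ((K + ‖v x‖) * ‖y - x‖⁻¹) := by
    filter_upwards [ae_restrict_mem measurableSet_ball, ae_restrict_of_ae hK] with y hy hyK
    refine (norm_bondForceDeriv_le hf hF hJ hε hom u v hy).trans ?_
    rw [mul_comm (K + ‖v x‖)]
    gcongr
    exact (norm_sub_le _ _).trans (by gcongr)
  have hi2 := (hi.const_mul (K + ‖v x‖)).const_mul (om x * (M / ε * CF))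
  refine ⟨Integrable.mono' hi2 (aestronglyMeasurable_bondForceDeriv hf hF hJ hom.cont hu hv x).restrict hb, ?_⟩
  refine (norm_integral_le_of_norm_le hi2 hb).trans (le_of_eq ?_)
  rw [integral_const_mul, integral_const_mul, he]

lemma bondForceDeriv_congr_ae {f J : ℝ → ℝ} {om : E d → ℝ} {ε : ℝ} {u v u' v' : E d → E d}
    (hu : u =ᵐ[volume] u') (hv : v =ᵐ[volume] v') {x : E d} (hux : u x = u' x)
    (hvx : v x = v' x) :
    bondForceDeriv f J om ε v u x =ᵐ[volume] bondForceDeriv f J om ε v' u' x := by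
  filter_upwards [hu, hv] with y huy hvy
  simp only [bondForceDeriv, strain, huy, hvy, hux, hvx]

/-- `Q` as a superposition of bonds. -/
theorem Q_ae_eq (hd : 2 ≤ d) (hD : IsOpen D) {f : ℝ → ℝ} (hf : IsPotentialFunction f) (J : ℝ → ℝ)
    {ε C₁ C₂ : ℝ} (hε : 0 < ε) {om : E d → ℝ} (hom : IsBoundaryFunction D ε C₁ C₂ om)
    {u v u₀ v₀ : E d → E d} (hu : D.indicator u =ᵐ[volume] u₀)
    (hv : D.indicator v =ᵐ[volume] v₀) :
    Q D f J om ε v u =ᵐ[volume.restrict D] fun x =>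
      (2 / (volume (Metric.ball (0 : E d) 1)).toReal) • ∫ ξ in Metric.ball (0 : E d) 1,
        bondField J ε (kern D (potDeriv f) om ε u₀ v₀) ξ x := by
  -- The value at x itself enters the strain, so the point must avoid the null sets where u and v
  -- differ from their representatives.
  filter_upwards [ae_restrict_mem hD.measurableSet, ae_restrict_of_ae hu, ae_restrict_of_ae hv]
    with x hx hux hvx
  rw [Q, integral_congr_ae (ae_restrict_of_ae (bondForceDeriv_congr_ae hu hv hux hvx)),
    setIntegral_ball_eq _ _ hε, smul_smul]
  have h1 : ∫ ξ in Metric.ball (0 : E d) 1, bondForceDeriv f J om ε v₀ u₀ x (x + ε • ξ) =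
      ∫ ξ in Metric.ball (0 : E d) 1, bondField J ε (kern D (potDeriv f) om ε u₀ v₀) ξ x := by
    refine integral_congr_ae ?_
    filter_upwards [ae_ball_ne_zero hd] with ξ hξ
    exact bondForceDeriv_eq_bondField hf J hε hom u₀ v₀ hx hξ.2
  rw [h1]
  congr 1
  have : ε ^ d ≠ 0 := (pow_pos hε d).ne'
  field_simp

lemma bondForceDeriv_sub (f J : ℝ → ℝ) (om : E d → ℝ) (ε : ℝ) (u v w : E d → E d) (x y : E d) :
    bondForceDeriv f J om ε (D.indicator (v - w)) u x y =
      bondForceDeriv f J om ε (D.indicator v) u x y -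
        bondForceDeriv f J om ε (D.indicator w) u x y := by
  have h : strain (D.indicator (v - w)) y x =
      strain (D.indicator v) y x - strain (D.indicator w) y x := by
    simp only [strain, indicator_sub', Pi.sub_apply]
    rw [← inner_sub_left, ← smul_sub]
    congr 2
    abel
  simp only [bondForceDeriv, h, mul_sub, sub_smul]

end Operator

end Peridynamics

namespace Peridynamics

/-! ### Membership in H¹₀ through domination by the boundary function -/

section VanishingTrace

variable {d : ℕ} {D : Set (E d)}

lemma exists_cutoff_one_nhds {K : Set (E d)} (hK : IsCompact K) (hD : IsOpen D) (hKD : K ⊆ D) :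
    ∃ χ : E d → ℝ, ContDiff ℝ ∞ χ ∧ HasCompactSupport χ ∧ tsupport χ ⊆ D ∧
      ∀ x ∈ K, ∀ᶠ y in 𝓝 x, χ y = 1 := by
  obtain ⟨L, hL, hKL, hLD⟩ := exists_compact_between hK hD hKD
  obtain ⟨χ, h1, h0, -⟩ := exists_contMDiffMap_one_nhds_of_subset_interior (n := (⊤ : ℕ∞))
    (modelWithCornersSelf ℝ (E d)) hK.isClosed hKL
  have hs : tsupport χ ⊆ L := closure_minimal (fun x hx => by
    by_contra hxL
    exact hx (h0 x hxL)) hL.isClosed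
  exact ⟨χ, χ.contMDiff.contDiff, hL.of_isClosed_subset (isClosed_tsupport _) hs, hs.trans hLD,
    fun x hx => eventually_nhdsSet_iff_forall.1 h1 x hx⟩

/-- Extension by zero of weakly differentiable functions supported in a compact set. -/
lemma WeakPD.extend_zero_of_compact {F : Type*} [NormedAddCommGroup F] [NormedSpace ℝ F]
    (hD : IsOpen D) {K : Set (E d)} (hK : IsCompact K)
    (hKD : K ⊆ D) {i : Fin d} {t g : E d → F} (h : WeakPD D i (K.indicator t) (K.indicator g))
    (it : Integrable (K.indicator t)) (ig : Integrable (K.indicator g)) :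
    WeakPD univ i (K.indicator t) (K.indicator g) := by
  obtain ⟨χ, hχ, hχc, hχs, hχ1⟩ := exists_cutoff_one_nhds hK hD hKD
  refine ⟨it.locallyIntegrable.locallyIntegrableOn _, ig.locallyIntegrable.locallyIntegrableOn _,
    fun φ hφ hc _ => ?_⟩
  have hts : tsupport (fun x => φ x * χ x) ⊆ D := (tsupport_mul_test_subset φ χ).trans hχs
  -- φχ is a test function in D that agrees with φ near K, outside of which both integrands are
  -- zero.
  have h1 := h.2.2 (fun x => φ x * χ x) (hφ.mul hχ) (hχc.mul_left (f' := χ)) hts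
  have hz : ∀ w : E d → F, ∀ x ∉ D, K.indicator w x = 0 := fun w x hx =>
    indicator_of_notMem (fun hxK => hx (hKD hxK)) w
  rw [setIntegral_eq_integral_of_forall_compl_eq_zero fun x hx => by rw [hz t x hx, smul_zero],
    setIntegral_eq_integral_of_forall_compl_eq_zero fun x hx => by rw [hz g x hx, smul_zero]] at h1
  rw [setIntegral_univ, setIntegral_univ]
  convert h1 using 2
  · ext x
    by_cases hx : x ∈ K
    · have : (fun x => φ x * χ x) =ᶠ[𝓝 x] φ := (hχ1 x hx).mono fun y hy => by simp [hy]
      rw [this.fderiv_eq]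
    · rw [indicator_of_notMem hx, smul_zero, smul_zero]
  · congr 1
    ext x
    by_cases hx : x ∈ K
    · simp only [(hχ1 x hx).self_of_nhds, mul_one]
    · rw [indicator_of_notMem hx, smul_zero, smul_zero]

/-- For a function supported in a compact K ⊂ D the extension by zero keeps the weak derivatives,
and mollification at a scale below the distance from K to the boundary stays supported in D. -/
lemma exists_test_approx (hD : IsOpen D) {K : Set (E d)} (hK : IsCompact K) (hKD : K ⊆ D)
    {t : E d → ℝ} {g : Fin d → E d → ℝ}
    (h : ∀ i, WeakPD D i (K.indicator t) (K.indicator (g i)))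
    (mt : MemLp (K.indicator t) 2 volume) (mg : ∀ i, MemLp (K.indicator (g i)) 2 volume)
    {δ : ENNReal} (hδ : 0 < δ) :
    ∃ φ : E d → ℝ, ContDiff ℝ ∞ φ ∧ HasCompactSupport φ ∧ tsupport φ ⊆ D ∧
      eLpNorm (φ - K.indicator t) 2 volume ≤ δ ∧
      ∀ i, eLpNorm ((fun x => fderiv ℝ φ x (basisVec i)) - K.indicator (g i)) 2 volume ≤ δ := by
  have hI : ∀ {w : E d → ℝ}, MemLp (K.indicator w) 2 volume → Integrable (K.indicator w) := by
    intro w hw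
    have hfin : IsFiniteMeasure (volume.restrict K) := ⟨by simpa using hK.measure_lt_top⟩
    have h1 : IntegrableOn (K.indicator w) K := (hw.restrict K).integrable one_le_two
    rw [← integrable_indicator_iff hK.measurableSet, indicator_indicator, inter_self] at h1
    exact h1
  have hw := fun i => WeakPD.extend_zero_of_compact hD hK hKD (h i) (hI mt) (hI (mg i))
  obtain ⟨ρ, hρ, hρD⟩ := hK.exists_cthickening_subset_open hD hKD
  have e1 := ENNReal.tendsto_atTop_zero.1 (tendsto_eLpNorm_mol_sub mt) δ hδ
  have e2 := fun i => ENNReal.tendsto_atTop_zero.1 (tendsto_eLpNorm_mol_sub (mg i)) δ hδ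
  obtain ⟨N, hN⟩ := e1
  choose N' hN' using e2
  obtain ⟨m, hm⟩ := exists_nat_one_div_lt hρ
  set n := max m (max N (Finset.univ.sup N')) with hn
  have hn1 : 1 / ((n : ℝ) + 1) ≤ ρ := by
    refine le_trans ?_ hm.le
    have : (m : ℝ) ≤ n := by exact_mod_cast le_max_left _ _
    gcongr
  have hsub : tsupport (mol n (K.indicator t)) ⊆ Metric.cthickening ρ K := by
    refine closure_minimal ((support_mol_subset n _ (K := K) ?_).trans
      (Metric.cthickening_mono hn1 K)) Metric.isClosed_cthickening
    exact support_indicator_subset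
  refine ⟨mol n (K.indicator t), mol_contDiff n (hI mt).locallyIntegrable,
    hK.cthickening.of_isClosed_subset (isClosed_tsupport _) hsub, hsub.trans hρD,
    hN n ((le_max_left _ _).trans (le_max_right _ _)), fun i => ?_⟩
  have he : (fun x => fderiv ℝ (mol n (K.indicator t)) x (basisVec i)) =
      mol n (K.indicator (g i)) := by
    ext x
    exact fderiv_mol (hw i) (hI mt).locallyIntegrable MeasurableSet.univ (fun _ _ => rfl)
      (fun _ _ => rfl) n (subset_univ _)
  rw [he]
  exact hN' i n ((Finset.le_sup (Finset.mem_univ i)).trans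
    ((le_max_right _ _).trans (le_max_right _ _)))

lemma tendsto_eLpNorm_sub_of_dominated {α : Type*} [MeasurableSpace α] {μ : Measure α}
    {f : ℕ → α → ℝ} {g G : α → ℝ} (hf : ∀ n, AEStronglyMeasurable (f n) μ)
    (hg : AEStronglyMeasurable g μ) (hG : MemLp G 2 μ) (hle : ∀ n, ∀ᵐ x ∂μ, |f n x - g x| ≤ |G x|)
    (hlim : ∀ᵐ x ∂μ, Tendsto (fun n => f n x) atTop (𝓝 (g x))) :
    Tendsto (fun n => eLpNorm (f n - g) 2 μ) atTop (𝓝 0) := by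
  have h1 : Tendsto (fun n => ∫⁻ x, ‖(f n - g) x‖ₑ ^ (2 : ℝ) ∂μ) atTop (𝓝 (∫⁻ _, 0 ∂μ)) := by
    refine tendsto_lintegral_of_dominated_convergence' (fun x => ‖G x‖ₑ ^ (2 : ℝ))
      (fun n => (((hf n).sub hg).enorm).pow_const _) (fun n => ?_) ?_ ?_
    · filter_upwards [hle n] with x hx
      gcongr
      exact enorm_le_iff_norm_le.2 hx
    · have := hG.2.ne
      rw [eLpNorm_eq_lintegral_rpow_enorm_toReal (by norm_num) (by norm_num)] at this
      intro htop
      simp only [ENNReal.toReal_ofNat] at this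
      rw [htop] at this
      exact this (by simp)
    · filter_upwards [hlim] with x hx
      have h2 : Tendsto (fun n => ‖(f n - g) x‖ₑ) atTop (𝓝 0) := by
        have := (hx.sub_const (g x)).enorm
        simpa using this
      have h3 := (ENNReal.continuous_rpow_const (y := 2)).tendsto 0 |>.comp h2
      simpa [Function.comp_def] using h3
  rw [lintegral_zero] at h1
  have h4 := (ENNReal.continuous_rpow_const (y := 1 / 2)).tendsto 0 |>.comp h1
  simp only [Function.comp_def] at h4
  rw [ENNReal.zero_rpow_of_pos (by norm_num)] at h4
  refine h4.congr fun n => ?_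
  rw [eLpNorm_eq_lintegral_rpow_enorm_toReal (by norm_num) (by norm_num)]
  simp

lemma deriv_etan_eq_zero {n : ℕ} {s : ℝ} (hs : |s| < 1 / ((n : ℝ) + 1)) :
    deriv (etan n) s = 0 := by
  have h : etan n =ᶠ[𝓝 s] fun _ => 0 := by
    filter_upwards [(isOpen_lt continuous_abs continuous_const).mem_nhds hs] with t ht
    exact etan_eq_zero (le_of_lt ht)
  rw [h.deriv_eq, deriv_const]

/-- Points of the closure outside D are frontier points, where the function is 0 < s. -/
lemma isCompact_superlevel (hD : IsOpen D) (hDb : Bornology.IsBounded D) {om : E d → ℝ}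
    (hom : Continuous om) (hom0 : ∀ x ∈ frontier D, om x = 0) {s : ℝ} (hs : 0 < s) :
    IsCompact (closure D ∩ {x | s ≤ om x}) ∧ closure D ∩ {x | s ≤ om x} ⊆ D := by
  refine ⟨hDb.isCompact_closure.inter_right (isClosed_le continuous_const hom), fun x hx => ?_⟩
  by_contra hxD
  have h1 : x ∈ frontier D := by
    rw [hD.frontier_eq]
    exact ⟨hx.1, hxD⟩
  have h2 : s ≤ om x := hx.2
  rw [hom0 x h1] at h2
  linarith

/-- Weakly differentiable functions dominated by a continuous function that vanishes on the
boundary are limits of test functions. -/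
theorem isH10_of_abs_le (hD : IsOpen D) (hDb : Bornology.IsBounded D) {om : E d → ℝ}
    (hom : Continuous om) (hom0 : ∀ x ∈ frontier D, om x = 0) {q : E d → ℝ}
    {g : Fin d → E d → ℝ} (hq : ∀ i, WeakPD D i q (g i)) (mq : MemLp q 2 (volume.restrict D))
    (mg : ∀ i, MemLp (g i) 2 (volume.restrict D)) {C : ℝ} (hC : 0 < C)
    (hle : ∀ᵐ x ∂(volume.restrict D), |q x| ≤ C * om x) : IsH10 D q g := by
  have hDv : volume D ≠ ⊤ := hDb.measure_lt_top.ne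
  obtain ⟨B, hB1, hB⟩ := exists_deriv_eta_bound
  have hTc : ∀ n, ContDiff ℝ 1 (etan n) := fun n => (etan_contDiff n).of_le (by exact_mod_cast le_top)
  have hTB : ∀ n s, |deriv (etan n) s| ≤ B := fun n s => by
    rw [deriv_etan]
    exact hB _
  -- Truncating the small values of q removes a neighbourhood of the boundary, because |q| ≤ C om
  -- and `om` tends to zero there.
  set t : ℕ → E d → ℝ := fun n x => etan n (q x) with ht
  set t' : ℕ → Fin d → E d → ℝ := fun n i x => deriv (etan n) (q x) * g i x with ht'
  have wt : ∀ n i, WeakPD D i (t n) (t' n i) := fun n i =>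
    (hq i).comp hD hDv (hTc n) (hTB n) mq (mg i)
  have mt : ∀ n, MemLp (t n) 2 (volume.restrict D) := fun n =>
    memLp_comp_of_deriv_bounded hDv (hTc n) (hTB n) mq
  have mt' : ∀ n i, MemLp (t' n i) 2 (volume.restrict D) := fun n i =>
    memLp_mul_bounded (mg i)
      (((hTc n).continuous_deriv le_rfl).comp_aestronglyMeasurable mq.1)
      (Eventually.of_forall fun x => hTB n (q x))
  set k : Fin d → E d → ℝ := fun i x => (if q x = 0 then 0 else 1) * g i x with hk
  have lim0 : Tendsto (fun n => eLpNorm (t n - q) 2 (volume.restrict D)) atTop (𝓝 0) := by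
    refine tendsto_eLpNorm_sub_of_dominated (G := fun x => 2 * q x) (fun n => (mt n).1) mq.1
      (mq.const_mul 2) (fun n => Eventually.of_forall fun x => ?_)
      (Eventually.of_forall fun x => tendsto_etan (q x))
    have h1 := abs_etan_le n (q x)
    have h2 := abs_sub (etan n (q x)) (q x)
    rw [abs_mul, abs_two]
    simp only [ht]
    linarith
  have mk : ∀ i, AEStronglyMeasurable (k i) (volume.restrict D) := fun i =>
    aestronglyMeasurable_of_tendsto_ae atTop (fun n => (mt' n i).1)
      (Eventually.of_forall fun x => (tendsto_deriv_etan (q x)).mul_const (g i x))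
  have hkg : ∀ i x, |k i x| ≤ |g i x| := fun i x => by
    simp only [hk]
    split_ifs <;> simp
  have mk2 : ∀ i, MemLp (k i) 2 (volume.restrict D) := fun i =>
    (mg i).mono (mk i) (Eventually.of_forall fun x => hkg i x)
  have lim1 : ∀ i, Tendsto (fun n => eLpNorm (t' n i - k i) 2 (volume.restrict D)) atTop (𝓝 0) := by
    intro i
    refine tendsto_eLpNorm_sub_of_dominated (G := fun x => (B + 1) * g i x)
      (fun n => (mt' n i).1) (mk i)
      ((mg i).const_mul (B + 1)) (fun n => Eventually.of_forall fun x => ?_)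
      (Eventually.of_forall fun x => (tendsto_deriv_etan (q x)).mul_const (g i x))
    have h1 := hTB n (q x)
    have h2 := abs_sub (t' n i x) (k i x)
    have h3 := hkg i x
    rw [abs_mul, abs_of_pos (show 0 < B + 1 by linarith), add_mul, one_mul]
    have h4 : |t' n i x| ≤ B * |g i x| := by
      simp only [ht', abs_mul]
      gcongr
    linarith
  have hfin : IsFiniteMeasure (volume.restrict D) := ⟨by simpa using hDv.lt_top⟩
  -- Passing to the limit in the truncations gives q the weak derivative 1_{q ≠ 0} g. By uniqueness
  -- it equals g, that is, g vanishes almost everywhere on {q = 0}.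
  have wk : ∀ i, WeakPD D i q (k i) := fun i => by
    have ik : IntegrableOn (k i) D := (mk2 i).integrable one_le_two
    refine ⟨(hq i).1, ik.locallyIntegrableOn, fun φ hφ hc hs => ?_⟩
    have c1 := continuous_pd (hφ.of_le (by exact_mod_cast le_top)) (basisVec i)
    have l1 := tendsto_integral_mul_of_eLpNorm mq mt
      (memLp_test c1 (hasCompactSupport_pd hc _) 2 D) lim0
    have l2 := tendsto_integral_mul_of_eLpNorm (mk2 i) (fun n => mt' n i)
      (memLp_test hφ.continuous hc 2 D) (lim1 i)
    refine tendsto_nhds_unique l1 (l2.neg.congr fun n => ?_)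
    exact ((wt n i).2.2 φ hφ hc hs).symm
  have ekg : ∀ i, k i =ᵐ[volume.restrict D] g i := fun i => (wk i).unique hD (hq i)
  have key : ∀ δ : ENNReal, 0 < δ → ∃ φ : E d → ℝ, ContDiff ℝ ∞ φ ∧ HasCompactSupport φ ∧
      tsupport φ ⊆ D ∧ eLpNorm (φ - q) 2 (volume.restrict D) ≤ δ ∧
      ∀ i, eLpNorm ((fun x => fderiv ℝ φ x (basisVec i)) - g i) 2 (volume.restrict D) ≤ δ := by
    intro δ hδ
    have hδ2 : 0 < δ / 2 := ENNReal.half_pos hδ.ne'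
    obtain ⟨N, hN⟩ := ENNReal.tendsto_atTop_zero.1 lim0 _ hδ2
    choose N' hN' using fun i => ENNReal.tendsto_atTop_zero.1 (lim1 i) _ hδ2
    set n := max N (Finset.univ.sup N') with hn
    -- Where om < 1/((n+1)C) the domination gives |q| < 1/(n+1), the range on which `etan n` and its
    -- derivative vanish.
    have hs : 0 < 1 / ((n : ℝ) + 1) / C := by positivity
    obtain ⟨hK, hKD⟩ := isCompact_superlevel hD hDb hom hom0 hs
    set K := closure D ∩ {x | 1 / ((n : ℝ) + 1) / C ≤ om x} with hKdef
    have hsmall : ∀ᵐ x ∂(volume.restrict D), x ∉ K → |q x| < 1 / ((n : ℝ) + 1) := by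
      filter_upwards [hle, ae_restrict_mem hD.measurableSet] with x hx hxD hxK
      refine hx.trans_lt ?_
      have : om x < 1 / ((n : ℝ) + 1) / C := by
        by_contra hc
        exact hxK ⟨subset_closure hxD, not_lt.1 hc⟩
      rwa [lt_div_iff₀ hC, mul_comm] at this
    have et : t n =ᵐ[volume.restrict D] K.indicator (t n) := by
      filter_upwards [hsmall] with x hx
      by_cases hxK : x ∈ K
      · rw [indicator_of_mem hxK]
      · rw [indicator_of_notMem hxK]
        exact etan_eq_zero (hx hxK).le
    have et' : ∀ i, t' n i =ᵐ[volume.restrict D] K.indicator (t' n i) := fun i => by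
      filter_upwards [hsmall] with x hx
      by_cases hxK : x ∈ K
      · rw [indicator_of_mem hxK]
      · rw [indicator_of_notMem hxK]
        simp only [ht', deriv_etan_eq_zero (hx hxK), zero_mul]
    have hmono : volume.restrict K ≤ volume.restrict D := Measure.restrict_mono hKD le_rfl
    obtain ⟨φ, h1, h2, h3, h4, h5⟩ := exists_test_approx hD hK hKD
      (fun i => (wt n i).congr_ae et (et' i))
      (memLp_indicator hK.measurableSet ((mt n).mono_measure hmono))
      (fun i => memLp_indicator hK.measurableSet ((mt' n i).mono_measure hmono)) hδ2
    have htri : ∀ {a b c c' : E d → ℝ}, AEStronglyMeasurable a (volume.restrict D) →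
        AEStronglyMeasurable b (volume.restrict D) → AEStronglyMeasurable c (volume.restrict D) →
        c =ᵐ[volume.restrict D] c' →
        eLpNorm (a - b) 2 volume ≤ δ / 2 → eLpNorm (b - c) 2 (volume.restrict D) ≤ δ / 2 →
        eLpNorm (a - c') 2 (volume.restrict D) ≤ δ := by
      intro a b c c' ha hb hc hcc h6 h7
      have e : eLpNorm (a - c') 2 (volume.restrict D) =
          eLpNorm ((a - b) + (b - c)) 2 (volume.restrict D) := by
        rw [sub_add_sub_cancel]
        exact eLpNorm_congr_ae ((ae_eq_refl a).sub hcc.symm)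
      rw [e]
      refine (eLpNorm_add_le (ha.sub hb) (hb.sub hc) one_le_two).trans ?_
      rw [← ENNReal.add_halves δ]
      exact add_le_add ((eLpNorm_restrict_le _ _ _ D).trans h6) h7
    refine ⟨φ, h1, h2, h3, htri h1.continuous.aestronglyMeasurable ((mt n).1.congr et) mq.1
      (ae_eq_refl q) h4 ?_, fun i => htri
      (measurable_pd φ (basisVec i)).aestronglyMeasurable ((mt' n i).1.congr (et' i)) (mk i) (ekg i)
      (h5 i) ?_⟩
    · rw [eLpNorm_congr_ae (et.symm.sub (ae_eq_refl q))]
      exact hN n (le_max_left _ _)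
    · rw [eLpNorm_congr_ae ((et' i).symm.sub (ae_eq_refl (k i)))]
      exact hN' i n ((Finset.le_sup (Finset.mem_univ i)).trans (le_max_right _ _))
  refine ⟨mq, mg, ?_⟩
  have hδpos : ∀ n : ℕ, (0 : ENNReal) < ENNReal.ofReal (1 / ((n : ℝ) + 1)) := fun n =>
    ENNReal.ofReal_pos.2 (by positivity)
  have hδlim : Tendsto (fun n : ℕ => ENNReal.ofReal (1 / ((n : ℝ) + 1))) atTop (𝓝 0) := by
    have := ENNReal.tendsto_ofReal tendsto_one_div_add_atTop_nhds_zero_nat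
    rwa [ENNReal.ofReal_zero] at this
  choose φ h1 h2 h3 h4 h5 using fun n : ℕ => key _ (hδpos n)
  exact ⟨φ, fun n => ⟨h1 n, h2 n, h3 n⟩,
    tendsto_of_tendsto_of_tendsto_of_le_of_le tendsto_const_nhds hδlim (fun _ => zero_le) h4,
    fun i => tendsto_of_tendsto_of_tendsto_of_le_of_le tendsto_const_nhds hδlim
      (fun _ => zero_le) fun n => h5 n i⟩

/-- The norm is at most the sum of the absolute coordinates, so the triangle inequality in L²
reduces vector convergence to scalar convergence. -/
lemma tendsto_eLpNorm_of_coord {α : Type*} [MeasurableSpace α] {μ : Measure α}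
    {w : ℕ → α → E d} (hw : ∀ n, AEStronglyMeasurable (w n) μ)
    (h : ∀ k, Tendsto (fun n => eLpNorm (fun x => w n x k) 2 μ) atTop (𝓝 0)) :
    Tendsto (fun n => eLpNorm (w n) 2 μ) atTop (𝓝 0) := by
  have h1 : Tendsto (fun n => ∑ k, eLpNorm (fun x => w n x k) 2 μ) atTop (𝓝 (∑ _k : Fin d, 0)) :=
    tendsto_finsetSum _ fun k _ => h k
  rw [Finset.sum_const_zero] at h1
  refine tendsto_of_tendsto_of_tendsto_of_le_of_le tendsto_const_nhds h1 (fun _ => zero_le)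
    fun n => ?_
  have hm : ∀ k, AEStronglyMeasurable (fun x => ‖w n x k‖) μ := fun k =>
    ((EuclideanSpace.proj k : E d →L[ℝ] ℝ).continuous.comp_aestronglyMeasurable (hw n)).norm
  have h2 : eLpNorm (w n) 2 μ ≤ eLpNorm (∑ k, fun x => ‖w n x k‖) 2 μ := by
    refine eLpNorm_mono fun x => ?_
    rw [Finset.sum_apply, Real.norm_of_nonneg (Finset.sum_nonneg fun _ _ => norm_nonneg _)]
    exact norm_le_sum_abs_apply _
  refine h2.trans ((eLpNorm_sum_le (fun k _ => hm k) one_le_two).trans (le_of_eq ?_))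
  exact Finset.sum_congr rfl fun k _ => eLpNorm_norm _

/-- A field belongs to `H^1_0` if its components do. -/
theorem memH10_of_coord (hD : IsOpen D) {q : E d → E d} {g : Fin d → E d → E d}
    (hq : ∀ i, WeakPD D i q (g i)) (mq : MemLp q 2 (volume.restrict D))
    (mg : ∀ i, MemLp (g i) 2 (volume.restrict D))
    (h : ∀ k, IsH10 D (fun x => q x k) (fun i x => g i x k)) : MemH10 D q := by
  refine ⟨⟨mq, fun i => ⟨g i, hq i, mg i⟩⟩, fun δ hδ => ?_⟩
  choose φ h1 h2 h3 using fun k => (h k).exists_seq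
  set Φ : ℕ → E d → E d := fun n x => ∑ k, φ k n x • basisVec k with hΦ
  have hsm : ∀ n, ContDiff ℝ ∞ (Φ n) := fun n =>
    ContDiff.sum fun k _ => ((h1 k n).1).smul contDiff_const
  have hts : ∀ n, tsupport (Φ n) ⊆ ⋃ k, tsupport (φ k n) := fun n => by
    refine closure_minimal (fun x hx => ?_) (isClosed_iUnion_of_finite fun k => isClosed_tsupport _)
    by_contra hc
    simp only [mem_iUnion, not_exists] at hc
    refine hx (Finset.sum_eq_zero fun k _ => ?_)
    rw [image_eq_zero_of_notMem_tsupport (hc k), zero_smul]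
  have hcs : ∀ n, HasCompactSupport (Φ n) := fun n =>
    (isCompact_iUnion fun k => (h1 k n).2.1.isCompact).of_isClosed_subset (isClosed_tsupport _)
      (hts n)
  have hcoord : ∀ n x k, (Φ n x) k = φ k n x := fun n x k => by
    simp [hΦ, basisVec, Pi.single_apply]
  have hfd : ∀ n i x k, (fderiv ℝ (Φ n) x (basisVec i)) k = fderiv ℝ (φ k n) x (basisVec i) := by
    intro n i x k
    have h4 : fderiv ℝ (φ k n) x = (EuclideanSpace.proj k : E d →L[ℝ] ℝ).comp (fderiv ℝ (Φ n) x) := by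
      have h5 := (EuclideanSpace.proj k : E d →L[ℝ] ℝ).hasFDerivAt.comp x
        ((hsm n).differentiable (by simp) x).hasFDerivAt
      rw [← h5.fderiv]
      congr 1
      ext y
      exact (hcoord n y k).symm
    rw [h4]
    rfl
  have hΦ1 : ∀ n, ContDiff ℝ 1 (Φ n) := fun n => (hsm n).of_le (by exact_mod_cast le_top)
  have hpm : ∀ n i, AEStronglyMeasurable (fun x => fderiv ℝ (Φ n) x (basisVec i))
      (volume.restrict D) := fun n i =>
    (((hΦ1 n).continuous_fderiv one_ne_zero).clm_apply continuous_const).aestronglyMeasurable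
  have l0 : Tendsto (fun n => l2Norm D (q - Φ n)) atTop (𝓝 0) := by
    have h5 : Tendsto (fun n => eLpNorm (q - Φ n) 2 (volume.restrict D)) atTop (𝓝 0) := by
      refine tendsto_eLpNorm_of_coord (fun n => mq.1.sub (hsm n).continuous.aestronglyMeasurable)
        fun k => (h2 k).congr fun n => ?_
      rw [eLpNorm_sub_comm]
      congr 1
      ext x
      simp [hcoord]
    exact (ENNReal.tendsto_toReal ENNReal.zero_ne_top).comp h5
  have l1 : ∀ i, Tendsto (fun n => l2Norm D (weakPartial D i (q - Φ n))) atTop (𝓝 0) := by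
    intro i
    have h5 : Tendsto (fun n => eLpNorm (g i - fun x => fderiv ℝ (Φ n) x (basisVec i)) 2
        (volume.restrict D)) atTop (𝓝 0) := by
      refine tendsto_eLpNorm_of_coord (fun n => (mg i).1.sub (hpm n i))
        fun k => (h3 k i).congr fun n => ?_
      rw [eLpNorm_sub_comm]
      congr 1
      ext x
      simp [hfd]
    refine ((ENNReal.tendsto_toReal ENNReal.zero_ne_top).comp h5).congr fun n => ?_
    exact l2Norm_congr_ae (weakPartial_ae_eq hD ((hq i).sub (WeakPD.of_contDiff D i (hΦ1 n)))).symm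
  have l2 : Tendsto (fun n => h1Norm D (q - Φ n)) atTop
      (𝓝 (Real.sqrt (0 ^ 2 + ∑ _i : Fin d, (0 : ℝ) ^ 2))) :=
    (Real.continuous_sqrt.tendsto _).comp
      ((l0.pow 2).add (tendsto_finsetSum _ fun i _ => (l1 i).pow 2))
  have h6 : Real.sqrt (0 ^ 2 + ∑ _i : Fin d, (0 : ℝ) ^ 2) = 0 := by simp
  rw [h6] at l2
  obtain ⟨n, hn⟩ := (l2.eventually (gt_mem_nhds hδ)).exists
  refine ⟨Φ n, hsm n, hcs n, (hts n).trans (iUnion_subset fun k => (h1 k n).2.2), hn⟩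

end VanishingTrace

end Peridynamics

namespace Peridynamics

/-! ### The norm estimate and the theorem -/

section Conclusion

variable {d : ℕ} {D : Set (E d)}

lemma IsH10.sub {a b : E d → ℝ} {a' b' : Fin d → E d → ℝ} (ha : IsH10 D a a')
    (hb : IsH10 D b b') : IsH10 D (fun x => a x - b x) (fun i x => a' i x - b' i x) := by
  obtain ⟨φ, h1, h2, h3⟩ := ha.exists_seq
  obtain ⟨ψ, k1, k2, k3⟩ := hb.exists_seq
  have hlim : ∀ {f g : ℕ → E d → ℝ} {a b : E d → ℝ},
      (∀ n, AEStronglyMeasurable (f n - a) (volume.restrict D)) →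
      (∀ n, AEStronglyMeasurable (g n - b) (volume.restrict D)) →
      Tendsto (fun n => eLpNorm (f n - a) 2 (volume.restrict D)) atTop (𝓝 0) →
      Tendsto (fun n => eLpNorm (g n - b) 2 (volume.restrict D)) atTop (𝓝 0) →
      Tendsto (fun n => eLpNorm ((fun x => f n x - g n x) - fun x => a x - b x) 2
        (volume.restrict D)) atTop (𝓝 0) := by
    intro f g a b mf mg hf hg
    have h4 := hf.add hg
    rw [add_zero] at h4
    refine tendsto_of_tendsto_of_tendsto_of_le_of_le tendsto_const_nhds h4 (fun _ => zero_le)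
      fun n => ?_
    have e : ((fun x => f n x - g n x) - fun x => a x - b x) = (f n - a) - (g n - b) := by
      ext x
      simp only [Pi.sub_apply]
      ring
    rw [e]
    exact eLpNorm_sub_le (mf n) (mg n) one_le_two
  refine ⟨ha.memLp.sub hb.memLp, fun i => (ha.memLp' i).sub (hb.memLp' i),
    fun n x => φ n x - ψ n x, fun n => ⟨(h1 n).1.sub (k1 n).1, (h1 n).2.1.sub (k1 n).2.1,
      (tsupport_sub (φ n) (ψ n)).trans (union_subset (h1 n).2.2 (k1 n).2.2)⟩,
    hlim (fun n => (h1 n).1.continuous.aestronglyMeasurable.sub ha.memLp.1)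
      (fun n => (k1 n).1.continuous.aestronglyMeasurable.sub hb.memLp.1) h2 k2, fun i => ?_⟩
  have := hlim (fun n => (measurable_pd (φ n) (basisVec i)).aestronglyMeasurable.sub
    (ha.memLp' i).1) (fun n => (measurable_pd (ψ n) (basisVec i)).aestronglyMeasurable.sub
    (hb.memLp' i).1) (h3 i) (k3 i)
  refine this.congr fun n => ?_
  congr 1
  ext x
  rw [Pi.sub_apply, Pi.sub_apply, fderiv_fun_sub ((h1 n).1.differentiable (by simp) x)
    ((k1 n).1.differentiable (by simp) x)]
  rfl

lemma MemW.sub (hD : IsOpen D) {v w : E d → E d} (hv : MemW D v) (hw : MemW D w) :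
    MemW D (v - w) := by
  choose g hg hgH using hv.1.2
  choose k hk hkH using hw.1.2
  refine ⟨⟨hv.1.1.sub hw.1.1, fun i => ⟨fun x => g i x - k i x, WeakPD.sub (hg i) (hk i),
    (hgH i).1.sub (hkH i).1, fun j => ?_⟩⟩, ?_⟩
  · obtain ⟨g', h1, h2⟩ := (hgH i).2 j
    obtain ⟨k', h3, h4⟩ := (hkH i).2 j
    exact ⟨fun x => g' x - k' x, WeakPD.sub h1 h3, h2.sub h4⟩
  · refine memH10_of_coord hD (g := fun i x => g i x - k i x)
      (fun i => WeakPD.sub (hg i) (hk i)) (hv.1.1.sub hw.1.1)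
      (fun i => (hgH i).1.sub (hkH i).1) fun c => ?_
    exact (MemH10.isH10 hD hv.2 hg (EuclideanSpace.proj c : E d →L[ℝ] ℝ)).sub
      (MemH10.isH10 hD hw.2 hk (EuclideanSpace.proj c : E d →L[ℝ] ℝ))

lemma LpLe.l2Norm_le {u : E d → E d} {Z : ℝ} (hZ : 0 ≤ Z) (h : LpLe 2 (volume.restrict D) u Z) :
    l2Norm D u ≤ Z := by
  have := ENNReal.toReal_mono ENNReal.ofReal_ne_top h.2
  rwa [ENNReal.toReal_ofReal hZ] at this

lemma h2Norm_le (hD : IsOpen D) {q : E d → E d} {q₁ : Fin d → E d → E d}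
    {q₂ : Fin d → Fin d → E d → E d} (h₁ : ∀ i, WeakPD D i q (q₁ i))
    (h₂ : ∀ i j, WeakPD D j (q₁ i) (q₂ i j)) {Z : ℝ} (hZ : 0 ≤ Z)
    (l₀ : LpLe 2 (volume.restrict D) q Z) (l₁ : ∀ i, LpLe 2 (volume.restrict D) (q₁ i) Z)
    (l₂ : ∀ i j, LpLe 2 (volume.restrict D) (q₂ i j) Z) : h2Norm D q ≤ (1 + d) * Z := by
  have e1 : ∀ i, l2Norm D (weakPartial D i q) = l2Norm D (q₁ i) := fun i =>
    l2Norm_congr_ae (weakPartial_ae_eq hD (h₁ i))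
  have e2 : ∀ i j, l2Norm D (weakPartial D j (weakPartial D i q)) = l2Norm D (q₂ i j) := fun i j => by
    rw [weakPartial_congr_ae (weakPartial_ae_eq hD (h₁ i))]
    exact l2Norm_congr_ae (weakPartial_ae_eq hD (h₂ i j))
  have hsq : ∀ {w : E d → E d}, LpLe 2 (volume.restrict D) w Z → l2Norm D w ^ 2 ≤ Z ^ 2 :=
    fun hw => pow_le_pow_left₀ ENNReal.toReal_nonneg (hw.l2Norm_le hZ) 2
  refine Real.sqrt_le_iff.2 ⟨by positivity, ?_⟩
  simp only [e1, e2]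
  calc l2Norm D q ^ 2 + ∑ i, l2Norm D (q₁ i) ^ 2 + ∑ i, ∑ j, l2Norm D (q₂ i j) ^ 2
      ≤ Z ^ 2 + ∑ _i : Fin d, Z ^ 2 + ∑ _i : Fin d, ∑ _j : Fin d, Z ^ 2 := by
        exact add_le_add (add_le_add (hsq l₀) (Finset.sum_le_sum fun i _ => hsq (l₁ i)))
          (Finset.sum_le_sum fun i _ => Finset.sum_le_sum fun j _ => hsq (l₂ i j))
    -- There are 1, d and d² terms of the three orders, and 1 + d + d² ≤ (1 + d)².
    _ = (1 + d + d ^ 2) * Z ^ 2 := by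
        simp only [Finset.sum_const, Finset.card_univ, Fintype.card_fin, nsmul_eq_mul]
        ring
    _ ≤ ((1 + d) * Z) ^ 2 := by
        have : 0 ≤ (d : ℝ) * Z ^ 2 := by positivity
        linarith

/-- Fields in `H^1` dominated by a continuous function that vanishes on the boundary are in
`H^1_0`. -/
theorem memH10_of_norm_le (hD : IsOpen D) (hDb : Bornology.IsBounded D) {om : E d → ℝ}
    (hom : Continuous om) (hom0 : ∀ x ∈ frontier D, om x = 0) {q : E d → E d}
    {g : Fin d → E d → E d} (hq : ∀ i, WeakPD D i q (g i)) (mq : MemLp q 2 (volume.restrict D))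
    (mg : ∀ i, MemLp (g i) 2 (volume.restrict D)) {C : ℝ} (hC : 0 < C)
    (hle : ∀ᵐ x ∂(volume.restrict D), ‖q x‖ ≤ C * om x) : MemH10 D q := by
  refine memH10_of_coord hD hq mq mg fun k => isH10_of_abs_le hD hDb hom hom0
    (fun i => (hq i).clm_comp (EuclideanSpace.proj k : E d →L[ℝ] ℝ))
    ((EuclideanSpace.proj k : E d →L[ℝ] ℝ).comp_memLp' mq)
    (fun i => (EuclideanSpace.proj k : E d →L[ℝ] ℝ).comp_memLp' (mg i)) hC ?_
  filter_upwards [hle] with x hx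
  exact (PiLp.norm_apply_le (q x) k).trans hx

/-- `Q` is dominated by the boundary function. -/
lemma exists_norm_Q_le (hd : 2 ≤ d) {f : ℝ → ℝ} (hf : IsPotentialFunction f) {CF : ℝ}
    (hF : IsBddC2 (potDeriv f) CF) {J : ℝ → ℝ} {M : ℝ} (hJ : IsInfluenceFunction J M)
    {ε C₁ C₂ : ℝ} (hε : 0 < ε) {om : E d → ℝ} (hom : IsBoundaryFunction D ε C₁ C₂ om)
    {u v : E d → E d} (hu : AEStronglyMeasurable (D.indicator u))
    (hv : AEStronglyMeasurable (D.indicator v)) {K : ℝ} (hK : ∀ᵐ y, ‖D.indicator v y‖ ≤ K) :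
    ∃ C : ℝ, 0 < C ∧ ∀ᵐ x, ‖Q D f J om ε v u x‖ ≤ C * om x := by
  set I := ∫ z in Metric.ball (0 : E d) ε, ‖z‖⁻¹ with hI
  have hI0 : 0 ≤ I := integral_nonneg fun z => by positivity
  set b : ℝ := 2 / (ε ^ d * (volume (Metric.ball (0 : E d) 1)).toReal) with hb
  have hb0 : 0 ≤ b := by positivity
  set C := b * (M / ε * CF * ((K + K) * I)) with hC
  refine ⟨|C| + 1, by positivity, ?_⟩
  filter_upwards [hK] with x hx
  have hCF : 0 ≤ CF := (abs_nonneg _).trans (hF.bd 0)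
  have hM : 0 ≤ M := (hJ.nonneg 0 le_rfl one_pos).trans (hJ.le 0 le_rfl one_pos)
  have hom0 := hom.nonneg x
  have h1 := (integrableOn_bondForceDeriv hd hf hF hJ hε hom hu hv hK x).2
  rw [Q, norm_smul, Real.norm_of_nonneg hb0]
  calc b * ‖∫ y in Metric.ball x ε, bondForceDeriv f J om ε (D.indicator v) (D.indicator u) x y‖
      ≤ b * (om x * (M / ε * CF) * ((K + ‖D.indicator v x‖) * I)) :=
        mul_le_mul_of_nonneg_left h1 hb0
    _ ≤ b * (om x * (M / ε * CF) * ((K + K) * I)) := by gcongr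
    _ = C * om x := by rw [hC]; ring
    _ ≤ (|C| + 1) * om x := by
        gcongr
        linarith [le_abs_self C]

/-- The exponents -1 and -7/4 add up to -11/4 ≥ -3, and ε < 1. The embedding constant is separated
from the norm of u by 1 + CN + (CN)² ≤ (1 + C + C²)(1 + N + N²). Passing from L to L + 1 makes the
final constant positive. -/
lemma constant_le {ε Nu Nv Cr B t L X : ℝ} (hε : 0 < ε) (hε1 : ε < 1) (hNu : 0 ≤ Nu) (hNv : 0 ≤ Nv)
    (hCr : 0 ≤ Cr) (hB : 0 ≤ t * B) (hL : L = 40 * (t * B) * (1 + Cr + Cr ^ 2) * Cr)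
    (hX : X = 40 * (t * B) * (1 + Cr * Nu + (Cr * Nu) ^ 2) * (Cr * Nv) *
      (ε⁻¹ * ε ^ (-(7 / 4) : ℝ))) :
    X ≤ (L + 1) * (1 + Nu + Nu ^ 2) / ε ^ 3 * Nv := by
  have hpow : ε⁻¹ * ε ^ (-(7 / 4) : ℝ) ≤ (ε ^ 3)⁻¹ := by
    rw [← Real.rpow_neg_one, ← Real.rpow_add hε, ← Real.rpow_natCast, ← Real.rpow_neg hε.le]
    exact Real.rpow_le_rpow_of_exponent_ge hε hε1.le (by norm_num)
  have hq : 1 + Cr * Nu + (Cr * Nu) ^ 2 ≤ (1 + Cr + Cr ^ 2) * (1 + Nu + Nu ^ 2) := by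
    have : 0 ≤ Nu + Nu ^ 2 + Cr + Cr * Nu ^ 2 + Cr ^ 2 + Cr ^ 2 * Nu := by positivity
    linarith [mul_pow Cr Nu 2]
  rw [hX]
  calc 40 * (t * B) * (1 + Cr * Nu + (Cr * Nu) ^ 2) * (Cr * Nv) * (ε⁻¹ * ε ^ (-(7 / 4) : ℝ))
      ≤ 40 * (t * B) * ((1 + Cr + Cr ^ 2) * (1 + Nu + Nu ^ 2)) * (Cr * Nv) * (ε ^ 3)⁻¹ := by gcongr
    _ = L * (1 + Nu + Nu ^ 2) / ε ^ 3 * Nv := by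
        rw [hL, div_eq_mul_inv]
        ring
    _ ≤ (L + 1) * (1 + Nu + Nu ^ 2) / ε ^ 3 * Nv := by
        gcongr
        linarith

/-- The operator `Q(·; u)` is bounded on `H^2 ∩ H^1_0`. -/
theorem exists_Q_bound (hd : d = 2 ∨ d = 3) (hD : IsOpen D) (hDb : Bornology.IsBounded D)
    {f : ℝ → ℝ} (hf : IsPotentialFunction f) {J : ℝ → ℝ} {M : ℝ} (hJ : IsInfluenceFunction J M)
    (C₁ C₂ : ℝ) :
    ∃ L : ℝ, 0 < L ∧ ∀ ε : ℝ, 0 < ε → ε < 1 → ∀ om : E d → ℝ, IsBoundaryFunction D ε C₁ C₂ om →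
      ∀ u v : E d → E d, MemW D u → MemW D v →
        (∀ x, IntegrableOn (bondForceDeriv f J om ε (D.indicator v) (D.indicator u) x)
          (Metric.ball x ε)) ∧
        MemW D (Q D f J om ε v u) ∧
        h2Norm D (Q D f J om ε v u) ≤
          L * (1 + h2Norm D u + h2Norm D u ^ 2) / ε ^ 3 * h2Norm D v := by
  have hd2 : 2 ≤ d := by omega
  obtain ⟨CF, hF⟩ := hf.exists_isBddC2
  obtain ⟨Cr, hCr0, hCr⟩ := exists_isRegular hd hD hDb
  have hCF : 0 ≤ CF := (abs_nonneg _).trans (hF.bd 0)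
  have hM : 0 ≤ M := (hJ.nonneg 0 le_rfl one_pos).trans (hJ.le 0 le_rfl one_pos)
  set V : ℝ := 1 + (volume D).toReal with hVdef
  have hV1 : 1 ≤ V := le_add_of_nonneg_right ENNReal.toReal_nonneg
  have hV : volume D ≤ ENNReal.ofReal V := by
    rw [← ENNReal.ofReal_toReal hDb.measure_lt_top.ne]
    exact ENNReal.ofReal_le_ofReal (le_add_of_nonneg_left zero_le_one)
  have hV0 : 0 ≤ V := zero_le_one.trans hV1
  set W := bondWeight d with hW
  have hW0 : 0 ≤ W := integral_nonneg fun ξ => by positivity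
  set c : ℝ := 2 / (volume (Metric.ball (0 : E d) 1)).toReal with hc
  have hc0 : 0 ≤ c := by positivity
  set L₀ : ℝ := (1 + d) * (c * (M * ((1 + (|C₁| + |C₂|)) *
    (10 * CF * V * (1 + Cr + Cr ^ 2) * Cr) * 4) * W)) with hL₀
  have hL₀0 : 0 ≤ L₀ := by positivity
  refine ⟨L₀ + 1, by positivity, fun ε hε hε1 om hom u v hu hv => ?_⟩
  obtain ⟨u₀, u₁, u₂, ru, eu⟩ := hCr u hu
  obtain ⟨v₀, v₁, v₂, rv, ev⟩ := hCr v hv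
  set Nu := h2Norm D u with hNu
  set Nv := h2Norm D v with hNv
  have hNu0 : 0 ≤ Nu := Real.sqrt_nonneg _
  have hNv0 : 0 ≤ Nv := Real.sqrt_nonneg _
  have hKv0 : 0 ≤ Cr * Nv := by positivity
  have hvK : ∀ᵐ y, ‖D.indicator v y‖ ≤ Cr * Nv := by
    filter_upwards [ev, rv.sup] with y h1 h2
    rwa [h1]
  have mu : AEStronglyMeasurable (D.indicator u) :=
    ru.meas.aestronglyMeasurable.congr eu.symm
  have mv : AEStronglyMeasurable (D.indicator v) :=
    rv.meas.aestronglyMeasurable.congr ev.symm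
  have hint := integrableOn_bondForceDeriv hd2 hf hF hJ hε hom mu mv hvK
  obtain ⟨q₁, q₂, w₁, w₂, l₀, l₁, l₂⟩ := integral_bondField_weakPD hd2 hD hDb hF hV hV1 hJ hε hε1 hom
    (by positivity) hKv0 ru rv rfl
  set Z := M / ε * ((1 + (|C₁| + |C₂|)) *
      (10 * CF * V * (1 + Cr * Nu + (Cr * Nu) ^ 2) * (Cr * Nv) * ε ^ (-(7 / 4) : ℝ)) * 4) *
      bondWeight d with hZ
  have hZ0 : 0 ≤ Z := by positivity
  have eQ := Q_ae_eq hd2 hD hf J hε hom eu ev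
  have hsm : ∀ {w : E d → E d}, LpLe 2 volume w Z →
      LpLe 2 (volume.restrict D) (fun x => c • w x) (c * Z) := fun hw =>
    (hw.restrict D).of_le_mul (hw.1.restrict.const_smul c) hc0 (Eventually.of_forall fun x => by
      rw [norm_smul, Real.norm_of_nonneg hc0])
  have W₁ : ∀ i, WeakPD D i (Q D f J om ε v u) (fun x => c • q₁ i x) := fun i =>
    ((w₁ i).const_smul c).congr_ae eQ.symm (ae_eq_refl _)
  have W₂ : ∀ i j, WeakPD D j (fun x => c • q₁ i x) (fun x => c • q₂ i j x) := fun i j =>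
    (w₂ i j).const_smul c
  have lQ : LpLe 2 (volume.restrict D) (Q D f J om ε v u) (c * Z) := by
    have := hsm l₀
    exact ⟨this.1.congr eQ.symm, by rw [eLpNorm_congr_ae eQ]; exact this.2⟩
  have lQ₁ := fun i => hsm (l₁ i)
  have lQ₂ := fun i j => hsm (l₂ i j)
  refine ⟨fun x => (hint x).1, ⟨⟨lQ.memLp, fun i => ⟨_, W₁ i, (lQ₁ i).memLp, fun j =>
    ⟨_, W₂ i j, (lQ₂ i j).memLp⟩⟩⟩, ?_⟩, ?_⟩
  -- Here C may depend on u, v and ε: only the qualitative vanishing of Q at the boundary is used.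
  · obtain ⟨C, hC, hle⟩ := exists_norm_Q_le hd2 hf hF hJ hε hom mu mv hvK
    exact memH10_of_norm_le hD hDb hom.cont hom.eq_zero W₁ lQ.memLp (fun i => (lQ₁ i).memLp) hC
      (ae_restrict_of_ae hle)
  · refine (h2Norm_le hD W₁ W₂ (by positivity) lQ lQ₁ lQ₂).trans ?_
    rw [hZ, ← hW]
    exact constant_le hε hε1 hNu0 hNv0 hCr0 (t := 1 + d) (B := M * (1 + (|C₁| + |C₂|)) * CF * V * W * c)
      (by positivity) (by rw [hL₀]; ring) (by ring)

lemma Q_sub {f J : ℝ → ℝ} {om : E d → ℝ} {ε : ℝ} {u v w : E d → E d} {x : E d}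
    (hv : IntegrableOn (bondForceDeriv f J om ε (D.indicator v) (D.indicator u) x)
      (Metric.ball x ε))
    (hw : IntegrableOn (bondForceDeriv f J om ε (D.indicator w) (D.indicator u) x)
      (Metric.ball x ε)) :
    Q D f J om ε (v - w) u x = Q D f J om ε v u x - Q D f J om ε w u x := by
  simp only [Q, bondForceDeriv_sub]
  rw [integral_sub hv hw, smul_sub]

end Conclusion

end Peridynamics

theorem mainTheorem5 (d : ℕ) (hd : d = 2 ∨ d = 3)
    (D : Set (Peridynamics.E d)) (hD_open : IsOpen D) (hD_bdd : Bornology.IsBounded D)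
    (hD_C1 : Peridynamics.HasC1Boundary D)
    (f : ℝ → ℝ) (hf : Peridynamics.IsPotentialFunction f)
    (J : ℝ → ℝ) (M : ℝ) (hJ : Peridynamics.IsInfluenceFunction J M)
    (C₁ C₂ : ℝ) :
    ∃ L₆ : ℝ, 0 < L₆ ∧
      ∀ ε : ℝ, 0 < ε → ε < 1 →
      ∀ om : Peridynamics.E d → ℝ, Peridynamics.IsBoundaryFunction D ε C₁ C₂ om →
      ∀ u : Peridynamics.E d → Peridynamics.E d, Peridynamics.MemW D u →
        (∀ v, Peridynamics.MemW D v →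
          (∀ x ∈ D, IntegrableOn
            (Peridynamics.bondForceDeriv f J om ε (D.indicator v) (D.indicator u) x)
            (Metric.ball x ε)) ∧
          Peridynamics.MemW D (Peridynamics.Q D f J om ε v u)) ∧
        (∀ v w, Peridynamics.MemW D v → Peridynamics.MemW D w →
          Peridynamics.h2Norm D
              (Peridynamics.Q D f J om ε v u - Peridynamics.Q D f J om ε w u) ≤
            L₆ * (1 + Peridynamics.h2Norm D u + Peridynamics.h2Norm D u ^ 2) / ε ^ 3 *
              Peridynamics.h2Norm D (v - w)) ∧
        (∀ v, Peridynamics.MemW D v →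
          Peridynamics.h2Norm D (Peridynamics.Q D f J om ε v u) ≤
            L₆ * (1 + Peridynamics.h2Norm D u + Peridynamics.h2Norm D u ^ 2) / ε ^ 3 *
              Peridynamics.h2Norm D v) := by
  obtain ⟨L, hL, h⟩ := Peridynamics.exists_Q_bound hd hD_open hD_bdd hf hJ C₁ C₂
  refine ⟨L, hL, fun ε hε hε1 om hom u hu => ⟨fun v hv => ?_, fun v w hv hw => ?_, fun v hv => ?_⟩⟩
  · obtain ⟨h1, h2, -⟩ := h ε hε hε1 om hom u v hu hv
    exact ⟨fun x _ => h1 x, h2⟩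
  · obtain ⟨h1, -, -⟩ := h ε hε hε1 om hom u v hu hv
    obtain ⟨k1, -, -⟩ := h ε hε hε1 om hom u w hu hw
    obtain ⟨-, -, h3⟩ := h ε hε hε1 om hom u (v - w) hu (Peridynamics.MemW.sub hD_open hv hw)
    -- Linearity in v holds as an identity of functions on the whole space, because the defining
    -- integrals converge at every x and not only in D.
    have e : Peridynamics.Q D f J om ε (v - w) u =
        Peridynamics.Q D f J om ε v u - Peridynamics.Q D f J om ε w u := by
      ext1 x
      exact Peridynamics.Q_sub (h1 x) (k1 x)
    rwa [e] at h3
  · exact (h ε hε hε1 om hom u v hu hv).2.2
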